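/- **Setting.** An episodic POMDP has finite sets $\mathcal S,\mathcal O,\mathcal A$ of states, observations and actions, horizon $H$, initial distribution $\mu_1$, transitions $\mathbb T_h(s'|s,a)$, emissions $\mathbb O_h(o|s)$ and known rewards $r_h(o_h,a_h)\in[0,1]$, $h\in[H]$. Policies are history-dependent and randomized; $\mathbb P^\pi_f(\tau_H)$ is the probability of the trajectory $\tau_H=(o_1,a_1,\dots,o_H,a_H)$ under the policy $\pi$ and the model $f$, $V^\pi_f$ is the expected total reward, and $V^*=\sup_\pi V^\pi$ for the true model. *Linear POMDPs.* Given are feature vectors $\phi_h(s,a)\in\mathbb R^{d_1}$, $\psi_h(s)\in\mathbb R^{d_2}$, $\overline\phi_h(s)\in\mathbb R^{d_3}$, $\overline\psi_h(o)\in\mathbb R^{d_4}$, $\widehat\phi(s)\in\mathbb R^{d_5}$, all of sup norm at most $1$. A parameter $f=(B_{h,1}\in\mathbb R^{d_2\times d_1},B_{h,2}\in\mathbb R^{d_4\times d_3},\theta\in\mathbb R^{d_5})_{h\in[H]}$ with all entries of absolute value at most $1$ defines a linear POMDP if $$\mathbb T_h(s'|s,a)=\psi_h(s')^\top B_{h,1}\phi_h(s,a),\quad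 \mathbb O_h(o|s)=\overline\psi_h(o)^\top B_{h,2}\overline\phi_h(s),\quad \mu_1(s)=\theta^\top\widehat\phi(s)$$ are probability distributions. Put $d_{\rm lin}=\max\{d_1,\dots,d_5\}$. *Tests, core tests, regularity.* Let $1\le m\le H$. A test $t$ consists of observations $o_{h+1:h+W}$ and actions $a_{h+1:h+W-1}$ with $h+W\le H$; $\mathbb P(t|\tau_h)$ is the probability of seeing its observations after the history $\tau_h$ when its actions are executed ($0$ if $\tau_h$ is unreachable). $D_h$ is the matrix $(\mathbb P(t|\tau_h))$ with rows all tests and columns all histories of length $h$, and $\overline D_h$ consists of its rows indexed by $\mathcal U=(\mathcal O\times\mathcal A)^{m-1}\times\mathcal O$. The set $\mathcal U$ is a core test set at step $h+1$ if $\operatorname{rank}\overline D_h=\operatorname{rank}D_h$. A core matrix $K_h$ consists of $\operatorname{rank}D_h$ linearly independent columns of $\overline D_h$; among these, $K_h$ denotes the one with the smallest $\|K_h^\dagger\|_{1\mapsto1}$, where $\dagger$ is the Moore–Penrose pseudoinverse. The POMDP is $m$-step weakly revealing if for every $h\in[H-m+1]$ the matrix with entries $\mathbb P(o_{h:h+m-1}|s_h=s,a_{h:h+m-2})$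 (columns indexed by $s$) has rank $|\mathcal S|$. *Model class.* $\mathcal F$ is a class of linear POMDPs with respect to the given features that contains the true one, $f^*\in\mathcal F$, and such that for every $f\in\mathcal F$ and every $0\le h\le H-m$, the set $\mathcal U$ is a core test set at step $h+1$ and $\|K_{h;f}^\dagger\|_{1\mapsto 1}\le1/\alpha$, where $\alpha>0$. The bracket number $\mathcal N_{\mathcal F}(\epsilon)$ is the least $N$ for which there are functions $g_1^i,g_2^i$ of $(\pi,\tau_H)$, $i\le N$, with $\sum_{\tau_H}|g^i_1(\pi,\tau_H)-g^i_2(\pi,\tau_H)|\le\epsilon$ for all $i,\pi$, such that every $f\in\mathcal F$ has an $i$ with $g_1^i(\pi,\tau_H)\le\mathbb P^\pi_f(\tau_H)\le g_2^i(\pi,\tau_H)$ for all $\pi,\tau_H$. *CRANE (executed up to step $H-m$).* Let $|\mathcal U_A|=|\mathcal A|^{m-1}$, $\epsilon_{\rm b}=1/(KH|\mathcal U_A|)$ and $\beta=c\log(\mathcal N_{\mathcal F}(\epsilon_{\rm b})KH|\mathcal U_A|/\delta)$. Start with the empty data set $\mathcal D$. For $k=1,\dots,K$: choose $(f^k,\pi^k)\in\arg\max_{f\in\mathcal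 B^k,\pi}V_f^\pi$, where $\mathcal B^k=\{f\in\mathcal F:\sum_{(\pi,\tau)\in\mathcal D}\log\mathbb P^\pi_f(\tau)\ge\max_{f'\in\mathcal F}\sum_{(\pi,\tau)\in\mathcal D}\log\mathbb P^\pi_{f'}(\tau)-\beta\}$; then, for every $h\in\{0,\dots,H-m\}$ and $u\in\mathcal A^{m-1}$, collect a trajectory by following $\pi^k$ at steps $1,\dots,h-1$, acting uniformly at step $h$, executing $u$ at steps $h+1,\dots,h+m-1$, and acting uniformly afterwards; add it with its policy to $\mathcal D$. The output $\widehat\pi$ is the uniform mixture of $\pi^1,\dots,\pi^K$. **Statement.** There are an absolute constant $c>0$ and an absolute polynomial $\mathrm{poly}$ such that in this setting, if the true linear POMDP $f^*$ is $m$-step weakly revealing, then for all $\delta\in(0,1]$, $\epsilon>0$ and every integer $$K\ \ge\ \max\Big\{1,\ \frac1{\epsilon^2}\,\mathrm{poly}\big(d_{\rm lin},|\mathcal A|^m,1/\alpha,H,\log|\mathcal O|,\log(1/\delta),\log(1+1/\epsilon)\big)\Big\},$$ CRANE run for $K$ iterations satisfies $V^{\widehat\pi}\ge V^*-\epsilon$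 with probability at least $1-\delta$. In particular $K$ need not grow polynomially with $|\mathcal S|$ or $|\mathcal O|$. -/

import Mathlib

open scoped Matrix

noncomputable section

namespace Crane

/-! ## POMDPs -/

/-- A vector of probabilities on a finite set. -/
def IsDist {X : Type*} [Fintype X] (p : X → ℝ) : Prop :=
  (∀ x, 0 ≤ p x) ∧ ∑ x, p x = 1

/-- The parameters of an episodic POMDP. Steps are numbered `1, …, H`; entries with an index
outside this range are never used.
`trans h s a s'` is the probability of `s'` given `(s, a)` at step `h`, and
`emit h s o` is the probability of the observation `o` in the state `s` at step `h`. -/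
structure POMDP (S O A : Type*) where
  init : S → ℝ
  trans : ℕ → S → A → S → ℝ
  emit : ℕ → S → O → ℝ

/-- A trajectory (or history) of `n` steps: `(o_1, a_1), …, (o_n, a_n)`. -/
abbrev Traj (O A : Type*) (n : ℕ) := Fin n → O × A

/-- A test of length `n + 1`: `n` observation-action pairs, followed by one observation. -/
abbrev Test (O A : Type*) (n : ℕ) := (Fin n → O × A) × O

namespace POMDP

variable {S O A : Type*} [Fintype S] [Fintype O] [Fintype A]

/-- Initial distribution, transitions and emissions are probability distributions. -/
def IsValid (M : POMDP S O A) (H : ℕ) : Prop :=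
  IsDist M.init ∧ ∀ h ∈ Finset.Icc 1 H,
    (∀ s a, IsDist (M.trans h s a)) ∧ ∀ s, IsDist (M.emit h s)

/-- Started at step `h` with (unnormalized) state weights `b`, the weight of each state after
the listed observations have been seen while the listed actions were executed. -/
def forward (M : POMDP S O A) : ℕ → (S → ℝ) → List (O × A) → S → ℝ
  | _, b, [] => b
  | h, b, p :: l =>
      M.forward (h + 1) (fun s' => ∑ s, b s * M.emit h s p.1 * M.trans h s p.2 s') l

/-- Probability of seeing the observations of the history when its actions are executed
(`do` operator); the history is reachable iff this is nonzero. -/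
def histProb (M : POMDP S O A) (l : List (O × A)) : ℝ :=
  ∑ s, M.forward 1 M.init l s

/-- Probability of seeing the observations of the history `l` and then of the test `(t, o)` when
their actions are executed. -/
def jointProb (M : POMDP S O A) (l t : List (O × A)) (o : O) : ℝ :=
  ∑ s, M.forward 1 M.init (l ++ t) s * M.emit (l.length + t.length + 1) s o

/-- Probability `ℙ(t | τ)` that the test `t` succeeds after the history `τ`; it is `0` (division
by zero) when the history is unreachable. -/
def testProb (M : POMDP S O A) {h n : ℕ} (t : Test O A n) (τ : Traj O A h) : ℝ :=
  M.jointProb (List.ofFn τ) (List.ofFn t.1) t.2 / M.histProb (List.ofFn τ)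

/-- The one-step system dynamics matrix `D_h`: rows are all tests that start at step `h + 1` and
end by step `H`, columns are all histories of length `h`. -/
def dynMatrix (M : POMDP S O A) (H h : ℕ) :
    Matrix (Σ n : Fin (H - h), Test O A n) (Traj O A h) ℝ :=
  Matrix.of fun t τ => M.testProb t.2 τ

/-- The rows of `D_h` that belong to the `m`-step futures `(O × A)^(m-1) × O`; the column of
`τ` is the predictive state of `τ`. -/
def predMatrix (M : POMDP S O A) (m h : ℕ) : Matrix (Test O A (m - 1)) (Traj O A h) ℝ :=
  Matrix.of fun t τ => M.testProb t τ

/-- The rank `d_{PSR,h}` of `D_h`. -/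
def psrRank (M : POMDP S O A) (H h : ℕ) : ℕ := (M.dynMatrix H h).rank

/-- The `m`-step futures form a core test set at step `h + 1`. -/
def IsCoreTestSet (M : POMDP S O A) (H m h : ℕ) : Prop :=
  (M.predMatrix m h).rank = M.psrRank H h

open Classical in
/-- The `m`-step emission matrix `𝕆_{h,m}`: entry at (test, state) is the probability of the
test's observations at the steps `h, …, h+m-1`, given `s_h = s` and the test's actions. -/
def emissionMatrix (M : POMDP S O A) (m h : ℕ) : Matrix (Test O A (m - 1)) S ℝ :=
  Matrix.of fun t s =>
    ∑ s', M.forward h (Pi.single s 1) (List.ofFn t.1) s' * M.emit (h + (m - 1)) s' t.2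

/-- The `m`-step weakly-revealing condition. -/
def IsWeaklyRevealing (M : POMDP S O A) (H m : ℕ) : Prop :=
  ∀ h ∈ Finset.Icc 1 (H - m + 1), (M.emissionMatrix m h).rank = Fintype.card S

end POMDP

/-! ## Core matrices and regularity -/

/-- The `ℓ¹` norm of a vector. -/
def l1 {ι : Type*} [Fintype ι] (x : ι → ℝ) : ℝ := ∑ i, |x i|

/-- The operator norm `‖·‖_{1 ↦ 1}` of a matrix. -/
def opNorm1 {ι κ : Type*} [Fintype ι] [Fintype κ] (B : Matrix ι κ ℝ) : ℝ :=
  ⨆ x : {x : κ → ℝ // l1 x = 1}, l1 (B *ᵥ x.1)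

/-- `B'` is the Moore–Penrose pseudoinverse of `B` (the four Penrose equations, which have exactly
one solution). -/
def IsPseudoinverse {ι κ : Type*} [Fintype ι] [Fintype κ]
    (B : Matrix ι κ ℝ) (B' : Matrix κ ι ℝ) : Prop :=
  B * B' * B = B ∧ B' * B * B' = B' ∧ (B * B')ᵀ = B * B' ∧ (B' * B)ᵀ = B' * B

/-- `K` is a core matrix at `h`: its columns are the predictive states of `d_{PSR,h}` histories
of length `h`, and it has full rank. -/
def IsCoreMatrix {S O A : Type*} [Fintype S] [Fintype O] [Fintype A] (M : POMDP S O A)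
    (H m h : ℕ) (K : Matrix (Test O A (m - 1)) (Fin (M.psrRank H h)) ℝ) : Prop :=
  (∃ τ : Fin (M.psrRank H h) → Traj O A h, K = (M.predMatrix m h).submatrix id τ) ∧
    K.rank = M.psrRank H h

/-- `α`-regularity for the `m`-step futures: for `h = 0, …, H - m` the core matrix with the
smallest `‖K†‖_{1 ↦ 1}` satisfies `‖K†‖_{1 ↦ 1} ≤ 1/α`, i.e. some core matrix does. -/
def IsRegular {S O A : Type*} [Fintype S] [Fintype O] [Fintype A] (M : POMDP S O A)
    (H m : ℕ) (α : ℝ) : Prop :=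
  ∀ h ≤ H - m, ∃ K K', IsCoreMatrix M H m h K ∧ IsPseudoinverse K K' ∧ opNorm1 K' ≤ 1 / α

/-! ## Policies and values -/

/-- A history-dependent randomized policy: `prob l o a` is the probability of the action `a` at
step `l.length + 1` after the history `l` and the current observation `o`. -/
structure Policy (O A : Type*) [Fintype A] where
  prob : List (O × A) → O → A → ℝ
  isDist : ∀ l o, IsDist (prob l o)

section Values

variable {S O A : Type*} [Fintype S] [Fintype O] [Fintype A]

/-- `π(τ)`, the product of the probabilities of the actions chosen along `τ`. -/
def Policy.weight (π : Policy O A) {n : ℕ} (τ : Traj O A n) : ℝ :=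
  ∏ i : Fin n, π.prob ((List.ofFn τ).take i) (τ i).1 (τ i).2

/-- `ℙ^π(τ_H)`, the probability of a full trajectory when `π` is executed. -/
def trajProb (M : POMDP S O A) {H : ℕ} (π : Policy O A) (τ : Traj O A H) : ℝ :=
  M.histProb (List.ofFn τ) * π.weight τ

/-- Expected cumulative reward when the trajectory has the law `p`; `r h o a` is the reward at
step `h`. -/
def expReturn {H : ℕ} (r : ℕ → O → A → ℝ) (p : Traj O A H → ℝ) : ℝ :=
  ∑ τ, p τ * ∑ i : Fin H, r ((i : ℕ) + 1) (τ i).1 (τ i).2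

/-- The value `V^π`. -/
def value (M : POMDP S O A) (H : ℕ) (r : ℕ → O → A → ℝ) (π : Policy O A) : ℝ :=
  expReturn (H := H) r (trajProb M π)

/-- The optimal value `V^*`. -/
def optValue (M : POMDP S O A) (H : ℕ) (r : ℕ → O → A → ℝ) : ℝ :=
  ⨆ π : Policy O A, value M H r π

/-- The value of the uniform mixture of the listed policies: one of them is drawn uniformly and
followed for the whole episode. -/
def mixtureValue (M : POMDP S O A) (H : ℕ) (r : ℕ → O → A → ℝ) (L : List (Policy O A)) : ℝ :=
  expReturn (H := H) r fun τ => (L.map fun π => trajProb M π τ).sum / L.length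

end Values

/-! ## Linear POMDPs -/

/-- The given feature vectors `φ, ψ, φ̄, ψ̄, φ̂`. -/
structure Features (S O A : Type*) (d₁ d₂ d₃ d₄ d₅ : ℕ) where
  φ : ℕ → S → A → Fin d₁ → ℝ
  ψ : ℕ → S → Fin d₂ → ℝ
  φbar : ℕ → S → Fin d₃ → ℝ
  ψbar : ℕ → O → Fin d₄ → ℝ
  φhat : S → Fin d₅ → ℝ

/-- The feature vectors have sup norm at most one. -/
def Features.IsBounded {S O A : Type*} {d₁ d₂ d₃ d₄ d₅ : ℕ}
    (Φ : Features S O A d₁ d₂ d₃ d₄ d₅) (H : ℕ) : Prop :=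
  (∀ h ∈ Finset.Icc 1 H,
    (∀ s a i, |Φ.φ h s a i| ≤ 1) ∧ (∀ s i, |Φ.ψ h s i| ≤ 1) ∧
    (∀ s i, |Φ.φbar h s i| ≤ 1) ∧ (∀ o i, |Φ.ψbar h o i| ≤ 1)) ∧
  ∀ s i, |Φ.φhat s i| ≤ 1

/-- The parameters `f = (B_{h,1}, B_{h,2}, θ)` of a linear model. -/
structure LinParam (d₁ d₂ d₃ d₄ d₅ : ℕ) where
  B₁ : ℕ → Matrix (Fin d₂) (Fin d₁) ℝ
  B₂ : ℕ → Matrix (Fin d₄) (Fin d₃) ℝ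
  θ : Fin d₅ → ℝ

section Linear

variable {d₁ d₂ d₃ d₄ d₅ : ℕ}

/-- The parameters are bounded by one entrywise. -/
def LinParam.IsBounded (f : LinParam d₁ d₂ d₃ d₄ d₅) (H : ℕ) : Prop :=
  (∀ h ∈ Finset.Icc 1 H, (∀ i j, |f.B₁ h i j| ≤ 1) ∧ (∀ i j, |f.B₂ h i j| ≤ 1)) ∧
  ∀ i, |f.θ i| ≤ 1

variable {S O A : Type*}

/-- The model with transitions `ψ_h(s')ᵀ B_{h,1} φ_h(s,a)`, emissions `ψ̄_h(o)ᵀ B_{h,2} φ̄_h(s)`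
and initial distribution `θᵀ φ̂(s)`. -/
def Features.model (Φ : Features S O A d₁ d₂ d₃ d₄ d₅) (f : LinParam d₁ d₂ d₃ d₄ d₅) :
    POMDP S O A where
  init s := f.θ ⬝ᵥ Φ.φhat s
  trans h s a s' := Φ.ψ h s' ⬝ᵥ (f.B₁ h *ᵥ Φ.φ h s a)
  emit h s o := Φ.ψbar h o ⬝ᵥ (f.B₂ h *ᵥ Φ.φbar h s)

variable [Fintype S] [Fintype O] [Fintype A]

/-- `f` is a linear POMDP (bounded parameters, genuine probability distributions) for which the
`m`-step futures are core test sets up to step `H - m + 1` and which is `α`-regular. -/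
def Features.IsAdmissible (Φ : Features S O A d₁ d₂ d₃ d₄ d₅) (H m : ℕ) (α : ℝ)
    (f : LinParam d₁ d₂ d₃ d₄ d₅) : Prop :=
  f.IsBounded H ∧ (Φ.model f).IsValid H ∧
    (∀ h ≤ H - m, (Φ.model f).IsCoreTestSet H m h) ∧ IsRegular (Φ.model f) H m α

/-! ## Bracketing numbers -/

/-- `(g₁, g₂)` is an `ε`-bracket of size `N` of the class `F`. -/
def IsBracket (Φ : Features S O A d₁ d₂ d₃ d₄ d₅) (H : ℕ) (F : Set (LinParam d₁ d₂ d₃ d₄ d₅))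
    (ε : ℝ) {N : ℕ} (g₁ g₂ : Fin N → Policy O A → Traj O A H → ℝ) : Prop :=
  (∀ i π, ∑ τ, |g₁ i π τ - g₂ i π τ| ≤ ε) ∧
  ∀ f ∈ F, ∃ i, ∀ π τ, g₁ i π τ ≤ trajProb (Φ.model f) π τ ∧ trajProb (Φ.model f) π τ ≤ g₂ i π τ

/-- The `ε`-bracket number `𝒩_F(ε)`. -/
def bracketNumber (Φ : Features S O A d₁ d₂ d₃ d₄ d₅) (H : ℕ)
    (F : Set (LinParam d₁ d₂ d₃ d₄ d₅)) (ε : ℝ) : ℕ :=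
  sInf {N | ∃ g₁ g₂ : Fin N → Policy O A → Traj O A H → ℝ, IsBracket Φ H F ε g₁ g₂}

end Linear

/-! ## The algorithm, executed up to step `H - m` -/

section Algorithm

variable {S O A : Type*} [Fintype S] [Fintype O] [Fintype A]

open Classical in
/-- The exploration policy `π_{1:h-1} ∘ Unif(A) ∘ u`: follow `π` at the steps `1, …, h-1`, act
uniformly at step `h`, execute the actions `u` at the steps `h+1, …, h+m-1`, and act uniformly
afterwards. -/
def Policy.explore [Nonempty A] (π : Policy O A) {m : ℕ} (h : ℕ) (u : Fin (m - 1) → A) :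
    Policy O A where
  prob l o a :=
    if l.length + 1 < h then π.prob l o a
    else if hu : h ≤ l.length ∧ l.length - h < m - 1 then
      (if a = u ⟨l.length - h, hu.2⟩ then 1 else 0)
    else 1 / Fintype.card A
  isDist l o := by
    by_cases h1 : l.length + 1 < h
    · simpa [h1] using π.isDist l o
    · by_cases hu : h ≤ l.length ∧ l.length - h < m - 1
      · simp only [h1, hu]
        refine ⟨fun a => ?_, by simp⟩
        by_cases ha : a = u ⟨l.length - h, hu.2⟩ <;> simp [ha]
      · simp only [h1, hu]
        exact ⟨fun a => by simp, by simp⟩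

/-- The pairs `(h, u)` with `h = 0, …, H - m` and `u` an action sequence of length `m - 1`: one
trajectory is collected for each of them in every iteration. -/
abbrev Index (A : Type*) (H m : ℕ) := Fin (H - m + 1) × (Fin (m - 1) → A)

/-- The trajectories collected in one iteration. -/
abbrev Batch (O A : Type*) (H m : ℕ) := Index A H m → Traj O A H

/-- What the algorithm stores in one iteration: its policy and the trajectories collected with the
exploration policies built from it. A data set is a list of records, oldest first. -/
abbrev Record (O A : Type*) [Fintype A] (H m : ℕ) := Policy O A × Batch O A H m

/-- The likelihood of a data set under a model, i.e. the probability of the stored trajectories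
under the exploration policies of the stored policies. -/
def likelihood [Nonempty A] (M : POMDP S O A) {H m : ℕ} (D : List (Record O A H m)) : ℝ :=
  (D.map fun ρ => ∏ i : Index A H m, trajProb M (ρ.1.explore i.1 i.2) (ρ.2 i)).prod

variable {d₁ d₂ d₃ d₄ d₅ : ℕ}

/-- The confidence set: the models in `F` whose log-likelihood is at least the maximal one minus
`β` (in exponentiated form, so that the logarithm of zero is `-∞`). -/
def confSet [Nonempty A] (Φ : Features S O A d₁ d₂ d₃ d₄ d₅) (F : Set (LinParam d₁ d₂ d₃ d₄ d₅))
    (β : ℝ) {H m : ℕ} (D : List (Record O A H m)) : Set (LinParam d₁ d₂ d₃ d₄ d₅) :=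
  {f ∈ F | ∀ f' ∈ F,
    Real.exp (-β) * likelihood (Φ.model f') D ≤ likelihood (Φ.model f) D}

/-- A planning rule: the model and the policy chosen on the basis of the data collected so far. -/
abbrev Planner (O A : Type*) [Fintype A] (d₁ d₂ d₃ d₄ d₅ H m : ℕ) :=
  List (Record O A H m) → LinParam d₁ d₂ d₃ d₄ d₅ × Policy O A

/-- The data set after the batches `bs` have been collected, starting from the data set `D`; in
every iteration the policy is chosen by the planning rule from the current data set. -/
def records {H m : ℕ} (plan : Planner O A d₁ d₂ d₃ d₄ d₅ H m) :
    List (Record O A H m) → List (Batch O A H m) → List (Record O A H m)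
  | D, [] => D
  | D, b :: bs => records plan (D ++ [((plan D).2, b)]) bs

/-- Optimistic planning: `(f, π)` maximizes the value over the confidence set and all policies. -/
def IsOptimistic [Nonempty A] (Φ : Features S O A d₁ d₂ d₃ d₄ d₅)
    (F : Set (LinParam d₁ d₂ d₃ d₄ d₅)) (r : ℕ → O → A → ℝ) (β : ℝ) {H m : ℕ}
    (D : List (Record O A H m)) (f : LinParam d₁ d₂ d₃ d₄ d₅) (π : Policy O A) : Prop :=
  f ∈ confSet Φ F β D ∧
    ∀ f' ∈ confSet Φ F β D, ∀ π', value (Φ.model f') H r π' ≤ value (Φ.model f) H r π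

/-- `plan` implements CRANE for `K` iterations in the environment `M`: with every data set that
can arise after fewer than `K` iterations it plans optimistically. -/
def IsCrane [Nonempty A] (Φ : Features S O A d₁ d₂ d₃ d₄ d₅) (F : Set (LinParam d₁ d₂ d₃ d₄ d₅))
    (r : ℕ → O → A → ℝ) (β : ℝ) {H m : ℕ} (M : POMDP S O A) (K : ℕ)
    (plan : Planner O A d₁ d₂ d₃ d₄ d₅ H m) : Prop :=
  ∀ bs : List (Batch O A H m), bs.length < K → 0 < likelihood M (records plan [] bs) →
    IsOptimistic Φ F r β (records plan [] bs)
      (plan (records plan [] bs)).1 (plan (records plan [] bs)).2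

/-- The data set of a full run with outcome `ω` (the batches of all `K` iterations). -/
def runData {H m K : ℕ} (plan : Planner O A d₁ d₂ d₃ d₄ d₅ H m) (ω : Fin K → Batch O A H m) :
    List (Record O A H m) :=
  records plan [] (List.ofFn ω)

open Classical in
/-- The probability of an event of the run in the environment `M`. By the chain rule the outcome
`ω` has as its probability the product over the iterations of the probabilities of the collected
trajectories under the policies executed in that iteration. -/
def runProb [Nonempty A] {H m K : ℕ} (M : POMDP S O A) (plan : Planner O A d₁ d₂ d₃ d₄ d₅ H m)
    (E : Set (Fin K → Batch O A H m)) : ℝ :=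
  ∑ ω, E.indicator (fun ω => likelihood M (runData plan ω)) ω

/-- The slackness `β = c log (𝒩_F(ε_b) K H |U_A| / δ)`, where `|U_A| = |A|^(m-1)` and
`ε_b = 1 / (K H |U_A|)`. -/
def slackness (c : ℝ) (Φ : Features S O A d₁ d₂ d₃ d₄ d₅) (H m K : ℕ)
    (F : Set (LinParam d₁ d₂ d₃ d₄ d₅)) (δ : ℝ) : ℝ :=
  c * Real.log (bracketNumber Φ H F (1 / (K * H * (Fintype.card A : ℝ) ^ (m - 1))) *
    (K * H * (Fintype.card A : ℝ) ^ (m - 1)) / δ)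

end Algorithm

end Crane

end

open Crane

/-!
# Sample complexity of optimistic likelihood-based learning of linear POMDPs

The value of the planned policy in the planned model is at least the optimal value, as long as the
true model stays in the confidence set. So the total regret of the `K` iterations is at most `H`
times the sum over `k` of the distance, under `π^k`, of the trajectory laws of `f^k` and of the true
model, and it suffices that this sum is of order `√K`, up to logarithms. This follows from four
facts.

*Statistics.* For every upper bracket `g`, the likelihood ratio of `g` to the truth and that of the
normalized geometric mean of `g` and the truth are supermartingales, up to a factor close to `1`
in each step. By a maximal inequality (`listSum_exists_le`) and a union bound over the bracket,
with probability `1 - 4 𝒩 exp (-β)` all of them stay below `exp β` throughout the run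
(`one_sub_le_runProb`). On this event the true model is in every confidence set
(`IsTypical.mem_confSet`), and every model of a confidence set has a small sum of squared distances
from the truth on the collected data (`IsTypical.dataSum_lawDist_le`).

*Representation.* As `𝒰` is a core test set, the probabilities of all futures of a history depend
linearly on its predictive state, with coefficients bounded by `‖K†‖ ≤ 1/α`
(`IsRegular.nonempty_coreRep`). Passing from histories under the truth to predictions of the learned
model one step at a time bounds the distance of the laws by the prediction errors for a step and a
core test (`lawDist_le`), and the exploration policies observe these errors
(`CoreRep.listSum_weight_err_le`).

*Potential.* In the coordinates of the core histories of the true model the prediction errors are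
linear functionals, in a dimension that is at most the rank of the system dynamics matrix, hence at
most `d_lin` (`psrRank_le`). Functionals which are small in total on the earlier histories are small
on average on the next ones, by an elliptical potential argument (`sum_sum_abs_dotProduct_le`). It
uses sums of absolute values instead of squares, and a Gram matrix with weights adapted to this; so
no factor `|𝒪|` arises from the number of histories or futures. Together, this gives
`sum_lawDist_le`.

*Bracketing.* A grid of parameters gives a bracket whose size involves `|𝒮|` only under the
logarithm (`exists_isBracket_le`), and weak revealing bounds `|𝒮|` by the number of core tests
(`card_state_le`). Thus `β` is polynomial in the parameters and in `log K`, and the polynomial in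
the bound on `K` is large enough to absorb `log K` (`log_sq_div_sqrt_le`).
-/

noncomputable section

namespace Crane

set_option linter.unusedSectionVars false

/-! ### Sums over histories of a given length -/

section

/-- The sum of `F` over all lists of length `n`. -/
def listSum {X : Type*} [Fintype X] (n : ℕ) (F : List X → ℝ) : ℝ :=
  ∑ τ : Fin n → X, F (List.ofFn τ)

section ListSum

variable {X : Type*} [Fintype X]

lemma listSum_zero (F : List X → ℝ) : listSum 0 F = F [] := by
  simp [listSum]

lemma listSum_cons (n : ℕ) (F : List X → ℝ) :
    listSum (n + 1) F = ∑ p, listSum n fun l => F (p :: l) := by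
  unfold listSum
  rw [← (Fin.consEquiv fun _ : Fin (n + 1) => X).sum_comp, Fintype.sum_prod_type]
  simp [Fin.consEquiv, List.ofFn_succ]

lemma listSum_one (F : List X → ℝ) : listSum 1 F = ∑ p, F [p] := by
  rw [listSum_cons]; simp [listSum_zero]

lemma listSum_add (a b : ℕ) (F : List X → ℝ) :
    listSum (a + b) F = listSum a fun l => listSum b fun r => F (l ++ r) := by
  induction a generalizing F with
  | zero => simp [listSum_zero]
  | succ a ih =>
    rw [show a + 1 + b = (a + b) + 1 by omega, listSum_cons, listSum_cons]
    exact Finset.sum_congr rfl fun p _ => by rw [ih]; simp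

lemma listSum_snoc (n : ℕ) (F : List X → ℝ) :
    listSum (n + 1) F = listSum n fun l => ∑ p, F (l ++ [p]) := by
  rw [listSum_add]; simp [listSum_one]

lemma listSum_congr {n : ℕ} {F G : List X → ℝ} (h : ∀ l, l.length = n → F l = G l) :
    listSum n F = listSum n G :=
  Finset.sum_congr rfl fun τ _ => h _ (by simp)

lemma listSum_mono {n : ℕ} {F G : List X → ℝ} (h : ∀ l, l.length = n → F l ≤ G l) :
    listSum n F ≤ listSum n G :=
  Finset.sum_le_sum fun τ _ => h _ (by simp)

lemma listSum_nonneg {n : ℕ} {F : List X → ℝ} (h : ∀ l, l.length = n → 0 ≤ F l) :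
    0 ≤ listSum n F :=
  Finset.sum_nonneg fun τ _ => h _ (by simp)

lemma listSum_add_fun (n : ℕ) (F G : List X → ℝ) :
    listSum n (fun l => F l + G l) = listSum n F + listSum n G :=
  Finset.sum_add_distrib

lemma mul_listSum (n : ℕ) (c : ℝ) (F : List X → ℝ) :
    c * listSum n F = listSum n fun l => c * F l :=
  Finset.mul_sum _ _ _

lemma listSum_mul (n : ℕ) (c : ℝ) (F : List X → ℝ) :
    listSum n F * c = listSum n fun l => F l * c :=
  Finset.sum_mul _ _ _

lemma listSum_sum {ι : Type*} (s : Finset ι) (n : ℕ) (F : ι → List X → ℝ) :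
    listSum n (fun l => ∑ i ∈ s, F i l) = ∑ i ∈ s, listSum n (F i) :=
  Finset.sum_comm

lemma abs_listSum_le (n : ℕ) (F : List X → ℝ) : |listSum n F| ≤ listSum n fun l => |F l| :=
  Finset.abs_sum_le_sum_abs _ _

end ListSum

/-! ### Beliefs, history probabilities and policies -/

namespace POMDP

variable {S O A : Type*} [Fintype S] [Fintype O] [Fintype A] {M : POMDP S O A} {H : ℕ}

lemma forward_append (M : POMDP S O A) (h : ℕ) (b : S → ℝ) (l r : List (O × A)) :
    M.forward h b (l ++ r) = M.forward (h + l.length) (M.forward h b l) r := by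
  induction l generalizing h b with
  | nil => simp [forward]
  | cons p l ih =>
    simp only [List.cons_append, forward, List.length_cons]
    rw [ih]; congr 1; omega

lemma forward_sum {ι : Type*} (s : Finset ι) (M : POMDP S O A) (h : ℕ) (c : ι → ℝ)
    (b : ι → S → ℝ) (l : List (O × A)) (x : S) :
    M.forward h (fun y => ∑ i ∈ s, c i * b i y) l x = ∑ i ∈ s, c i * M.forward h (b i) l x := by
  induction l generalizing h b with
  | nil => simp [forward]
  | cons p l ih =>
    simp only [forward]
    rw [← ih]
    congr 1
    ext y
    simp only [Finset.sum_mul, Finset.mul_sum]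
    rw [Finset.sum_comm]
    exact Finset.sum_congr rfl fun i _ => Finset.sum_congr rfl fun z _ => by ring

lemma forward_nonneg (hM : M.IsValid H) (h : ℕ) (hh : 1 ≤ h) {b : S → ℝ} (hb : ∀ s, 0 ≤ b s)
    (l : List (O × A)) (hl : h + l.length ≤ H + 1) (s : S) : 0 ≤ M.forward h b l s := by
  induction l generalizing h b with
  | nil => exact hb s
  | cons p l ih =>
    simp only [List.length_cons] at hl
    have hv := hM.2 h (Finset.mem_Icc.2 ⟨hh, by omega⟩)
    exact ih (h + 1) (by omega) (fun s' => Finset.sum_nonneg fun s _ =>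
      mul_nonneg (mul_nonneg (hb s) ((hv.2 s).1 _)) ((hv.1 s _).1 _)) (by omega)

lemma histProb_nonneg (hM : M.IsValid H) (l : List (O × A)) (hl : l.length ≤ H) :
    0 ≤ M.histProb l :=
  Finset.sum_nonneg fun s _ => forward_nonneg hM 1 le_rfl hM.1.1 l (by omega) s

/-- The probability of a history that ends with an action does not depend on this action, and is
the probability that its observations are seen. -/
lemma histProb_append_test (hM : M.IsValid H) (l t : List (O × A)) (o : O) (a : A)
    (hl : l.length + t.length + 1 ≤ H) :
    M.histProb (l ++ (t ++ [(o, a)])) = M.jointProb l t o := by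
  unfold histProb jointProb
  rw [← List.append_assoc, forward_append M 1 _ (l ++ t)]
  simp only [forward]
  rw [Finset.sum_comm]
  refine Finset.sum_congr rfl fun s _ => ?_
  rw [← Finset.mul_sum]
  have hv := hM.2 (1 + (l ++ t).length) (Finset.mem_Icc.2 ⟨by omega, by simp; omega⟩)
  rw [(hv.1 s a).2, mul_one]
  congr 2
  simp; omega

end POMDP

section Weights

variable {S O A : Type*} [Fintype S] [Fintype O] [Fintype A] {M : POMDP S O A} {H : ℕ}

/-- The product of the probabilities with which `π` chooses the actions along the second list,
when it starts after the history given by the first list. -/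
def Policy.listWeight (π : Policy O A) : List (O × A) → List (O × A) → ℝ
  | _, [] => 1
  | pre, p :: l => π.prob pre p.1 p.2 * π.listWeight (pre ++ [p]) l

lemma Policy.prod_prob_eq (π : Policy O A) (pre : List (O × A)) {n : ℕ} (τ : Traj O A n) :
    ∏ i : Fin n, π.prob (pre ++ (List.ofFn τ).take i) (τ i).1 (τ i).2 =
      π.listWeight pre (List.ofFn τ) := by
  induction n generalizing pre with
  | zero => simp [Policy.listWeight]
  | succ n ih =>
    rw [Fin.prod_univ_succ, List.ofFn_succ, Policy.listWeight, ← ih]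
    simp

lemma Policy.weight_eq (π : Policy O A) {n : ℕ} (τ : Traj O A n) :
    π.weight τ = π.listWeight [] (List.ofFn τ) := by
  rw [← Policy.prod_prob_eq]; simp [Policy.weight]

lemma Policy.listWeight_append (π : Policy O A) (pre l r : List (O × A)) :
    π.listWeight pre (l ++ r) = π.listWeight pre l * π.listWeight (pre ++ l) r := by
  induction l generalizing pre with
  | nil => simp [listWeight]
  | cons p l ih => simp [listWeight, ih, mul_assoc]

lemma Policy.prob_le_one (π : Policy O A) (l : List (O × A)) (o : O) (a : A) :
    π.prob l o a ≤ 1 := by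
  rw [← (π.isDist l o).2]
  exact Finset.single_le_sum (fun a _ => (π.isDist l o).1 a) (Finset.mem_univ a)

lemma Policy.listWeight_nonneg (π : Policy O A) (pre l : List (O × A)) :
    0 ≤ π.listWeight pre l := by
  induction l generalizing pre with
  | nil => simp [listWeight]
  | cons p l ih => exact mul_nonneg ((π.isDist _ _).1 _) (ih _)

lemma Policy.listWeight_le_one (π : Policy O A) (pre l : List (O × A)) :
    π.listWeight pre l ≤ 1 := by
  induction l generalizing pre with
  | nil => simp [listWeight]
  | cons p l ih => exact mul_le_one₀ (π.prob_le_one _ _ _) (π.listWeight_nonneg _ _) (ih _)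

lemma trajProb_eq (M : POMDP S O A) (π : Policy O A) (τ : Traj O A H) :
    trajProb M π τ = M.histProb (List.ofFn τ) * π.listWeight [] (List.ofFn τ) := by
  rw [trajProb, Policy.weight_eq]

lemma trajProb_nonneg (hM : M.IsValid H) (π : Policy O A) (τ : Traj O A H) :
    0 ≤ trajProb M π τ := by
  rw [trajProb_eq]
  exact mul_nonneg (POMDP.histProb_nonneg hM _ (by simp)) (π.listWeight_nonneg _ _)

/-- Following a policy for `n` steps preserves the total mass of the belief. -/
lemma listSum_weight_forward (hM : M.IsValid H) (π : Policy O A) (n : ℕ) (pre : List (O × A))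
    (h : ℕ) (b : S → ℝ) (hh : 1 ≤ h) (hn : h + n ≤ H + 1) :
    listSum n (fun l => π.listWeight pre l * ∑ s, M.forward h b l s) = ∑ s, b s := by
  induction n generalizing pre h b with
  | zero => simp [listSum_zero, Policy.listWeight, POMDP.forward]
  | succ n ih =>
    have hv := hM.2 h (Finset.mem_Icc.2 ⟨hh, by omega⟩)
    rw [listSum_cons]
    simp only [Policy.listWeight, POMDP.forward, mul_assoc, ← mul_listSum]
    have key : ∀ p : O × A, listSum n (fun l => π.listWeight (pre ++ [p]) l *
        ∑ s', M.forward (h + 1) (fun s' => ∑ s, b s * (M.emit h s p.1 * M.trans h s p.2 s')) l s')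
        = ∑ s, b s * M.emit h s p.1 := by
      intro p
      rw [ih _ _ _ (by omega) (by omega), Finset.sum_comm]
      refine Finset.sum_congr rfl fun s _ => ?_
      simp only [← mul_assoc]
      rw [← Finset.mul_sum, (hv.1 s p.2).2, mul_one]
    simp only [key]
    rw [Fintype.sum_prod_type]
    simp only [← Finset.sum_mul, (π.isDist _ _).2, one_mul]
    rw [Finset.sum_comm]
    refine Finset.sum_congr rfl fun s _ => ?_
    rw [← Finset.mul_sum, (hv.2 s).2, mul_one]

/-- The probabilities of the continuations of a history under a policy add up to the probability
of the history. -/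
lemma listSum_weight_histProb (hM : M.IsValid H) (π : Policy O A) (n : ℕ) (pre l : List (O × A))
    (hn : l.length + n ≤ H) :
    listSum n (fun r => π.listWeight pre r * M.histProb (l ++ r)) = M.histProb l := by
  simp only [POMDP.histProb, POMDP.forward_append M 1 _ l]
  exact listSum_weight_forward hM π n pre _ _ (by omega) (by omega)

lemma POMDP.histProb_nil (hM : M.IsValid H) : M.histProb [] = 1 := hM.1.2

lemma sum_trajProb (hM : M.IsValid H) (π : Policy O A) :
    ∑ τ : Traj O A H, trajProb M π τ = 1 := by
  have := listSum_weight_histProb hM π H [] [] (by simp)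
  rw [POMDP.histProb_nil hM] at this
  rw [← this, listSum]
  exact Finset.sum_congr rfl fun τ _ => by rw [trajProb_eq, mul_comm, List.nil_append]

/-- The policy that always acts uniformly. -/
def uniformPolicy (O A : Type*) [Fintype A] [Nonempty A] : Policy O A where
  prob _ _ _ := 1 / Fintype.card A
  isDist _ _ := ⟨fun _ => by positivity, by simp⟩

instance [Nonempty A] : Nonempty (Policy O A) := ⟨uniformPolicy O A⟩

lemma uniformPolicy_listWeight [Nonempty A] (pre l : List (O × A)) :
    (uniformPolicy O A).listWeight pre l = (1 / (Fintype.card A : ℝ)) ^ l.length := by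
  induction l generalizing pre with
  | nil => simp [Policy.listWeight]
  | cons p l ih =>
    rw [Policy.listWeight, ih, List.length_cons, pow_succ']
    rfl

/-- The sum of a nonnegative function over all continuations, via the uniform policy. -/
lemma listSum_eq_uniform [Nonempty A] (n : ℕ) (pre : List (O × A)) (F : List (O × A) → ℝ) :
    listSum n F =
      (Fintype.card A : ℝ) ^ n *
        listSum n (fun r => (uniformPolicy O A).listWeight pre r * F r) := by
  have hA : (Fintype.card A : ℝ) ≠ 0 := by simp
  rw [mul_listSum]
  refine listSum_congr fun l hl => ?_
  rw [uniformPolicy_listWeight, hl, ← mul_assoc, ← mul_pow, mul_one_div_cancel hA, one_pow,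
    one_mul]

end Weights

end

/-! ### Linear representation of the future by core tests -/

section

section Norms

variable {ι κ : Type*} [Fintype ι] [Fintype κ]

lemma l1_nonneg (x : ι → ℝ) : 0 ≤ l1 x := Finset.sum_nonneg fun _ _ => abs_nonneg _

lemma l1_smul (c : ℝ) (x : ι → ℝ) : l1 (c • x) = |c| * l1 x := by
  simp [l1, abs_mul, Finset.mul_sum]

lemma l1_mulVec_le_sum (B : Matrix ι κ ℝ) (x : κ → ℝ) :
    l1 (B *ᵥ x) ≤ (∑ i, ∑ j, |B i j|) * l1 x := by
  unfold l1
  rw [Finset.sum_mul]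
  refine Finset.sum_le_sum fun i _ => ?_
  refine (Finset.abs_sum_le_sum_abs _ _).trans ?_
  rw [Finset.sum_mul]
  refine Finset.sum_le_sum fun j _ => ?_
  rw [abs_mul]
  exact mul_le_mul_of_nonneg_left
    (Finset.single_le_sum (fun j _ => abs_nonneg (x j)) (Finset.mem_univ j)) (abs_nonneg _)

lemma l1_mulVec_le (B : Matrix ι κ ℝ) {C : ℝ} (hB : opNorm1 B ≤ C) (x : κ → ℝ) :
    l1 (B *ᵥ x) ≤ C * l1 x := by
  by_cases hx : l1 x = 0
  · have := l1_mulVec_le_sum B x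
    rw [hx, mul_zero] at this
    simpa [hx] using this
  have hpos : 0 < l1 x := lt_of_le_of_ne (l1_nonneg x) (Ne.symm hx)
  have hbdd : BddAbove (Set.range fun x : {x : κ → ℝ // l1 x = 1} => l1 (B *ᵥ x.1)) := by
    refine ⟨∑ i, ∑ j, |B i j|, ?_⟩
    rintro _ ⟨y, rfl⟩
    simpa [y.2] using l1_mulVec_le_sum B y.1
  have hy : l1 ((l1 x)⁻¹ • x) = 1 := by
    rw [l1_smul, abs_of_nonneg (inv_nonneg.2 hpos.le), inv_mul_cancel₀ hx]
  have h1 : l1 (B *ᵥ ((l1 x)⁻¹ • x)) ≤ opNorm1 B := le_ciSup hbdd ⟨_, hy⟩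
  rw [Matrix.mulVec_smul, l1_smul, abs_of_nonneg (inv_nonneg.2 hpos.le)] at h1
  have h2 := h1.trans hB
  rwa [inv_mul_le_iff₀ hpos, mul_comm] at h2

end Norms

section Column

variable {ι κ : Type*} [Fintype ι] [Fintype κ]

/-- If the columns `τ` of a submatrix of `D` are independent and as many as the rank of `D`, then
every column of `D` is the combination of the columns `τ` whose coefficients are obtained from the
pseudoinverse of the submatrix. -/
lemma column_eq_of_rank {υ : Type*} [Fintype υ] {n : ℕ} (D : Matrix ι κ ℝ) (ρ : υ → ι)
    (τ : Fin n → κ) (K' : Matrix (Fin n) υ ℝ) (hn : D.rank = n)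
    (hrank : (D.submatrix ρ τ).rank = n) (hK : IsPseudoinverse (D.submatrix ρ τ) K') (i : ι)
    (k : κ) : D i k = ∑ j, D i (τ j) * (K' *ᵥ fun u => D (ρ u) k) j := by
  classical
  have hinj : Function.Injective (D.submatrix ρ τ).mulVec := by
    rw [Matrix.mulVec_injective_iff]
    rw [Matrix.rank_eq_finrank_span_cols] at hrank
    rw [linearIndependent_iff_card_eq_finrank_span, Fintype.card_fin]
    exact hrank.symm
  have hsub : ∀ v u, ((D.submatrix ρ τ) *ᵥ v) u = ((D.submatrix id τ) *ᵥ v) (ρ u) :=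
    fun v u => rfl
  have hinj' : Function.Injective (D.submatrix id τ).mulVec := by
    intro v w hvw
    apply hinj
    ext u
    rw [hsub, hsub]
    exact congrFun hvw _
  have hle : LinearMap.range (D.submatrix id τ).mulVecLin ≤ LinearMap.range D.mulVecLin := by
    rw [Matrix.range_mulVecLin, Matrix.range_mulVecLin]
    refine Submodule.span_mono ?_
    rintro _ ⟨j, rfl⟩
    exact ⟨τ j, rfl⟩
  have hfin : Module.finrank ℝ (LinearMap.range (D.submatrix id τ).mulVecLin) = n := by
    rw [LinearMap.finrank_range_of_inj]
    · simp
    · exact hinj'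
  have heq := Submodule.eq_of_le_of_finrank_eq hle (hfin.trans hn.symm)
  have hmem : D *ᵥ Pi.single k 1 ∈ LinearMap.range (D.submatrix id τ).mulVecLin := by
    rw [heq]
    exact ⟨Pi.single k 1, rfl⟩
  obtain ⟨v, hv⟩ := hmem
  have hv' : ∀ i, D i k = ∑ j, D i (τ j) * v j := by
    intro i
    have := congrFun hv i
    rw [Matrix.mulVec_single_one] at this
    exact this.symm
  have hKv : K' *ᵥ (fun u => D (ρ u) k) = v := by
    have h1 : (fun u => D (ρ u) k) = (D.submatrix ρ τ) *ᵥ v := by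
      ext u; exact hv' (ρ u)
    rw [h1]
    apply hinj
    simp only [Matrix.mulVec_mulVec]
    rw [← Matrix.mul_assoc, hK.1]
  rw [hKv]
  exact hv' i

end Column

variable {S O A : Type*} [Fintype S] [Fintype O] [Fintype A] {M : POMDP S O A} {H : ℕ}

/-- The unnormalized predictive state of a history: the joint probabilities of the history and
the `m`-step futures. -/
def POMDP.pred (M : POMDP S O A) (m : ℕ) (l : List (O × A)) : Test O A (m - 1) → ℝ :=
  fun u => M.jointProb l (List.ofFn u.1) u.2

/-- The test `u` as a list of observation-action pairs, where the last action, which does not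
matter, is `a`. -/
def testList {n : ℕ} (a : A) (u : Test O A n) : List (O × A) := List.ofFn u.1 ++ [(u.2, a)]

@[simp] lemma length_testList {n : ℕ} (a : A) (u : Test O A n) :
    (testList a u).length = n + 1 := by simp [testList]

lemma POMDP.pred_eq (hM : M.IsValid H) {m : ℕ} (hm : 1 ≤ m) (l : List (O × A)) (a : A)
    (u : Test O A (m - 1)) (hl : l.length + m ≤ H) :
    M.pred m l u = M.histProb (l ++ testList a u) := by
  rw [testList, histProb_append_test hM]
  · rfl
  · simp; omega

lemma sum_testList_le {n : ℕ} (a : A) (F : List (O × A) → ℝ) (hF : ∀ l, 0 ≤ F l) :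
    ∑ u : Test O A n, F (testList a u) ≤ listSum (n + 1) F := by
  rw [listSum_snoc, Fintype.sum_prod_type, listSum]
  refine Finset.sum_le_sum fun τ _ => ?_
  rw [Fintype.sum_prod_type]
  refine Finset.sum_le_sum fun o _ => ?_
  exact Finset.single_le_sum (f := fun a => F (List.ofFn τ ++ [(o, a)])) (fun _ _ => hF _)
    (Finset.mem_univ a)

lemma POMDP.histProb_append_eq_zero (hM : M.IsValid H) (l r : List (O × A)) (hl : l.length ≤ H)
    (h0 : M.histProb l = 0) : M.histProb (l ++ r) = 0 := by
  have hz : M.forward 1 M.init l = fun s => ∑ i ∈ (∅ : Finset ℕ), (0 : ℝ) * (0 : ℝ) := by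
    ext s
    have := (Finset.sum_eq_zero_iff_of_nonneg
      fun s _ => forward_nonneg hM 1 le_rfl hM.1.1 l (by omega) s).1 h0 s (Finset.mem_univ s)
    simpa using this
  rw [histProb, forward_append, hz]
  refine Finset.sum_eq_zero fun s _ => ?_
  rw [forward_sum ∅ M _ (fun _ => 0) (fun _ _ => 0)]
  simp

/-- A linear representation of the futures of all histories of length `h`: `n` core histories and
a matrix `coef` that sends the predictive state of a history to the coefficients with which the
futures of the core histories combine to the futures of the history. -/
structure CoreRep (M : POMDP S O A) (H m h : ℕ) (α : ℝ) where
  /-- The number of core histories. -/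
  n : ℕ
  /-- The core histories. -/
  core : Fin n → List (O × A)
  /-- The coefficients of a history, as a function of its predictive state. -/
  coef : Matrix (Fin n) (Test O A (m - 1)) ℝ
  n_eq : n = M.psrRank H h
  length_core : ∀ j, (core j).length = h
  norm_coef : ∀ x, l1 (coef *ᵥ x) ≤ 1 / α * l1 x
  repr : ∀ l r, l.length = h → r ≠ [] → h + r.length ≤ H →
    M.histProb (l ++ r) =
      ∑ j, M.histProb (core j ++ r) / M.histProb (core j) * (coef *ᵥ M.pred m l) j

theorem IsRegular.nonempty_coreRep (hM : M.IsValid H) {m : ℕ} (hm : 1 ≤ m) (hmH : m ≤ H) {α : ℝ}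
    (hR : IsRegular M H m α) {h : ℕ} (hh : h ≤ H - m) : Nonempty (CoreRep M H m h α) := by
  obtain ⟨K, K', ⟨⟨τ, rfl⟩, hrank⟩, hK, hnorm⟩ := hR h hh
  let ρ : Test O A (m - 1) → Σ n : Fin (H - h), Test O A n :=
    fun u => ⟨⟨m - 1, by omega⟩, u⟩
  have hcol := column_eq_of_rank (M.dynMatrix H h) ρ τ K' rfl hrank hK
  refine ⟨⟨M.psrRank H h, fun j => List.ofFn (τ j), K', rfl, by simp, l1_mulVec_le K' hnorm, ?_⟩⟩
  intro l r hl hr hlr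
  obtain rfl | ⟨t, ⟨o, a⟩, rfl⟩ := List.eq_nil_or_concat r
  · exact absurd rfl hr
  rw [List.concat_eq_append] at *
  simp only [List.length_append, List.length_singleton] at hlr
  obtain ⟨σ, rfl⟩ : ∃ σ : Traj O A h, l = List.ofFn σ := by
    subst hl; exact ⟨l.get, (List.ofFn_get l).symm⟩
  obtain ⟨n, σt, rfl⟩ : ∃ (n : ℕ) (σ : Fin n → O × A), t = List.ofFn σ :=
    ⟨_, t.get, (List.ofFn_get t).symm⟩
  simp only [List.length_ofFn] at hlr
  have hjoint : ∀ σ : Traj O A h, M.histProb (List.ofFn σ ++ (List.ofFn σt ++ [(o, a)])) =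
      M.jointProb (List.ofFn σ) (List.ofFn σt) o := fun σ =>
    POMDP.histProb_append_test hM _ _ _ _ (by simp; omega)
  have hpred : ∀ u, M.jointProb (List.ofFn σ) (List.ofFn u.1) u.2 =
      M.pred m (List.ofFn σ) u := fun u => rfl
  have hi := hcol ⟨⟨n, by omega⟩, (σt, o)⟩ σ
  simp only [POMDP.dynMatrix, POMDP.testProb, Matrix.of_apply, ρ] at hi
  by_cases h0 : M.histProb (List.ofFn σ) = 0
  · rw [POMDP.histProb_append_eq_zero hM _ _ (by simp; omega) h0]
    have : M.pred m (List.ofFn σ) = 0 := by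
      ext u
      rw [POMDP.pred_eq hM hm _ a u (by simp; omega),
        POMDP.histProb_append_eq_zero hM _ _ (by simp; omega) h0]
      rfl
    simp [this]
  · have hvec : (fun u : Test O A (m - 1) => M.jointProb (List.ofFn σ) (List.ofFn u.1) u.2 /
        M.histProb (List.ofFn σ)) = (M.histProb (List.ofFn σ))⁻¹ • M.pred m (List.ofFn σ) := by
      ext u
      simp [hpred, div_eq_inv_mul]
    rw [hvec, Matrix.mulVec_smul, div_eq_iff h0, Finset.sum_mul] at hi
    simp only [hjoint]
    rw [hi]
    refine Finset.sum_congr rfl fun j _ => ?_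
    simp only [Pi.smul_apply, smul_eq_mul]
    field_simp

end

section

variable {S O A : Type*} [Fintype S] [Fintype O] [Fintype A] {M : POMDP S O A} {H m h : ℕ}
  {α : ℝ}

/-- The linear functional that predicts the probability of a future from a predictive state. -/
def CoreRep.fut (R : CoreRep M H m h α) (r : List (O × A)) (x : Test O A (m - 1) → ℝ) : ℝ :=
  ∑ j, M.histProb (R.core j ++ r) / M.histProb (R.core j) * (R.coef *ᵥ x) j

lemma CoreRep.fut_pred (R : CoreRep M H m h α) {l r : List (O × A)} (hl : l.length = h)
    (hr : r ≠ []) (hlr : h + r.length ≤ H) : R.fut r (M.pred m l) = M.histProb (l ++ r) :=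
  (R.repr l r hl hr hlr).symm

lemma CoreRep.fut_sub (R : CoreRep M H m h α) (r : List (O × A)) (x y : Test O A (m - 1) → ℝ) :
    R.fut r (x - y) = R.fut r x - R.fut r y := by
  simp [fut, Matrix.mulVec_sub, mul_sub, Finset.sum_sub_distrib]

lemma CoreRep.fut_sum (R : CoreRep M H m h α) (r : List (O × A)) {ι : Type*} (s : Finset ι)
    (c : ι → ℝ) (x : ι → Test O A (m - 1) → ℝ) :
    R.fut r (fun u => ∑ i ∈ s, c i * x i u) = ∑ i ∈ s, c i * R.fut r (x i) := by
  have : (fun u => ∑ i ∈ s, c i * x i u) = ∑ i ∈ s, c i • x i := by ext u; simp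
  unfold fut
  simp only [this, Finset.mul_sum]
  rw [Finset.sum_comm]
  refine Finset.sum_congr rfl fun j _ => ?_
  rw [Matrix.mulVec_sum, Finset.sum_apply, Finset.mul_sum]
  refine Finset.sum_congr rfl fun i _ => ?_
  rw [Matrix.mulVec_smul, Pi.smul_apply, smul_eq_mul]
  ring

lemma POMDP.listSum_weight_div_le_one (hM : M.IsValid H) (π : Policy O A) (k : ℕ)
    (pre l : List (O × A)) (hk : l.length + k ≤ H) :
    listSum k (fun r => π.listWeight pre r * (M.histProb (l ++ r) / M.histProb l)) ≤ 1 := by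
  simp only [div_eq_mul_inv, ← mul_assoc]
  rw [← listSum_mul, listSum_weight_histProb hM π k pre l hk]
  exact mul_inv_le_one

/-- Under any policy, the functionals `fut` are bounded in total by the norm of the coefficient
matrix. -/
lemma CoreRep.listSum_weight_abs_fut_le (hM : M.IsValid H) (R : CoreRep M H m h α)
    (π : Policy O A) (k : ℕ) (pre : List (O × A)) (hk : h + k ≤ H)
    (x : Test O A (m - 1) → ℝ) :
    listSum k (fun r => π.listWeight pre r * |R.fut r x|) ≤ 1 / α * l1 x := by
  calc listSum k (fun r => π.listWeight pre r * |R.fut r x|)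
      ≤ listSum k (fun r => ∑ j, (π.listWeight pre r *
          (M.histProb (R.core j ++ r) / M.histProb (R.core j))) * |(R.coef *ᵥ x) j|) := by
        refine listSum_mono fun r hr => ?_
        simp only [mul_assoc]
        rw [← Finset.mul_sum]
        refine mul_le_mul_of_nonneg_left ?_ (π.listWeight_nonneg _ _)
        refine (Finset.abs_sum_le_sum_abs _ _).trans (le_of_eq ?_)
        refine Finset.sum_congr rfl fun j _ => ?_
        have hj := R.length_core j
        rw [abs_mul, abs_of_nonneg]
        exact div_nonneg (POMDP.histProb_nonneg hM _ (by simp; omega))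
          (POMDP.histProb_nonneg hM _ (by omega))
    _ = ∑ j, listSum k (fun r => π.listWeight pre r *
          (M.histProb (R.core j ++ r) / M.histProb (R.core j))) * |(R.coef *ᵥ x) j| := by
        rw [listSum_sum]; simp only [listSum_mul]
    _ ≤ ∑ j, |(R.coef *ᵥ x) j| := by
        refine Finset.sum_le_sum fun j _ => mul_le_of_le_one_left (abs_nonneg _) ?_
        exact POMDP.listSum_weight_div_le_one hM π k _ _ (by rw [R.length_core]; exact hk)
    _ ≤ 1 / α * l1 x := R.norm_coef x

lemma CoreRep.listSum_abs_fut_le [Nonempty A] (hM : M.IsValid H) (R : CoreRep M H m h α) (k : ℕ)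
    (hk : h + k ≤ H) (x : Test O A (m - 1) → ℝ) :
    listSum k (fun r => |R.fut r x|) ≤ (Fintype.card A : ℝ) ^ k * (1 / α * l1 x) := by
  rw [listSum_eq_uniform k []]
  exact mul_le_mul_of_nonneg_left (R.listSum_weight_abs_fut_le hM _ k [] hk x) (by positivity)

lemma POMDP.listSum_histProb_append [Nonempty A] (hM : M.IsValid H) (k : ℕ) (l : List (O × A))
    (hk : l.length + k ≤ H) :
    listSum k (fun r => M.histProb (l ++ r)) = (Fintype.card A : ℝ) ^ k * M.histProb l := by
  rw [listSum_eq_uniform k [], listSum_weight_histProb hM _ k _ _ hk]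

lemma POMDP.l1_pred_le [Nonempty A] (hM : M.IsValid H) (hm : 1 ≤ m) (l : List (O × A))
    (hl : l.length + m ≤ H) : l1 (M.pred m l) ≤ (Fintype.card A : ℝ) ^ m * M.histProb l := by
  obtain ⟨a⟩ := ‹Nonempty A›
  have : Nonempty A := ⟨a⟩
  rw [← listSum_histProb_append hM m l hl]
  obtain ⟨n, rfl⟩ : ∃ n, m = n + 1 := ⟨m - 1, by omega⟩
  have h2 := sum_testList_le (n := n) a (fun r => |M.histProb (l ++ r)|) fun _ => abs_nonneg _
  refine le_trans (le_trans (le_of_eq ?_) h2) (listSum_mono fun r hr => ?_)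
  · exact Finset.sum_congr rfl fun u _ => by rw [pred_eq hM hm l a u hl]
  · rw [abs_of_nonneg (histProb_nonneg hM _ (by simp; omega))]

/-- Predicting a future after one more step: the predictive state is first pushed through the
step `p`. -/
lemma CoreRep.fut_cons (hM : M.IsValid H) (hm : 1 ≤ m) (R : CoreRep M H m h α)
    (R' : CoreRep M H m (h + 1) α) (a : A) (p : O × A) (r : List (O × A)) (hr : r ≠ [])
    (hmH : h + 1 + m ≤ H) (hrH : h + 1 + r.length ≤ H) (x : Test O A (m - 1) → ℝ) :
    R.fut (p :: r) x = R'.fut r fun u => R.fut (p :: testList a u) x := by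
  have h1 : (fun u : Test O A (m - 1) => R.fut (p :: testList a u) x) = fun u => ∑ j,
      ((R.coef *ᵥ x) j / M.histProb (R.core j)) * M.pred m (R.core j ++ [p]) u := by
    ext u
    refine Finset.sum_congr rfl fun j _ => ?_
    rw [POMDP.pred_eq hM hm _ a u (by simp [R.length_core]; omega)]
    simp only [List.append_assoc, List.singleton_append]
    ring
  rw [h1, CoreRep.fut_sum]
  refine Finset.sum_congr rfl fun j _ => ?_
  rw [R'.fut_pred (by simp [R.length_core]) hr hrH]
  simp only [List.append_assoc, List.singleton_append]
  ring

section Telescope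

variable {N : POMDP S O A}

/-- How much the predictions of `R` for the futures of length `k`, started in the predictive state
of the history `l` in the environment `N`, differ in total from the probabilities in `N`. -/
def CoreRep.err (R : CoreRep M H m h α) (N : POMDP S O A) (k : ℕ) (l : List (O × A)) : ℝ :=
  listSum k fun r => |R.fut r (N.pred m l) - N.histProb (l ++ r)|

lemma CoreRep.err_nonneg (R : CoreRep M H m h α) (N : POMDP S O A) (k : ℕ) (l : List (O × A)) :
    0 ≤ R.err N k l := listSum_nonneg fun _ _ => abs_nonneg _

/-- The distance of the trajectory law in `M` from the hybrid that has the histories of length `h`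
from `N` and predicts the rest by `R`. -/
def CoreRep.hybridDist (R : CoreRep M H m h α) (N : POMDP S O A) (π : Policy O A) : ℝ :=
  listSum h fun l => listSum (H - h) fun r => π.listWeight [] (l ++ r) *
    |M.histProb (l ++ r) - R.fut r (N.pred m l)|

/-- Before the first step the hybrid differs from `M` only by its initial predictive state. -/
lemma CoreRep.hybridDist_zero_le (hM : M.IsValid H) (hH : 1 ≤ H) (R : CoreRep M H m 0 α)
    (π : Policy O A) :
    R.hybridDist N π ≤ 1 / α * l1 (M.pred m [] - N.pred m []) := by
  refine le_trans (le_of_eq ?_)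
    (R.listSum_weight_abs_fut_le hM π H [] (by omega) (M.pred m [] - N.pred m []))
  rw [hybridDist, listSum_zero]
  refine listSum_congr fun r hr => ?_
  rw [R.fut_sub, R.fut_pred rfl (by rintro rfl; simp at hr; omega) (by omega)]
  simp

/-- One step of the telescoping: from one hybrid to the next, the prediction of `R` for the next
predictive state is replaced by the true one, and the error passes through the later predictions,
which are bounded. -/
lemma CoreRep.hybridDist_succ_le (hM : M.IsValid H) (hN : N.IsValid H) (hm : 1 ≤ m)
    (hα : 0 < α) (hmH : h + 1 + m ≤ H) (R : CoreRep M H m h α) (R' : CoreRep M H m (h + 1) α)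
    (π : Policy O A) :
    R'.hybridDist N π ≤ R.hybridDist N π +
      1 / α * listSum h fun l => π.listWeight [] l * R.err N (m + 1) l := by
  rcases isEmpty_or_nonempty A with hA | ⟨⟨a⟩⟩
  · have : IsEmpty (O × A) := inferInstance
    have h0 : R'.hybridDist N π = 0 := by
      rw [hybridDist, listSum_cons]; simp
    rw [h0]
    have h1 : 0 ≤ R.hybridDist N π := listSum_nonneg fun l _ => listSum_nonneg fun r _ =>
      mul_nonneg (π.listWeight_nonneg _ _) (abs_nonneg _)
    have h2 : 0 ≤ listSum h fun l => π.listWeight [] l * R.err N (m + 1) l :=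
      listSum_nonneg fun l _ => mul_nonneg (π.listWeight_nonneg _ _) (R.err_nonneg _ _ _)
    positivity
  unfold hybridDist
  rw [mul_listSum, ← listSum_add_fun, listSum_snoc]
  refine listSum_mono fun l hl => ?_
  obtain ⟨k, hk⟩ : ∃ k, H - h = k + 1 := ⟨H - h - 1, by omega⟩
  rw [show H - (h + 1) = k by omega, hk, listSum_cons]
  have hstep : ∀ p : O × A, listSum k (fun r => π.listWeight [] (l ++ [p] ++ r) *
      |M.histProb (l ++ [p] ++ r) - R'.fut r (N.pred m (l ++ [p]))|) ≤
      listSum k (fun r => π.listWeight [] (l ++ p :: r) *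
        |M.histProb (l ++ p :: r) - R.fut (p :: r) (N.pred m l)|) +
      π.listWeight [] l * (1 / α * ∑ u : Test O A (m - 1),
        |R.fut (p :: testList a u) (N.pred m l) - N.histProb (l ++ p :: testList a u)|) := by
    intro p
    -- The predictive state after the step `p`, as it is predicted by `R`.
    set v : Test O A (m - 1) → ℝ := fun u => R.fut (p :: testList a u) (N.pred m l) with hv
    have hl1 : l1 (v - N.pred m (l ++ [p])) = ∑ u : Test O A (m - 1),
        |R.fut (p :: testList a u) (N.pred m l) - N.histProb (l ++ p :: testList a u)| := by
      refine Finset.sum_congr rfl fun u _ => ?_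
      rw [Pi.sub_apply, POMDP.pred_eq hN hm _ a u (by simp; omega)]
      simp [hv]
    rw [← hl1]
    have hb := R'.listSum_weight_abs_fut_le hM π k (l ++ [p]) (by omega) (v - N.pred m (l ++ [p]))
    have hw : π.listWeight [] (l ++ [p]) ≤ π.listWeight [] l := by
      rw [Policy.listWeight_append]
      exact mul_le_of_le_one_right (π.listWeight_nonneg _ _) (π.listWeight_le_one _ _)
    have hnn : 0 ≤ 1 / α * l1 (v - N.pred m (l ++ [p])) := mul_nonneg (by positivity) (l1_nonneg _)
    have hchain := (mul_le_mul_of_nonneg_left hb (π.listWeight_nonneg [] (l ++ [p]))).trans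
      (mul_le_mul_of_nonneg_right hw hnn)
    refine le_trans ?_ (add_le_add le_rfl hchain)
    rw [mul_listSum, ← listSum_add_fun]
    refine listSum_mono fun r hr => ?_
    have hr' : r ≠ [] := by rintro rfl; simp at hr; omega
    rw [R.fut_cons hM hm R' a p r hr' (by omega) (by omega), R'.fut_sub, ← mul_assoc]
    have hw2 : π.listWeight [] (l ++ [p]) * π.listWeight (l ++ [p]) r =
        π.listWeight [] (l ++ p :: r) := by
      rw [show l ++ p :: r = (l ++ [p]) ++ r by simp, Policy.listWeight_append π [] (l ++ [p])]
      simp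
    rw [hw2, show l ++ [p] ++ r = l ++ p :: r by simp, ← mul_add]
    refine mul_le_mul_of_nonneg_left ?_ (π.listWeight_nonneg _ _)
    exact abs_sub_le _ _ _
  refine (Finset.sum_le_sum fun p _ => hstep p).trans ?_
  rw [Finset.sum_add_distrib]
  refine add_le_add le_rfl ?_
  rw [← Finset.mul_sum, ← Finset.mul_sum, mul_left_comm]
  refine mul_le_mul_of_nonneg_left (mul_le_mul_of_nonneg_left ?_ (π.listWeight_nonneg _ _))
    (by positivity)
  rw [err, listSum_cons]
  refine Finset.sum_le_sum fun p _ => ?_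
  have := sum_testList_le (n := m - 1) a
    (fun r => |R.fut (p :: r) (N.pred m l) - N.histProb (l ++ p :: r)|) fun _ => abs_nonneg _
  rwa [show m - 1 + 1 = m by omega] at this

/-- The `ℓ¹` distance of the laws of the trajectory of length `k` under a policy. -/
def lawDist (M N : POMDP S O A) (k : ℕ) (π : Policy O A) : ℝ :=
  listSum k fun L => π.listWeight [] L * |M.histProb L - N.histProb L|

lemma lawDist_nonneg (M N : POMDP S O A) (k : ℕ) (π : Policy O A) : 0 ≤ lawDist M N k π :=
  listSum_nonneg fun _ _ => mul_nonneg (π.listWeight_nonneg _ _) (abs_nonneg _)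

lemma CoreRep.lawDist_le_hybridDist (hmH : h + m = H) (R : CoreRep M H m h α)
    (π : Policy O A) :
    lawDist M N H π ≤ R.hybridDist N π + listSum h fun l => π.listWeight [] l * R.err N m l := by
  subst hmH
  rw [lawDist, listSum_add, hybridDist, ← listSum_add_fun, Nat.add_sub_cancel_left]
  refine listSum_mono fun l hl => ?_
  rw [err, mul_listSum, ← listSum_add_fun]
  refine listSum_mono fun r hr => ?_
  have hw : π.listWeight [] (l ++ r) ≤ π.listWeight [] l := by
    rw [Policy.listWeight_append]
    exact mul_le_of_le_one_right (π.listWeight_nonneg _ _) (π.listWeight_le_one _ _)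
  refine le_trans ?_ (add_le_add le_rfl (mul_le_mul_of_nonneg_right hw (abs_nonneg _)))
  rw [← mul_add]
  exact mul_le_mul_of_nonneg_left (abs_sub_le _ _ _) (π.listWeight_nonneg _ _)

/-- The length of the futures whose prediction matters at step `h`: the next step and a core test,
or a core test alone at the last step. -/
def futLen (H m h : ℕ) : ℕ := if h < H - m then m + 1 else m

/-- The total variation distance of two models under a policy is controlled by the errors which the
representation of the first model makes in the second one along the policy. -/
lemma lawDist_le (hM : M.IsValid H) (hN : N.IsValid H) (hm : 1 ≤ m) (hmH : m ≤ H) (hα : 0 < α)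
    (R : ∀ h : Fin (H - m + 1), CoreRep M H m h α) (π : Policy O A) :
    lawDist M N H π ≤ (1 + 1 / α) * (l1 (M.pred m [] - N.pred m []) +
      ∑ h : Fin (H - m + 1), listSum (h : ℕ) fun l =>
        π.listWeight [] l * (R h).err N (futLen H m h) l) := by
  set E : ℕ → ℝ := fun h => if hh : h < H - m + 1 then listSum h (fun l =>
        π.listWeight [] l * (R ⟨h, hh⟩).err N (futLen H m h) l) else 0 with hE
  have hE0 : ∀ h, 0 ≤ E h := by
    intro h
    simp only [hE]
    split_ifs
    · exact listSum_nonneg fun l _ =>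
        mul_nonneg (π.listWeight_nonneg _ _) (CoreRep.err_nonneg _ _ _ _)
    · exact le_rfl
  have hsum : ∑ h : Fin (H - m + 1), listSum (h : ℕ) (fun l =>
        π.listWeight [] l * (R h).err N (futLen H m h) l) = ∑ h ∈ Finset.range (H - m + 1), E h := by
    rw [Finset.sum_range]
    exact Finset.sum_congr rfl fun h _ => by simp only [hE]; rw [dif_pos h.2]
  rw [hsum]
  have hind : ∀ h (hh : h < H - m + 1), (R ⟨h, hh⟩).hybridDist N π ≤
      1 / α * (l1 (M.pred m [] - N.pred m []) + ∑ i ∈ Finset.range h, E i) := by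
    intro h
    induction h with
    | zero =>
      intro hh
      simpa using (R ⟨0, hh⟩).hybridDist_zero_le hM (hm.trans hmH) π
    | succ h ih =>
      intro hh
      have h1 := (R ⟨h, by omega⟩).hybridDist_succ_le hM hN hm hα (by simp; omega) (R ⟨h + 1, hh⟩) π
      have h2 := ih (by omega)
      have h3 : E h = listSum h (fun l =>
        π.listWeight [] l * (R ⟨h, by omega⟩).err N (m + 1) l) := by
        simp only [hE]
        rw [dif_pos (by omega), futLen, if_pos (by omega)]
      rw [Finset.sum_range_succ, ← add_assoc, mul_add, h3]
      linarith
  have h1 := (R ⟨H - m, by omega⟩).lawDist_le_hybridDist (N := N) (by simp; omega) π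
  have h2 := hind (H - m) (by omega)
  have h3 : E (H - m) = listSum (H - m) (fun l =>
        π.listWeight [] l * (R ⟨H - m, by omega⟩).err N m l) := by
    simp only [hE]
    rw [dif_pos (by omega), futLen, if_neg (by omega)]
  rw [Finset.sum_range_succ, add_mul, one_mul]
  have h4 : 0 ≤ l1 (M.pred m [] - N.pred m []) := l1_nonneg _
  have h5 : 0 ≤ ∑ i ∈ Finset.range (H - m), E i := Finset.sum_nonneg fun _ _ => hE0 _
  have h6 : 0 ≤ 1 / α * E (H - m) := mul_nonneg (by positivity) (hE0 _)
  rw [← add_assoc, mul_add (1 / α)]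
  simp only [h3] at *
  linarith

end Telescope

end

/-! ### Errors on the exploration data -/

section

variable {S O A : Type*} [Fintype S] [Fintype O] [Fintype A] {M N : POMDP S O A} {H m h : ℕ}
  {α : ℝ}

lemma Policy.listWeight_congr {π ρ : Policy O A} (pre l : List (O × A))
    (hπ : ∀ q : List (O × A), q.length < pre.length + l.length → ∀ o a,
      ρ.prob q o a = π.prob q o a) : ρ.listWeight pre l = π.listWeight pre l := by
  induction l generalizing pre with
  | nil => rfl
  | cons p l ih =>
    rw [listWeight, listWeight, hπ pre (by simp), ih]
    intro q hq
    apply hπ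
    simp only [List.length_append, List.length_cons, List.length_nil] at hq ⊢
    omega

section Explore

variable [Nonempty A]

lemma Policy.explore_prob_of_lt (π : Policy O A) (u : Fin (m - 1) → A) {l : List (O × A)}
    (hl : l.length + 1 < h) (o : O) (a : A) : (π.explore h u).prob l o a = π.prob l o a := by
  simp [explore, hl]

lemma Policy.explore_prob_of_test (π : Policy O A) (u : Fin (m - 1) → A) {l : List (O × A)}
    (hl : h ≤ l.length ∧ l.length - h < m - 1) (o : O) :
    (π.explore h u).prob l o (u ⟨l.length - h, hl.2⟩) = 1 := by
  have : ¬ l.length + 1 < h := by omega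
  simp [explore, this, hl]

lemma Policy.explore_prob_of_unif (π : Policy O A) (u : Fin (m - 1) → A) {l : List (O × A)}
    (h1 : ¬ l.length + 1 < h) (h2 : ¬ (h ≤ l.length ∧ l.length - h < m - 1)) (o : O) (a : A) :
    (π.explore h u).prob l o a = 1 / Fintype.card A := by
  simp only [explore, h1, h2, if_false, dite_false]

lemma Policy.explore_listWeight_test (π : Policy O A) (L : List (O × A)) (hL : L.length = h + m)
    (hm : 1 ≤ m) (pre t r : List (O × A)) (hLt : L = pre ++ (t ++ r)) (hpre : h ≤ pre.length)
    (ht : pre.length + t.length ≤ h + (m - 1)) :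
    (π.explore h fun i : Fin (m - 1) => (L[h + i]'(by omega)).2).listWeight pre t = 1 := by
  induction t generalizing pre with
  | nil => rfl
  | cons p t ih =>
    simp only [List.length_cons] at ht
    rw [listWeight, ih (pre ++ [p]) (by simp [hLt]) (by simp; omega) (by simp; omega), mul_one]
    have hl : h ≤ pre.length ∧ pre.length - h < m - 1 := by omega
    have hp : p = L[pre.length]'(by omega) := by simp [hLt]
    have := π.explore_prob_of_test (fun i : Fin (m - 1) => (L[h + i]'(by omega)).2) hl p.1
    simp only [Nat.add_sub_cancel' hpre, ← hp] at this
    exact this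

/-- Some exploration policy follows a given sequence of `h + m` steps nearly as likely as the
policy on which it is based follows the first `h - 1` of them. -/
lemma Policy.exists_listWeight_take_le (π : Policy O A) (hm : 1 ≤ m) (L : List (O × A))
    (hL : L.length = h + m) : ∃ u : Fin (m - 1) → A, π.listWeight [] (L.take (h - 1)) ≤
      (Fintype.card A : ℝ) ^ 2 * (π.explore h u).listWeight [] L := by
  refine ⟨fun i => (L[h + i]'(by omega)).2, ?_⟩
  set ρ := π.explore h fun i : Fin (m - 1) => (L[h + i]'(by omega)).2 with hρ
  have hA : (1 : ℝ) ≤ Fintype.card A := by exact_mod_cast Fintype.card_pos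
  have hA0 : (Fintype.card A : ℝ) ≠ 0 := by simp
  obtain ⟨l, r, rfl, hlen⟩ : ∃ l r, L = l ++ r ∧ l.length = h :=
    ⟨L.take h, L.drop h, (List.take_append_drop h L).symm, by simp; omega⟩
  have hr : r.length = (m - 1) + 1 := by simp at hL; omega
  obtain ⟨t, p, rfl⟩ : ∃ t p, r = t ++ [p] := by
    rcases List.eq_nil_or_concat r with h0 | ⟨t, p, h0⟩
    · simp [h0] at hr
    · exact ⟨t, p, by simpa using h0⟩
  have htl : t.length = m - 1 := by simpa using hr
  have h1 : ρ.listWeight l t = 1 :=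
    π.explore_listWeight_test _ hL hm l t [p] rfl hlen.ge (by omega)
  have h2 : ρ.listWeight (l ++ t) [p] = 1 / Fintype.card A := by
    rw [listWeight, listWeight, mul_one]
    exact π.explore_prob_of_unif _ (by simp; omega) (by simp; omega) _ _
  have h3 : π.listWeight [] (l.take (h - 1)) ≤ Fintype.card A * ρ.listWeight [] l := by
    rcases List.eq_nil_or_concat l with rfl | ⟨l', q, rfl⟩
    · simpa [listWeight] using hA
    · simp only [List.concat_eq_append, List.length_append, List.length_singleton] at hlen ⊢
      have h4 : ρ.listWeight [] l' = π.listWeight [] l' := by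
        refine listWeight_congr _ _ fun q hq o a => π.explore_prob_of_lt _ ?_ _ _
        simp at hq; omega
      rw [listWeight_append, h4, listWeight, listWeight, mul_one, List.nil_append,
        π.explore_prob_of_unif _ (by omega) (by omega), mul_left_comm, mul_one_div_cancel hA0,
        mul_one, List.take_left' (by omega)]
  rw [List.take_append_of_le_length (by omega), listWeight_append, listWeight_append,
    List.nil_append, h1, h2, one_mul, pow_two]
  calc π.listWeight [] (l.take (h - 1)) ≤ Fintype.card A * ρ.listWeight [] l := h3
    _ = _ := by field_simp

end Explore

/-- The law of a prefix of the trajectory is a marginal of the law of the trajectory. -/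
lemma lawDist_mono (hM : M.IsValid H) (hN : N.IsValid H) (π : Policy O A) {k : ℕ} (hk : k ≤ H) :
    lawDist M N k π ≤ lawDist M N H π := by
  obtain ⟨j, rfl⟩ := Nat.exists_eq_add_of_le hk
  rw [lawDist, lawDist, listSum_add]
  refine listSum_mono fun l hl => ?_
  simp only [Policy.listWeight_append, List.nil_append, mul_assoc]
  rw [← mul_listSum]
  refine mul_le_mul_of_nonneg_left ?_ (π.listWeight_nonneg _ _)
  have h1 := listSum_weight_histProb hM π j l l (by omega)
  have h2 := listSum_weight_histProb hN π j l l (by omega)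
  have h3 : M.histProb l - N.histProb l =
      listSum j fun r => π.listWeight l r * (M.histProb (l ++ r) - N.histProb (l ++ r)) := by
    rw [← h1, ← h2]
    unfold listSum
    rw [← Finset.sum_sub_distrib]
    exact Finset.sum_congr rfl fun _ _ => by ring
  rw [h3]
  refine (abs_listSum_le _ _).trans (le_of_eq (listSum_congr fun r _ => ?_))
  rw [abs_mul, abs_of_nonneg (π.listWeight_nonneg _ _)]

/-- The difference of the laws of the first `h + m` observations, summed over all actions from
step `h` on, while the earlier actions are chosen by the policy. -/
def prefixDist (M N : POMDP S O A) (m h : ℕ) (π : Policy O A) : ℝ :=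
  listSum (h + m) fun L => π.listWeight [] (L.take (h - 1)) * |M.histProb L - N.histProb L|

lemma prefixDist_nonneg (M N : POMDP S O A) (m h : ℕ) (π : Policy O A) :
    0 ≤ prefixDist M N m h π :=
  listSum_nonneg fun _ _ => mul_nonneg (π.listWeight_nonneg _ _) (abs_nonneg _)

/-- The exploration policies detect every difference between the models in the futures of the
histories of length `h`. -/
lemma prefixDist_le [Nonempty A] (hM : M.IsValid H) (hN : N.IsValid H) (hm : 1 ≤ m)
    (hh : h + m ≤ H) (π : Policy O A) : prefixDist M N m h π ≤
      (Fintype.card A : ℝ) ^ 2 * ∑ u : Fin (m - 1) → A, lawDist M N H (π.explore h u) := by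
  calc prefixDist M N m h π
      ≤ (Fintype.card A : ℝ) ^ 2 * ∑ u : Fin (m - 1) → A, lawDist M N (h + m) (π.explore h u) := by
        unfold lawDist
        rw [← listSum_sum, mul_listSum]
        refine listSum_mono fun L hL => ?_
        obtain ⟨u, hu⟩ := π.exists_listWeight_take_le hm L hL
        rw [← Finset.sum_mul, ← mul_assoc]
        refine mul_le_mul_of_nonneg_right (hu.trans ?_) (abs_nonneg _)
        refine mul_le_mul_of_nonneg_left ?_ (by positivity)
        exact Finset.single_le_sum
          (f := fun u : Fin (m - 1) → A => (π.explore h u).listWeight [] L)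
          (fun u _ => Policy.listWeight_nonneg _ _ _) (Finset.mem_univ u)
    _ ≤ _ := by
        refine mul_le_mul_of_nonneg_left (Finset.sum_le_sum fun u _ => ?_) (by positivity)
        exact lawDist_mono hM hN _ hh

/-- The total distance of the laws of the data collected in one iteration. -/
def dataDist [Nonempty A] (M N : POMDP S O A) (H m : ℕ) (π : Policy O A) : ℝ :=
  ∑ i : Index A H m, lawDist M N H (π.explore i.1 i.2)

lemma sum_prefixDist_le [Nonempty A] (hM : M.IsValid H) (hN : N.IsValid H) (hm : 1 ≤ m)
    (hmH : m ≤ H) (π : Policy O A) : ∑ h : Fin (H - m + 1), prefixDist M N m h π ≤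
      (Fintype.card A : ℝ) ^ 2 * dataDist M N H m π := by
  rw [dataDist, Fintype.sum_prod_type, Finset.mul_sum]
  exact Finset.sum_le_sum fun h _ => prefixDist_le hM hN hm (by omega) π

lemma l1_pred_sub_le [Nonempty A] (hM : M.IsValid H) (hN : N.IsValid H) (hm : 1 ≤ m)
    (l : List (O × A)) (hl : l.length + m ≤ H) : l1 (N.pred m l - M.pred m l) ≤
      listSum m fun r => |M.histProb (l ++ r) - N.histProb (l ++ r)| := by
  obtain ⟨a⟩ := ‹Nonempty A›
  have h2 := sum_testList_le (n := m - 1) a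
    (fun r => |M.histProb (l ++ r) - N.histProb (l ++ r)|) fun _ => abs_nonneg _
  rw [show m - 1 + 1 = m by omega] at h2
  refine le_trans (le_of_eq ?_) h2
  refine Finset.sum_congr rfl fun u _ => ?_
  rw [Pi.sub_apply, POMDP.pred_eq hM hm l a u hl, POMDP.pred_eq hN hm l a u hl, abs_sub_comm]

/-- In its own environment `M` the representation makes no error. Hence its error in `N` comes from
the change of the predictive state and from the change of the probabilities of the futures. -/
lemma CoreRep.err_le [Nonempty A] (hM : M.IsValid H) (hN : N.IsValid H) (hm : 1 ≤ m)
    (hα : 0 < α) (R : CoreRep M H m h α) {k : ℕ} (hk : 1 ≤ k) (hkH : h + k ≤ H)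
    (hmH : h + m ≤ H) (l : List (O × A)) (hl : l.length = h) :
    R.err N k l ≤ (Fintype.card A : ℝ) ^ k * (1 / α) *
        listSum m (fun r => |M.histProb (l ++ r) - N.histProb (l ++ r)|) +
      listSum k fun r => |M.histProb (l ++ r) - N.histProb (l ++ r)| := by
  have h1 := R.listSum_abs_fut_le hM k hkH (N.pred m l - M.pred m l)
  have h2 := mul_le_mul_of_nonneg_left (l1_pred_sub_le hM hN hm l (by omega))
    (show 0 ≤ (Fintype.card A : ℝ) ^ k * (1 / α) by positivity)
  rw [← mul_assoc] at h1
  refine le_trans ?_ (add_le_add (h1.trans h2) le_rfl)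
  rw [err, ← listSum_add_fun]
  refine listSum_mono fun r hr => ?_
  have hr0 : r ≠ [] := by rintro rfl; simp at hr; omega
  rw [R.fut_sub, R.fut_pred hl hr0 (by omega)]
  exact abs_sub_le _ _ _

lemma listSum_weight_histProb_sub_le (π : Policy O A) (m h : ℕ) :
    listSum h (fun l => π.listWeight [] l *
      listSum m fun r => |M.histProb (l ++ r) - N.histProb (l ++ r)|) ≤ prefixDist M N m h π := by
  rw [prefixDist, listSum_add]
  refine listSum_mono fun l hl => ?_
  rw [mul_listSum]
  refine listSum_mono fun r hr => mul_le_mul_of_nonneg_right ?_ (abs_nonneg _)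
  rw [List.take_append_of_le_length (by omega)]
  conv_lhs => rw [← List.take_append_drop (h - 1) l, Policy.listWeight_append]
  exact mul_le_of_le_one_right (π.listWeight_nonneg _ _) (π.listWeight_le_one _ _)

lemma listSum_weight_histProb_sub_succ (π : Policy O A) (m h : ℕ) :
    listSum h (fun l => π.listWeight [] l *
      listSum (m + 1) fun r => |M.histProb (l ++ r) - N.histProb (l ++ r)|) =
      prefixDist M N m (h + 1) π := by
  rw [prefixDist, show h + 1 + m = h + (m + 1) by omega, listSum_add]
  refine listSum_congr fun l hl => ?_
  rw [mul_listSum]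
  refine listSum_congr fun r hr => ?_
  rw [List.take_left' (by omega)]

/-- The representation errors along a policy are controlled by the data collected with it. -/
lemma CoreRep.listSum_weight_err_le [Nonempty A] (hM : M.IsValid H) (hN : N.IsValid H)
    (hm : 1 ≤ m) (hmH : m ≤ H) (hα : 0 < α) {h : Fin (H - m + 1)}
    (R : CoreRep M H m h α) (π : Policy O A) :
    listSum (h : ℕ) (fun l => π.listWeight [] l * R.err N (futLen H m h) l) ≤
      ((Fintype.card A : ℝ) ^ (m + 1) * (1 / α) + 1) *
        ((Fintype.card A : ℝ) ^ 2 * dataDist M N H m π) := by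
  set k := futLen H m h with hk
  have hkm : k ≤ m + 1 := by rw [hk, futLen]; split_ifs <;> omega
  have hk1 : 1 ≤ k := by rw [hk, futLen]; split_ifs <;> omega
  have hkH : h + k ≤ H := by rw [hk, futLen]; split_ifs <;> omega
  have hA : (1 : ℝ) ≤ Fintype.card A := by exact_mod_cast Fintype.card_pos
  have hpow : (Fintype.card A : ℝ) ^ k ≤ (Fintype.card A : ℝ) ^ (m + 1) :=
    pow_le_pow_right₀ hA hkm
  have hsum := sum_prefixDist_le hM hN hm hmH π
  have hterm : ∀ i : Fin (H - m + 1), prefixDist M N m i π ≤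
      ∑ h : Fin (H - m + 1), prefixDist M N m h π := fun i =>
    Finset.single_le_sum (f := fun h : Fin (H - m + 1) => prefixDist M N m h π)
      (fun i _ => prefixDist_nonneg _ _ _ _ _) (Finset.mem_univ i)
  have hsecond : listSum (h : ℕ) (fun l => π.listWeight [] l *
      listSum k fun r => |M.histProb (l ++ r) - N.histProb (l ++ r)|) ≤
      ∑ h : Fin (H - m + 1), prefixDist M N m h π := by
    by_cases hh : (h : ℕ) < H - m
    · rw [hk, futLen, if_pos hh, listSum_weight_histProb_sub_succ]
      exact hterm ⟨h + 1, by omega⟩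
    · rw [hk, futLen, if_neg hh]
      exact (listSum_weight_histProb_sub_le π m h).trans (hterm h)
  have hfirst := (listSum_weight_histProb_sub_le (M := M) (N := N) π m h).trans (hterm h)
  have h0 : 0 ≤ ∑ h : Fin (H - m + 1), prefixDist M N m h π :=
    Finset.sum_nonneg fun _ _ => prefixDist_nonneg _ _ _ _ _
  calc listSum (h : ℕ) (fun l => π.listWeight [] l * R.err N k l)
      ≤ (Fintype.card A : ℝ) ^ k * (1 / α) * listSum (h : ℕ) (fun l => π.listWeight [] l *
          listSum m fun r => |M.histProb (l ++ r) - N.histProb (l ++ r)|) +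
        listSum (h : ℕ) (fun l => π.listWeight [] l *
          listSum k fun r => |M.histProb (l ++ r) - N.histProb (l ++ r)|) := by
        rw [mul_listSum, ← listSum_add_fun]
        refine listSum_mono fun l hl => ?_
        refine (mul_le_mul_of_nonneg_left (R.err_le hM hN hm hα hk1 hkH (by omega) l hl)
          (π.listWeight_nonneg _ _)).trans (le_of_eq (by ring))
    _ ≤ (Fintype.card A : ℝ) ^ (m + 1) * (1 / α) *
          (∑ h : Fin (H - m + 1), prefixDist M N m h π) +
          ∑ h : Fin (H - m + 1), prefixDist M N m h π := by
        refine add_le_add ?_ hsecond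
        refine mul_le_mul ?_ hfirst ?_ (by positivity)
        · exact mul_le_mul_of_nonneg_right hpow (by positivity)
        · exact listSum_nonneg fun l _ => mul_nonneg (π.listWeight_nonneg _ _)
            (listSum_nonneg fun _ _ => abs_nonneg _)
    _ ≤ _ := by
        rw [← add_one_mul]
        exact mul_le_mul_of_nonneg_left hsum (by positivity)

lemma l1_pred_nil_sub_le [Nonempty A] (hM : M.IsValid H) (hN : N.IsValid H) (hm : 1 ≤ m)
    (hmH : m ≤ H) (π : Policy O A) : l1 (M.pred m [] - N.pred m []) ≤
      (Fintype.card A : ℝ) ^ 2 * dataDist M N H m π := by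
  refine le_trans ?_ (sum_prefixDist_le hM hN hm hmH π)
  have h1 := l1_pred_sub_le hN hM hm [] (by simpa using hmH)
  have h2 : (listSum m fun r => |N.histProb ([] ++ r) - M.histProb ([] ++ r)|) =
      prefixDist M N m ((0 : Fin (H - m + 1)) : ℕ) π := by
    rw [prefixDist]
    simp only [Fin.val_zero, Nat.zero_add]
    refine listSum_congr fun r _ => ?_
    simp [Policy.listWeight, abs_sub_comm]
  rw [h2] at h1
  exact h1.trans (Finset.single_le_sum (f := fun h : Fin (H - m + 1) => prefixDist M N m h π)
      (fun i _ => prefixDist_nonneg _ _ _ _ _) (Finset.mem_univ 0))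

end

/-! ### An `ℓ¹` elliptical potential -/

section

section Potential

variable {n : ℕ}

lemma dotProduct_mulVec_comm {A : Matrix (Fin n) (Fin n) ℝ} (hA : A.PosDef) (v y : Fin n → ℝ) :
    y ⬝ᵥ A *ᵥ v = v ⬝ᵥ A *ᵥ y := by
  have hT : Aᵀ = A := by simpa using hA.isHermitian.eq
  rw [Matrix.dotProduct_mulVec, ← Matrix.mulVec_transpose, hT, dotProduct_comm]

lemma quad_nonneg {A : Matrix (Fin n) (Fin n) ℝ} (hA : A.PosDef) (v : Fin n → ℝ) :
    0 ≤ v ⬝ᵥ A *ᵥ v := by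
  simpa using hA.posSemidef.dotProduct_mulVec_nonneg v

lemma dotProduct_mulVec_sq_le {A : Matrix (Fin n) (Fin n) ℝ} (hA : A.PosDef) (v y : Fin n → ℝ) :
    (v ⬝ᵥ A *ᵥ y) ^ 2 ≤ (v ⬝ᵥ A *ᵥ v) * (y ⬝ᵥ A *ᵥ y) := by
  have h : ∀ t : ℝ, 0 ≤ (y ⬝ᵥ A *ᵥ y) * (t * t) + (2 * (v ⬝ᵥ A *ᵥ y)) * t + v ⬝ᵥ A *ᵥ v := by
    intro t
    have := quad_nonneg hA (v + t • y)
    simp only [Matrix.mulVec_add, Matrix.mulVec_smul, add_dotProduct, dotProduct_add,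
      smul_dotProduct, dotProduct_smul, smul_eq_mul, dotProduct_mulVec_comm hA v y] at this
    linarith
  have := discrim_le_zero h
  rw [discrim] at this
  linarith

/-- Cauchy–Schwarz for the norms of a positive definite matrix and of its inverse. -/
lemma dotProduct_sq_le {A : Matrix (Fin n) (Fin n) ℝ} (hA : A.PosDef) (v x : Fin n → ℝ) :
    (v ⬝ᵥ x) ^ 2 ≤ (v ⬝ᵥ A *ᵥ v) * (x ⬝ᵥ A⁻¹ *ᵥ x) := by
  have hdet : IsUnit A.det := (Matrix.isUnit_iff_isUnit_det A).1 hA.isUnit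
  have h1 : A *ᵥ (A⁻¹ *ᵥ x) = x := by
    rw [Matrix.mulVec_mulVec, Matrix.mul_nonsing_inv A hdet, Matrix.one_mulVec]
  have := dotProduct_mulVec_sq_le hA v (A⁻¹ *ᵥ x)
  rwa [h1, dotProduct_comm (A⁻¹ *ᵥ x)] at this

lemma quad_vecMulVec (c : ℝ) (v x : Fin n → ℝ) :
    v ⬝ᵥ (c • Matrix.vecMulVec x x) *ᵥ v = c * (v ⬝ᵥ x) ^ 2 := by
  rw [Matrix.smul_mulVec, Matrix.vecMulVec_mulVec, dotProduct_smul, dotProduct_smul]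
  simp only [op_smul_eq_smul, smul_eq_mul, dotProduct_comm x v]
  ring

lemma posDef_add_smul_vecMulVec {A : Matrix (Fin n) (Fin n) ℝ} (hA : A.PosDef) {c : ℝ}
    (hc : 0 ≤ c) (x : Fin n → ℝ) : (A + c • Matrix.vecMulVec x x).PosDef := by
  refine hA.add_posSemidef (Matrix.PosSemidef.smul ?_ hc)
  simpa using Matrix.posSemidef_vecMulVec_self_star x

/-- The matrix determinant lemma for a rank-one update of a positive definite matrix. -/
lemma det_add_smul_vecMulVec {A : Matrix (Fin n) (Fin n) ℝ} (hA : A.PosDef) (c : ℝ)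
    (x : Fin n → ℝ) :
    (A + c • Matrix.vecMulVec x x).det = A.det * (1 + c * (x ⬝ᵥ A⁻¹ *ᵥ x)) := by
  have hdet : IsUnit A.det := (Matrix.isUnit_iff_isUnit_det A).1 hA.isUnit
  have h := Matrix.det_add_replicateCol_mul_replicateRow (ι := Unit) hdet (c • x) x
  have h1 : c • Matrix.vecMulVec x x =
      Matrix.replicateCol Unit (c • x) * Matrix.replicateRow Unit x := by
    ext i j; simp [Matrix.vecMulVec_apply, Matrix.mul_apply, mul_assoc]
  rw [h1, h, Matrix.det_unique (n := Unit), Matrix.add_apply, Matrix.one_apply_eq]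
  congr 2
  have : (Matrix.replicateRow Unit x * A⁻¹ * Matrix.replicateCol Unit (c • x)) default default =
      x ⬝ᵥ A⁻¹ *ᵥ (c • x) := by
    rw [Matrix.mul_assoc, Matrix.mul_apply]
    rfl
  rw [this, Matrix.mulVec_smul, dotProduct_smul, smul_eq_mul]

lemma det_le_trace_pow {A : Matrix (Fin n) (Fin n) ℝ} (hA : A.PosDef) :
    A.det ≤ A.trace ^ n := by
  have hd := hA.isHermitian.det_eq_prod_eigenvalues
  have ht := hA.isHermitian.trace_eq_sum_eigenvalues
  simp only [RCLike.ofReal_real_eq_id, id_eq] at hd ht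
  rw [hd, ht]
  calc _ ≤ ∏ _i : Fin n, ∑ i, hA.isHermitian.eigenvalues i :=
        Finset.prod_le_prod (fun i _ => (hA.eigenvalues_pos i).le) fun i _ =>
          Finset.single_le_sum (fun i _ => (hA.eigenvalues_pos i).le) (Finset.mem_univ i)
    _ = _ := by simp

/-- The regularized Gram matrix of the first `j` vectors, where each vector is divided by the square
root of its norm with respect to the inverse of the matrix of its predecessors. With these weights
(in place of the equal weights of the usual elliptical potential) a bound on `∑ |w ⬝ x_s|` bounds
the norm of `w`. -/
def gram (ρ : ℝ) (x : ℕ → Fin n → ℝ) : ℕ → Matrix (Fin n) (Fin n) ℝ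
  | 0 => ρ ^ 2 • 1
  | j + 1 => gram ρ x j +
      (√(x j ⬝ᵥ (gram ρ x j)⁻¹ *ᵥ x j))⁻¹ • Matrix.vecMulVec (x j) (x j)

/-- The norm of the `j`-th vector with respect to the inverse Gram matrix of its predecessors. -/
def gramNorm (ρ : ℝ) (x : ℕ → Fin n → ℝ) (j : ℕ) : ℝ := √(x j ⬝ᵥ (gram ρ x j)⁻¹ *ᵥ x j)

variable {ρ : ℝ} {x : ℕ → Fin n → ℝ}

lemma gram_succ (j : ℕ) : gram ρ x (j + 1) =
    gram ρ x j + (gramNorm ρ x j)⁻¹ • Matrix.vecMulVec (x j) (x j) := rfl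

lemma gramNorm_nonneg (j : ℕ) : 0 ≤ gramNorm ρ x j := Real.sqrt_nonneg _

lemma gram_posDef (hρ : 0 < ρ) (j : ℕ) : (gram ρ x j).PosDef := by
  induction j with
  | zero => exact Matrix.PosDef.smul Matrix.PosDef.one (by positivity)
  | succ j ih => exact posDef_add_smul_vecMulVec ih (inv_nonneg.2 (gramNorm_nonneg j)) _

lemma gramNorm_sq (hρ : 0 < ρ) (j : ℕ) :
    gramNorm ρ x j ^ 2 = x j ⬝ᵥ (gram ρ x j)⁻¹ *ᵥ x j :=
  Real.sq_sqrt (quad_nonneg (gram_posDef hρ j).inv _)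

/-- With the weights of `gram`, the update by `x j` multiplies the determinant by `1 + gramNorm j`
(and not by `1 + gramNorm j ^ 2`, as without weights). If `gramNorm j = 0`, then `x j = 0`, and the
weight `0⁻¹ = 0` is harmless. -/
lemma det_gram (hρ : 0 < ρ) (j : ℕ) :
    (gram ρ x j).det = (ρ ^ 2) ^ n * ∏ i ∈ Finset.range j, (1 + gramNorm ρ x i) := by
  induction j with
  | zero => simp [gram]
  | succ j ih =>
    rw [gram_succ, det_add_smul_vecMulVec (gram_posDef hρ j), ih, Finset.prod_range_succ,
      ← gramNorm_sq hρ, mul_assoc]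
    congr 3
    by_cases h : gramNorm ρ x j = 0
    · simp [h]
    · field_simp

lemma quad_gram (w : Fin n → ℝ) (j : ℕ) :
    w ⬝ᵥ gram ρ x j *ᵥ w = ρ ^ 2 * (w ⬝ᵥ w) +
      ∑ i ∈ Finset.range j, (gramNorm ρ x i)⁻¹ * (w ⬝ᵥ x i) ^ 2 := by
  induction j with
  | zero => simp [gram, Matrix.smul_mulVec]
  | succ j ih =>
    rw [gram_succ, Matrix.add_mulVec, dotProduct_add, ih, quad_vecMulVec, Finset.sum_range_succ,
      add_assoc]

lemma quad_gram_mono (w : Fin n → ℝ) {i j : ℕ} (hij : i ≤ j) :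
    w ⬝ᵥ gram ρ x i *ᵥ w ≤ w ⬝ᵥ gram ρ x j *ᵥ w := by
  rw [quad_gram, quad_gram]
  have h : Finset.range i ⊆ Finset.range j := Finset.range_subset_range.2 hij
  have := Finset.sum_le_sum_of_subset_of_nonneg (f := fun i => (gramNorm ρ x i)⁻¹ * (w ⬝ᵥ x i) ^ 2)
    h fun i _ _ => mul_nonneg (inv_nonneg.2 (gramNorm_nonneg i)) (sq_nonneg _)
  linarith

lemma dotProduct_self_nonneg' (v : Fin n → ℝ) : 0 ≤ v ⬝ᵥ v :=
  Finset.sum_nonneg fun i _ => mul_self_nonneg (v i)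

lemma abs_dotProduct_le_gramNorm (hρ : 0 < ρ) (w : Fin n → ℝ) (j : ℕ) :
    |w ⬝ᵥ x j| ≤ √(w ⬝ᵥ gram ρ x j *ᵥ w) * gramNorm ρ x j := by
  rw [gramNorm, ← Real.sqrt_mul (quad_nonneg (gram_posDef hρ j) w)]
  exact Real.abs_le_sqrt (dotProduct_sq_le (gram_posDef hρ j) w (x j))

lemma gramNorm_le_one (hρ : 0 < ρ) (j : ℕ) (hx : x j ⬝ᵥ x j ≤ ρ ^ 2) : gramNorm ρ x j ≤ 1 := by
  have hA := gram_posDef (x := x) hρ j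
  set y := (gram ρ x j)⁻¹ *ᵥ x j with hy
  have hdet : IsUnit (gram ρ x j).det := (Matrix.isUnit_iff_isUnit_det _).1 hA.isUnit
  have hAy : gram ρ x j *ᵥ y = x j := by
    rw [hy, Matrix.mulVec_mulVec, Matrix.mul_nonsing_inv _ hdet, Matrix.one_mulVec]
  have h1 : ρ ^ 2 * (y ⬝ᵥ y) ≤ y ⬝ᵥ x j := by
    conv_rhs => rw [← hAy]
    have := quad_gram_mono (ρ := ρ) (x := x) y (Nat.zero_le j)
    simpa [gram, Matrix.smul_mulVec] using this
  have h2 : (y ⬝ᵥ x j) ^ 2 ≤ (y ⬝ᵥ y) * (x j ⬝ᵥ x j) := by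
    simpa using dotProduct_mulVec_sq_le (Matrix.PosDef.one (n := Fin n) (R := ℝ)) y (x j)
  have h3 : gramNorm ρ x j ^ 2 = y ⬝ᵥ x j := by rw [gramNorm_sq hρ, dotProduct_comm]
  have h4 : 0 ≤ y ⬝ᵥ y := dotProduct_self_nonneg' y
  rw [← h3] at h1 h2
  have h5 : (gramNorm ρ x j ^ 2) ^ 2 ≤ gramNorm ρ x j ^ 2 := by
    calc (gramNorm ρ x j ^ 2) ^ 2 ≤ (y ⬝ᵥ y) * (x j ⬝ᵥ x j) := h2
      _ ≤ (y ⬝ᵥ y) * ρ ^ 2 := mul_le_mul_of_nonneg_left hx h4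
      _ ≤ _ := by linarith
  by_contra hlt
  push Not at hlt
  have h6 : 1 < gramNorm ρ x j ^ 2 := one_lt_pow₀ hlt (by norm_num)
  nlinarith

lemma quad_gram_le_trace (v : Fin n → ℝ) (j : ℕ) :
    v ⬝ᵥ gram ρ x j *ᵥ v ≤ (gram ρ x j).trace * (v ⬝ᵥ v) := by
  induction j with
  | zero =>
    rcases Nat.eq_zero_or_pos n with rfl | hn
    · simp [dotProduct]
    · have hn' : (1 : ℝ) ≤ n := by exact_mod_cast hn
      simp only [gram, Matrix.smul_mulVec, Matrix.one_mulVec, dotProduct_smul, smul_eq_mul,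
        Matrix.trace_smul, Matrix.trace_one, Fintype.card_fin]
      have h0 := mul_nonneg (sq_nonneg ρ) (dotProduct_self_nonneg' v)
      nlinarith
  | succ j ih =>
    rw [gram_succ, Matrix.add_mulVec, dotProduct_add, quad_vecMulVec, Matrix.trace_add,
      Matrix.trace_smul, Matrix.trace_vecMulVec, add_mul, smul_eq_mul, mul_assoc]
    refine add_le_add ih (mul_le_mul_of_nonneg_left ?_ (inv_nonneg.2 (gramNorm_nonneg j)))
    rw [mul_comm]
    simpa using dotProduct_mulVec_sq_le (Matrix.PosDef.one (n := Fin n) (R := ℝ)) v (x j)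

lemma trace_gram_nonneg (hρ : 0 < ρ) (j : ℕ) : 0 ≤ (gram ρ x j).trace :=
  (gram_posDef hρ j).posSemidef.trace_nonneg

/-- Although the weights `(gramNorm j)⁻¹` are unbounded, the root of the trace grows only by the
length of the new vector, as this length is at most `√trace * gramNorm j`. -/
lemma sqrt_trace_gram_le (hρ : 0 < ρ) (j : ℕ) :
    √(gram ρ x j).trace ≤ √n * ρ + ∑ i ∈ Finset.range j, √(x i ⬝ᵥ x i) := by
  induction j with
  | zero =>
    simp only [gram, Matrix.trace_smul, Matrix.trace_one, Fintype.card_fin, smul_eq_mul,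
      Finset.range_zero, Finset.sum_empty, add_zero]
    rw [Real.sqrt_mul (sq_nonneg ρ), Real.sqrt_sq hρ.le, mul_comm]
  | succ j ih =>
    rw [Finset.sum_range_succ, ← add_assoc]
    refine le_trans ?_ (add_le_add ih le_rfl)
    set T := (gram ρ x j).trace with hT
    have hT0 : 0 ≤ T := trace_gram_nonneg hρ j
    have hN0 : 0 ≤ √(x j ⬝ᵥ x j) := Real.sqrt_nonneg _
    have hNsq : √(x j ⬝ᵥ x j) ^ 2 = x j ⬝ᵥ x j := Real.sq_sqrt (dotProduct_self_nonneg' _)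
    have hz := gramNorm_nonneg (ρ := ρ) (x := x) j
    have hle : √(x j ⬝ᵥ x j) ≤ √T * gramNorm ρ x j := by
      have h1 := abs_dotProduct_le_gramNorm hρ (x j) j (x := x)
      have h2 : √(x j ⬝ᵥ gram ρ x j *ᵥ x j) ≤ √T * √(x j ⬝ᵥ x j) := by
        rw [← Real.sqrt_mul hT0]
        exact Real.sqrt_le_sqrt (quad_gram_le_trace _ j)
      rw [abs_of_nonneg (dotProduct_self_nonneg' _), ← hNsq] at h1
      have h3 := h1.trans (mul_le_mul_of_nonneg_right h2 hz)
      rcases hN0.eq_or_lt with h0 | h0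
      · rw [← h0]; positivity
      · refine le_of_mul_le_mul_right ?_ h0
        calc √(x j ⬝ᵥ x j) * √(x j ⬝ᵥ x j) = √(x j ⬝ᵥ x j) ^ 2 := by ring
          _ ≤ _ := h3
          _ = _ := by ring
    have hinc : (gramNorm ρ x j)⁻¹ * (x j ⬝ᵥ x j) ≤ √T * √(x j ⬝ᵥ x j) := by
      rcases hz.eq_or_lt with h0 | h0
      · rw [← h0]; simp; positivity
      · rw [inv_mul_le_iff₀ h0]
        calc x j ⬝ᵥ x j = √(x j ⬝ᵥ x j) * √(x j ⬝ᵥ x j) := by rw [← pow_two, hNsq]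
          _ ≤ (√T * gramNorm ρ x j) * √(x j ⬝ᵥ x j) :=
            mul_le_mul_of_nonneg_right hle hN0
          _ = _ := by ring
    rw [Real.sqrt_le_left (by positivity), gram_succ, Matrix.trace_add, Matrix.trace_smul,
      Matrix.trace_vecMulVec, smul_eq_mul, ← hT]
    nlinarith [Real.sq_sqrt hT0, Real.sqrt_nonneg T, mul_nonneg (Real.sqrt_nonneg T) hN0]

/-- The potential argument: the determinant is a product of factors `1 + gramNorm j`, and it is
bounded by a power of the trace. -/
lemma sum_gramNorm_le (hρ : 0 < ρ) (N : ℕ) {k : ℝ} (hx : ∀ j < N, x j ⬝ᵥ x j ≤ ρ ^ 2)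
    (hsum : ∑ j ∈ Finset.range N, √(x j ⬝ᵥ x j) ≤ k * ρ) (hk : 1 ≤ √n + k) :
    ∑ j ∈ Finset.range N, gramNorm ρ x j ≤ 4 * n * Real.log (√n + k) := by
  have hdet := det_le_trace_pow (gram_posDef (x := x) hρ N)
  have htr : (gram ρ x N).trace ≤ (ρ * (√n + k)) ^ 2 := by
    have h1 := (sqrt_trace_gram_le (x := x) hρ N).trans (add_le_add le_rfl hsum)
    rw [Real.sqrt_le_left (by nlinarith)] at h1
    refine h1.trans (le_of_eq (by ring))
  have hprod : ∏ i ∈ Finset.range N, (1 + gramNorm ρ x i) ≤ ((√n + k) ^ 2) ^ n := by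
    rw [det_gram hρ] at hdet
    have h2 := hdet.trans (pow_le_pow_left₀ (trace_gram_nonneg hρ N) htr n)
    rw [mul_pow, mul_pow] at h2
    exact le_of_mul_le_mul_left h2 (by positivity)
  have hlog : ∑ i ∈ Finset.range N, Real.log (1 + gramNorm ρ x i) ≤
      2 * n * Real.log (√n + k) := by
    rw [← Real.log_prod fun i _ => by have := gramNorm_nonneg (ρ := ρ) (x := x) i; positivity]
    refine (Real.log_le_log ?_ hprod).trans (le_of_eq ?_)
    · exact Finset.prod_pos fun i _ => by
        have := gramNorm_nonneg (ρ := ρ) (x := x) i; positivity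
    · rw [Real.log_pow, Real.log_pow]; push_cast; ring
  have hterm : ∀ i ∈ Finset.range N, gramNorm ρ x i ≤ 2 * Real.log (1 + gramNorm ρ x i) := by
    intro i hi
    have h0 := gramNorm_nonneg (ρ := ρ) (x := x) i
    have h1 := gramNorm_le_one hρ i (hx i (Finset.mem_range.1 hi))
    have h2 := Real.one_sub_inv_le_log_of_pos (show 0 < 1 + gramNorm ρ x i by linarith)
    have h3 : gramNorm ρ x i / 2 ≤ 1 - (1 + gramNorm ρ x i)⁻¹ := by
      have : 1 - (1 + gramNorm ρ x i)⁻¹ = gramNorm ρ x i / (1 + gramNorm ρ x i) := by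
        field_simp; ring
      rw [this]
      exact div_le_div_of_nonneg_left h0 (by linarith) (by linarith)
    linarith
  refine (Finset.sum_le_sum hterm).trans ?_
  rw [← Finset.mul_sum]
  linarith

/-- A bound on `∑ |w ⬝ x i|`, without squares, bounds the norm `g` of `w`: by Cauchy–Schwarz each
weighted square is at most `g * |w ⬝ x i|`, so that `g ^ 2 ≤ (ρ * R) ^ 2 + g * γ`. -/
lemma sqrt_quad_gram_le (hρ : 0 < ρ) {R γ : ℝ} (hR : 0 ≤ R) (hγ : 0 ≤ γ) (w : Fin n → ℝ) (j : ℕ)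
    (hw : w ⬝ᵥ w ≤ R ^ 2) (hsum : ∑ i ∈ Finset.range j, |w ⬝ᵥ x i| ≤ γ) :
    √(w ⬝ᵥ gram ρ x j *ᵥ w) ≤ ρ * R + γ := by
  set g := √(w ⬝ᵥ gram ρ x j *ᵥ w) with hg
  have hg0 : 0 ≤ g := Real.sqrt_nonneg _
  have hgsq : g ^ 2 = w ⬝ᵥ gram ρ x j *ᵥ w := Real.sq_sqrt (quad_nonneg (gram_posDef hρ j) w)
  have hs : ∑ i ∈ Finset.range j, (gramNorm ρ x i)⁻¹ * (w ⬝ᵥ x i) ^ 2 ≤ g * γ := by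
    calc ∑ i ∈ Finset.range j, (gramNorm ρ x i)⁻¹ * (w ⬝ᵥ x i) ^ 2
        ≤ ∑ i ∈ Finset.range j, g * |w ⬝ᵥ x i| := by
          refine Finset.sum_le_sum fun i hi => ?_
          have h1 := abs_dotProduct_le_gramNorm (x := x) hρ w i
          have h2 : √(w ⬝ᵥ gram ρ x i *ᵥ w) ≤ g :=
            Real.sqrt_le_sqrt (quad_gram_mono w (Finset.mem_range.1 hi).le)
          have hz := gramNorm_nonneg (ρ := ρ) (x := x) i
          have h3 := h1.trans (mul_le_mul_of_nonneg_right h2 hz)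
          rcases hz.eq_or_lt with h0 | h0
          · rw [← h0]; simp; positivity
          · rw [inv_mul_le_iff₀ h0, ← sq_abs, pow_two]
            calc |w ⬝ᵥ x i| * |w ⬝ᵥ x i| ≤ (g * gramNorm ρ x i) * |w ⬝ᵥ x i| :=
                  mul_le_mul_of_nonneg_right h3 (abs_nonneg _)
              _ = _ := by ring
      _ = g * ∑ i ∈ Finset.range j, |w ⬝ᵥ x i| := (Finset.mul_sum _ _ _).symm
      _ ≤ g * γ := mul_le_mul_of_nonneg_left hsum hg0
  rw [quad_gram] at hgsq
  by_contra hlt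
  push Not at hlt
  have h1 : ρ ^ 2 * (w ⬝ᵥ w) ≤ (ρ * R) ^ 2 := by
    rw [mul_pow]; exact mul_le_mul_of_nonneg_left hw (sq_nonneg _)
  have hρR : 0 ≤ ρ * R := mul_nonneg hρ.le hR
  nlinarith [mul_nonneg hρR hγ]

/-- If every `w j` is nearly orthogonal, in total, to the vectors before `x j`, then the sum of all
`|w j ⬝ x j|` is small. -/
lemma sum_abs_dotProduct_le (hρ : 0 < ρ) {R γ k : ℝ} (hR : 0 ≤ R) (hγ : 0 ≤ γ) (N : ℕ)
    (w : ℕ → Fin n → ℝ) (hx : ∀ j < N, x j ⬝ᵥ x j ≤ ρ ^ 2)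
    (hsum : ∑ j ∈ Finset.range N, √(x j ⬝ᵥ x j) ≤ k * ρ) (hk : 1 ≤ √n + k)
    (hw : ∀ j < N, w j ⬝ᵥ w j ≤ R ^ 2)
    (hprev : ∀ j < N, ∑ i ∈ Finset.range j, |w j ⬝ᵥ x i| ≤ γ) :
    ∑ j ∈ Finset.range N, |w j ⬝ᵥ x j| ≤ (ρ * R + γ) * (4 * n * Real.log (√n + k)) := by
  have hρR : 0 ≤ ρ * R := mul_nonneg hρ.le hR
  calc ∑ j ∈ Finset.range N, |w j ⬝ᵥ x j|
      ≤ ∑ j ∈ Finset.range N, (ρ * R + γ) * gramNorm ρ x j := by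
        refine Finset.sum_le_sum fun j hj => ?_
        have hj := Finset.mem_range.1 hj
        exact (abs_dotProduct_le_gramNorm hρ (w j) j).trans (mul_le_mul_of_nonneg_right
          (sqrt_quad_gram_le hρ hR hγ (w j) j (hw j hj) (hprev j hj)) (gramNorm_nonneg j))
    _ = (ρ * R + γ) * ∑ j ∈ Finset.range N, gramNorm ρ x j := (Finset.mul_sum _ _ _).symm
    _ ≤ _ := mul_le_mul_of_nonneg_left (sum_gramNorm_le hρ N hx hsum hk) (by positivity)

lemma dotProduct_self_le_l1_sq (v : Fin n → ℝ) : v ⬝ᵥ v ≤ l1 v ^ 2 := by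
  have := Finset.sum_sq_le_sq_sum_of_nonneg (s := Finset.univ) (f := fun i => |v i|)
    fun i _ => abs_nonneg _
  simp only [sq_abs] at this
  refine le_trans (le_of_eq ?_) this
  simp [dotProduct, pow_two]

/-- The potential bound for batches of vectors and for families of functionals: if for every `k`
the functionals `w k` are small in total on the earlier batches, then the sum of their values on
their own batches is small. -/
lemma sum_sum_abs_dotProduct_le {I L : Type*} [Fintype I] [Fintype L] {K : ℕ} (hK : 1 ≤ K)
    (x : Fin K → I → Fin n → ℝ) (w : Fin K → L → Fin n → ℝ) {ρ R γ : ℝ} (hρ : 0 < ρ) (hR : 0 ≤ R)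
    (hγ : 0 ≤ γ) (hx : ∀ k, ∑ i, l1 (x k i) ≤ ρ) (hw : ∀ k j, ∑ l, |w k l j| ≤ R)
    (hprev : ∀ k, ∑ k' with k' < k, ∑ i, ∑ l, |w k l ⬝ᵥ x k' i| ≤ γ) :
    ∑ k, ∑ i, ∑ l, |w k l ⬝ᵥ x k i| ≤
      (ρ * (√n * R) + (γ + ρ * R)) * (4 * n * Real.log (√n + K)) := by
  set c := Fintype.card I with hc
  let e : I ≃ Fin c := Fintype.equivFin I
  -- The vectors are enumerated batch by batch.
  let pr : Fin (K * c) → Fin K × I := fun j =>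
    ((finProdFinEquiv.symm j).1, e.symm (finProdFinEquiv.symm j).2)
  have hpr : ∀ f : Fin K → I → ℝ, ∑ j, f (pr j).1 (pr j).2 = ∑ k, ∑ i, f k i := by
    intro f
    rw [← Fintype.sum_prod_type',
      ← ((Equiv.prodCongr (Equiv.refl _) e).trans finProdFinEquiv).symm.sum_comp]
    rfl
  have hprmono : ∀ i j : Fin (K * c), i ≤ j → (pr i).1 ≤ (pr j).1 := fun i j hij =>
    Nat.div_le_div_right (c := c) hij
  let W : Fin K → I → Fin n → ℝ := fun k i =>
    ∑ l, (SignType.sign (w k l ⬝ᵥ x k i) : ℝ) • w k l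
  have hsign : ∀ t : ℝ, |(SignType.sign t : ℝ)| ≤ 1 := by
    intro t
    rcases lt_trichotomy t 0 with h | h | h <;> simp [h]
  have hWabs : ∀ k i y, |W k i ⬝ᵥ y| ≤ ∑ l, |w k l ⬝ᵥ y| := by
    intro k i y
    rw [sum_dotProduct]
    refine (Finset.abs_sum_le_sum_abs _ _).trans (Finset.sum_le_sum fun l _ => ?_)
    rw [smul_dotProduct, smul_eq_mul, abs_mul]
    exact mul_le_of_le_one_left (abs_nonneg _) (hsign _)
  have hWeq : ∀ k i, ∑ l, |w k l ⬝ᵥ x k i| = W k i ⬝ᵥ x k i := by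
    intro k i
    rw [sum_dotProduct]
    refine Finset.sum_congr rfl fun l _ => ?_
    rw [smul_dotProduct, smul_eq_mul, sign_mul_self]
  have hWnorm : ∀ k i, W k i ⬝ᵥ W k i ≤ (√n * R) ^ 2 := by
    intro k i
    have h1 : ∀ j, W k i j * W k i j ≤ R ^ 2 := by
      intro j
      have h2 : |W k i j| ≤ R := by
        refine le_trans ?_ (hw k j)
        simp only [W, Finset.sum_apply]
        refine (Finset.abs_sum_le_sum_abs _ _).trans (Finset.sum_le_sum fun l _ => ?_)
        rw [Pi.smul_apply, smul_eq_mul, abs_mul]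
        exact mul_le_of_le_one_left (abs_nonneg _) (hsign _)
      rw [← pow_two]
      exact sq_le_sq' (abs_le.1 h2).1 (abs_le.1 h2).2
    rw [mul_pow, Real.sq_sqrt (Nat.cast_nonneg n)]
    refine (Finset.sum_le_sum fun j _ => h1 j).trans (le_of_eq ?_)
    simp
  have hbatch : ∀ k k' : Fin K, ∑ i, ∑ l, |w k l ⬝ᵥ x k' i| ≤ ρ * R := by
    intro k k'
    have h1 : ∀ i, ∑ l, |w k l ⬝ᵥ x k' i| ≤ l1 (x k' i) * R := by
      intro i
      calc ∑ l, |w k l ⬝ᵥ x k' i| ≤ ∑ l, ∑ j, |w k l j| * |x k' i j| := by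
            refine Finset.sum_le_sum fun l _ => (Finset.abs_sum_le_sum_abs _ _).trans ?_
            simp only [abs_mul, le_refl]
        _ = ∑ j, |x k' i j| * ∑ l, |w k l j| := by
            rw [Finset.sum_comm]
            refine Finset.sum_congr rfl fun j _ => ?_
            rw [← Finset.sum_mul, mul_comm]
        _ ≤ ∑ j, |x k' i j| * R := Finset.sum_le_sum fun j _ =>
            mul_le_mul_of_nonneg_left (hw k j) (abs_nonneg _)
        _ = _ := by rw [← Finset.sum_mul]; rfl
    refine (Finset.sum_le_sum fun i _ => h1 i).trans ?_
    rw [← Finset.sum_mul]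
    exact mul_le_mul_of_nonneg_right (hx k') hR
  have hxl : ∀ k i, l1 (x k i) ≤ ρ := fun k i =>
    (Finset.single_le_sum (f := fun i => l1 (x k i)) (fun i _ => l1_nonneg _)
      (Finset.mem_univ i)).trans (hx k)
  let xs : ℕ → Fin n → ℝ := fun j => if h : j < K * c then x (pr ⟨j, h⟩).1 (pr ⟨j, h⟩).2 else 0
  let ws : ℕ → Fin n → ℝ := fun j => if h : j < K * c then W (pr ⟨j, h⟩).1 (pr ⟨j, h⟩).2 else 0
  have hxs : ∀ j : Fin (K * c), xs j = x (pr j).1 (pr j).2 := fun j => by simp [xs]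
  have hws : ∀ j : Fin (K * c), ws j = W (pr j).1 (pr j).2 := fun j => by simp [ws]
  have hn : (1 : ℝ) ≤ √n + K := by
    have h1 : (1 : ℝ) ≤ K := by exact_mod_cast hK
    have := Real.sqrt_nonneg n
    linarith
  have hmain := sum_abs_dotProduct_le (x := xs) hρ (R := √n * R) (γ := γ + ρ * R) (k := K)
    (by positivity) (by positivity) (K * c) ws ?_ ?_ hn ?_ ?_
  · rw [Finset.sum_range] at hmain
    simp only [hxs, hws] at hmain
    rw [hpr fun k i => |W k i ⬝ᵥ x k i|] at hmain
    refine le_trans (Finset.sum_le_sum fun k _ => Finset.sum_le_sum fun i _ => ?_) hmain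
    rw [hWeq]
    exact le_abs_self _
  · intro j hj
    rw [hxs ⟨j, hj⟩]
    exact (dotProduct_self_le_l1_sq _).trans (pow_le_pow_left₀ (l1_nonneg _) (hxl _ _) 2)
  · rw [Finset.sum_range]
    simp only [hxs]
    rw [hpr fun k i => √(x k i ⬝ᵥ x k i)]
    calc ∑ k, ∑ i, √(x k i ⬝ᵥ x k i) ≤ ∑ _k : Fin K, ρ := by
          refine Finset.sum_le_sum fun k _ => le_trans (Finset.sum_le_sum fun i _ => ?_) (hx k)
          rw [Real.sqrt_le_left (l1_nonneg _)]
          exact dotProduct_self_le_l1_sq _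
      _ = K * ρ := by simp
  · intro j hj
    rw [hws ⟨j, hj⟩]
    exact hWnorm _ _
  · intro j hj
    rw [hws ⟨j, hj⟩]
    set k := (pr ⟨j, hj⟩).1 with hk
    set i₀ := (pr ⟨j, hj⟩).2
    calc ∑ i ∈ Finset.range j, |W k i₀ ⬝ᵥ xs i|
        ≤ ∑ i : Fin (K * c), if (pr i).1 ≤ k then |W k i₀ ⬝ᵥ x (pr i).1 (pr i).2| else 0 := by
          have h1 : ∑ i ∈ Finset.range j, |W k i₀ ⬝ᵥ xs i| ≤
              ∑ i ∈ Finset.range (K * c), if i < j then |W k i₀ ⬝ᵥ xs i| else 0 := by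
            rw [← Finset.sum_filter]
            refine Finset.sum_le_sum_of_subset_of_nonneg (fun i hi => ?_) fun _ _ _ => abs_nonneg _
            have := Finset.mem_range.1 hi
            simp; omega
          refine h1.trans ?_
          rw [Finset.sum_range]
          refine Finset.sum_le_sum fun i _ => ?_
          rw [hxs]
          by_cases hij : (i : ℕ) < j
          · rw [if_pos hij, if_pos (hprmono i ⟨j, hj⟩ hij.le)]
          · rw [if_neg hij]
            split_ifs
            · exact abs_nonneg _
            · exact le_rfl
      _ = ∑ k', ∑ i, if k' ≤ k then |W k i₀ ⬝ᵥ x k' i| else 0 :=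
          hpr fun k' i => if k' ≤ k then |W k i₀ ⬝ᵥ x k' i| else 0
      _ ≤ ∑ k', ((if k' < k then ∑ i, ∑ l, |w k l ⬝ᵥ x k' i| else 0) +
            if k' = k then ρ * R else 0) := by
          refine Finset.sum_le_sum fun k' _ => ?_
          have h0 : ∑ i, |W k i₀ ⬝ᵥ x k' i| ≤ ∑ i, ∑ l, |w k l ⬝ᵥ x k' i| :=
            Finset.sum_le_sum fun i _ => hWabs _ _ _
          rcases lt_trichotomy k' k with h | h | h
          · simpa [h, h.le, h.ne] using h0
          · simpa [h] using (h0.trans (hbatch k k'))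
          · simp [h.not_ge, h.not_gt, h.ne']
      _ ≤ γ + ρ * R := by
          rw [Finset.sum_add_distrib, ← Finset.sum_filter, Finset.sum_ite_eq' Finset.univ k]
          simpa using hprev k

end Potential

end

/-! ### Likelihood concentration -/

section

variable {S O A : Type*} [Fintype S] [Fintype O] [Fintype A] {M N : POMDP S O A} {H m : ℕ}
  {d₁ d₂ d₃ d₄ d₅ : ℕ}

section Records

variable (plan : Planner O A d₁ d₂ d₃ d₄ d₅ H m)

lemma records_append (D : List (Record O A H m)) (b₁ b₂ : List (Batch O A H m)) :
    records plan D (b₁ ++ b₂) = records plan (records plan D b₁) b₂ := by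
  induction b₁ generalizing D with
  | nil => rfl
  | cons b b₁ ih => exact ih _

lemma records_concat (D : List (Record O A H m)) (bs : List (Batch O A H m)) (b : Batch O A H m) :
    records plan D (bs ++ [b]) =
      records plan D bs ++ [((plan (records plan D bs)).2, b)] := by
  rw [records_append]; rfl

lemma exists_records_eq_append (D : List (Record O A H m)) (bs : List (Batch O A H m)) :
    ∃ E, records plan D bs = D ++ E := by
  induction bs generalizing D with
  | nil => exact ⟨[], by simp [records]⟩
  | cons b bs ih =>
    obtain ⟨E, hE⟩ := ih (D ++ [((plan D).2, b)])
    exact ⟨[((plan D).2, b)] ++ E, by rw [records, hE, List.append_assoc]⟩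

/-- The policies of a run are those which the planner chose on the data sets before. -/
lemma map_fst_records (bs : List (Batch O A H m)) :
    (records plan [] bs).map Prod.fst =
      (List.range bs.length).map fun k => (plan (records plan [] (bs.take k))).2 := by
  induction bs using List.reverseRecOn with
  | nil => rfl
  | append_singleton bs b ih =>
    rw [records_concat, List.map_append, ih, List.length_append, List.length_singleton,
      List.range_succ, List.map_append]
    congr 1
    · refine List.map_congr_left fun k hk => ?_
      rw [List.take_append_of_le_length (List.mem_range.1 hk).le]
    · simp

open Classical in
/-- A maximal inequality: if `L` is preserved on average and `Y` grows on average at most by the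
factor `C` in every iteration, then it is unlikely under `L` that `Y` ever exceeds `t * L`. -/
lemma listSum_exists_le (L Y : List (Record O A H m) → ℝ) {C t : ℝ} (hC : 1 ≤ C) (ht : 0 < t)
    (hL0 : ∀ D, 0 ≤ L D) (hY0 : ∀ D, 0 ≤ Y D)
    (hL : ∀ D π, ∑ b : Batch O A H m, L (D ++ [(π, b)]) = L D)
    (hY : ∀ D π, ∑ b : Batch O A H m, Y (D ++ [(π, b)]) ≤ C * Y D) (n : ℕ)
    (D : List (Record O A H m)) :
    listSum n (fun bs => if ∃ k ≤ n, t * L (records plan D (bs.take k)) <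
      Y (records plan D (bs.take k)) then L (records plan D bs) else 0) ≤ C ^ n / t * Y D := by
  have htotal : ∀ n D, listSum n (fun bs => L (records plan D bs)) = L D := by
    intro n
    induction n with
    | zero => intro D; rw [listSum_zero]; rfl
    | succ n ih =>
      intro D
      rw [listSum_cons]
      simp only [records]
      simp only [ih, hL]
  have hlarge : ∀ n D, t * L D < Y D → listSum n (fun bs =>
      if ∃ k ≤ n, t * L (records plan D (bs.take k)) < Y (records plan D (bs.take k))
        then L (records plan D bs) else 0) ≤ C ^ n / t * Y D := by
    intro n D h
    calc _ ≤ listSum n (fun bs => L (records plan D bs)) := by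
          refine listSum_mono fun bs _ => ?_
          split_ifs
          · exact le_rfl
          · exact hL0 _
      _ = L D := htotal n D
      _ ≤ 1 / t * Y D := by rw [one_div, inv_mul_eq_div, le_div_iff₀ ht]; linarith
      _ ≤ _ := mul_le_mul_of_nonneg_right
          (div_le_div_of_nonneg_right (one_le_pow₀ hC) ht.le) (hY0 D)
  induction n generalizing D with
  | zero =>
    by_cases h : t * L D < Y D
    · exact hlarge 0 D h
    · rw [listSum_zero]
      simp only [nonpos_iff_eq_zero, exists_eq_left, List.take_nil, records, h, if_false]
      exact mul_nonneg (by positivity) (hY0 D)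
  | succ n ih =>
    by_cases h : t * L D < Y D
    · exact hlarge (n + 1) D h
    · rw [listSum_cons]
      calc _ ≤ ∑ b : Batch O A H m, C ^ n / t * Y (D ++ [((plan D).2, b)]) := by
            refine Finset.sum_le_sum fun b _ => le_trans (listSum_mono fun bs _ => ?_)
              (ih (D ++ [((plan D).2, b)]))
            by_cases hex : ∃ k ≤ n + 1, t * L (records plan D ((b :: bs).take k)) <
                Y (records plan D ((b :: bs).take k))
            · obtain ⟨k, hk, hlt⟩ := hex
              rw [if_pos ⟨k, hk, hlt⟩, if_pos]
              · exact le_rfl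
              · rcases k with _ | k
                · exact absurd hlt h
                · exact ⟨k, by omega, hlt⟩
            · rw [if_neg hex]
              split_ifs
              · exact hL0 _
              · exact le_rfl
        _ = C ^ n / t * ∑ b : Batch O A H m, Y (D ++ [((plan D).2, b)]) :=
            (Finset.mul_sum _ _ _).symm
        _ ≤ C ^ n / t * (C * Y D) := mul_le_mul_of_nonneg_left (hY _ _) (by positivity)
        _ = _ := by rw [pow_succ]; ring

end Records

variable [Nonempty A]

/-- The product of the values of `y` at all exploration policies and trajectories of a data
set. -/
def dataProd (y : Policy O A → Traj O A H → ℝ) (D : List (Record O A H m)) : ℝ :=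
  (D.map fun ρ => ∏ i : Index A H m, y (ρ.1.explore i.1 i.2) (ρ.2 i)).prod

/-- The sum of the values of `z` at all exploration policies of a data set. -/
def dataSum (z : Policy O A → ℝ) (D : List (Record O A H m)) : ℝ :=
  (D.map fun ρ => ∑ i : Index A H m, z (ρ.1.explore i.1 i.2)).sum

lemma likelihood_eq (M : POMDP S O A) (D : List (Record O A H m)) :
    likelihood M D = dataProd (trajProb M) D := rfl

lemma dataProd_append (y : Policy O A → Traj O A H → ℝ) (D E : List (Record O A H m)) :
    dataProd y (D ++ E) = dataProd y D * dataProd y E := by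
  simp [dataProd]

lemma dataProd_nonneg {y : Policy O A → Traj O A H → ℝ} (hy : ∀ π τ, 0 ≤ y π τ)
    (D : List (Record O A H m)) : 0 ≤ dataProd y D := by
  refine List.prod_nonneg fun x hx => ?_
  obtain ⟨ρ, _, rfl⟩ := List.mem_map.1 hx
  exact Finset.prod_nonneg fun _ _ => hy _ _

lemma dataProd_cons (y : Policy O A → Traj O A H → ℝ) (ρ : Record O A H m)
    (D : List (Record O A H m)) : dataProd y (ρ :: D) =
      (∏ i : Index A H m, y (ρ.1.explore i.1 i.2) (ρ.2 i)) * dataProd y D := by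
  simp [dataProd]

lemma dataSum_cons (z : Policy O A → ℝ) (ρ : Record O A H m) (D : List (Record O A H m)) :
    dataSum z (ρ :: D) = (∑ i : Index A H m, z (ρ.1.explore i.1 i.2)) + dataSum z D := by
  simp [dataSum]

lemma dataProd_mono {y z : Policy O A → Traj O A H → ℝ} (hy : ∀ π τ, 0 ≤ y π τ)
    (hyz : ∀ π τ, y π τ ≤ z π τ) (D : List (Record O A H m)) : dataProd y D ≤ dataProd z D := by
  induction D with
  | nil => exact le_rfl
  | cons ρ D ih =>
    rw [dataProd_cons, dataProd_cons]
    exact mul_le_mul (Finset.prod_le_prod (fun _ _ => hy _ _) fun _ _ => hyz _ _) ih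
      (dataProd_nonneg hy D) (Finset.prod_nonneg fun _ _ => (hy _ _).trans (hyz _ _))

lemma dataSum_mono {y z : Policy O A → ℝ} (hyz : ∀ π, y π ≤ z π) (D : List (Record O A H m)) :
    dataSum y D ≤ dataSum z D := by
  induction D with
  | nil => exact le_rfl
  | cons ρ D ih =>
    rw [dataSum_cons, dataSum_cons]
    exact add_le_add (Finset.sum_le_sum fun _ _ => hyz _) ih

lemma dataSum_add_const (a b : ℝ) (z : Policy O A → ℝ) (D : List (Record O A H m)) :
    dataSum (fun π => a * z π + b) D =
      a * dataSum z D + D.length * (Fintype.card (Index A H m)) * b := by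
  induction D with
  | nil => simp [dataSum]
  | cons ρ D ih =>
    rw [dataSum_cons, dataSum_cons, ih, Finset.sum_add_distrib, ← Finset.mul_sum, Finset.sum_const,
      Finset.card_univ, nsmul_eq_mul, List.length_cons]
    push_cast
    ring

open Classical in
lemma sum_dataProd_concat (y : Policy O A → Traj O A H → ℝ) (D : List (Record O A H m))
    (π : Policy O A) : ∑ b : Batch O A H m, dataProd y (D ++ [(π, b)]) =
      dataProd y D * ∏ i : Index A H m, ∑ τ, y (π.explore i.1 i.2) τ := by
  rw [Finset.prod_univ_sum, Fintype.piFinset_univ, Finset.mul_sum]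
  refine Finset.sum_congr rfl fun b _ => ?_
  rw [dataProd_append]
  simp [dataProd]

lemma likelihood_nonneg (hM : M.IsValid H) (D : List (Record O A H m)) : 0 ≤ likelihood M D :=
  dataProd_nonneg (fun π τ => trajProb_nonneg hM π τ) D

open Classical in
lemma sum_likelihood_concat (hM : M.IsValid H) (D : List (Record O A H m)) (π : Policy O A) :
    ∑ b : Batch O A H m, likelihood M (D ++ [(π, b)]) = likelihood M D := by
  simp only [likelihood_eq]
  rw [sum_dataProd_concat]
  simp [sum_trajProb hM]

lemma likelihood_take_pos (hM : M.IsValid H) (plan : Planner O A d₁ d₂ d₃ d₄ d₅ H m)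
    (bs : List (Batch O A H m)) (k : ℕ) (h : 0 < likelihood M (records plan [] bs)) :
    0 < likelihood M (records plan [] (bs.take k)) := by
  rw [← List.take_append_drop k bs, records_append] at h
  obtain ⟨E, hE⟩ := exists_records_eq_append plan (records plan [] (bs.take k)) (bs.drop k)
  rw [hE, likelihood_eq, dataProd_append] at h
  exact pos_of_mul_pos_left h (likelihood_nonneg hM E)

/-- The affinity `∑ √(g · ℙ)` of a function `g` of the trajectory and the law of the trajectory. -/
def affinity (M : POMDP S O A) (g : Policy O A → Traj O A H → ℝ) (π : Policy O A) : ℝ :=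
  ∑ τ, √(g π τ * trajProb M π τ)

/-- The density of the normalized geometric mean of `g` and the law of the trajectory. -/
def geomMean (M : POMDP S O A) (g : Policy O A → Traj O A H → ℝ) (π : Policy O A)
    (τ : Traj O A H) : ℝ :=
  √(g π τ * trajProb M π τ) / affinity M g π

lemma affinity_nonneg (M : POMDP S O A) (g : Policy O A → Traj O A H → ℝ) (π : Policy O A) :
    0 ≤ affinity M g π := Finset.sum_nonneg fun _ _ => Real.sqrt_nonneg _

lemma geomMean_nonneg (M : POMDP S O A) (g : Policy O A → Traj O A H → ℝ) (π : Policy O A)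
    (τ : Traj O A H) : 0 ≤ geomMean M g π τ :=
  div_nonneg (Real.sqrt_nonneg _) (affinity_nonneg M g π)

lemma sum_geomMean_le (M : POMDP S O A) (g : Policy O A → Traj O A H → ℝ) (π : Policy O A) :
    ∑ τ, geomMean M g π τ ≤ 1 := by
  unfold geomMean
  rw [← Finset.sum_div]
  exact div_self_le_one _

/-- The data set is typical: neither the upper brackets nor their normalized geometric means with
the true law exceed the true likelihood by much. -/
def IsTypical {n : ℕ} (M : POMDP S O A) (β : ℝ) (g : Fin n → Policy O A → Traj O A H → ℝ)
    (D : List (Record O A H m)) : Prop :=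
  ∀ i, dataProd (g i) D ≤ Real.exp β * likelihood M D ∧
    dataProd (geomMean M (g i)) D ≤ Real.exp β * likelihood M D

open Classical in
lemma listSum_likelihood (hM : M.IsValid H) (plan : Planner O A d₁ d₂ d₃ d₄ d₅ H m) (K : ℕ)
    (D : List (Record O A H m)) :
    listSum K (fun bs => likelihood M (records plan D bs)) = likelihood M D := by
  induction K generalizing D with
  | zero => rw [listSum_zero]; rfl
  | succ n ih =>
    rw [listSum_cons]
    simp only [records]
    simp only [ih, sum_likelihood_concat hM]

open Classical in
/-- With high probability all data sets of a run are typical. -/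
lemma one_sub_le_runProb (hM : M.IsValid H) (plan : Planner O A d₁ d₂ d₃ d₄ d₅ H m) {K n : ℕ}
    {β η : ℝ} (g : Fin n → Policy O A → Traj O A H → ℝ) (hg0 : ∀ i π τ, 0 ≤ g i π τ)
    (hη : 0 ≤ η) (hg1 : ∀ i π, ∑ τ, g i π τ ≤ 1 + η)
    (hηK : K * Fintype.card (Index A H m) * η ≤ 1) (E : Set (Fin K → Batch O A H m))
    (hE : ∀ ω, 0 < likelihood M (runData plan ω) →
      (∀ k ≤ K, IsTypical M β g (records plan [] ((List.ofFn ω).take k))) → ω ∈ E) :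
    1 - 4 * n * Real.exp (-β) ≤ runProb M plan E := by
  set c := Fintype.card (Index A H m) with hc
  have hbound : ∀ (y : Policy O A → Traj O A H → ℝ) (C : ℝ), 1 ≤ C → (∀ π τ, 0 ≤ y π τ) →
      (∀ π, ∑ τ, y π τ ≤ C) → listSum K (fun bs =>
        if ∃ k ≤ K, Real.exp β * likelihood M (records plan [] (bs.take k)) <
          dataProd y (records plan [] (bs.take k)) then likelihood M (records plan [] bs) else 0) ≤
        (C ^ c) ^ K * Real.exp (-β) := by
    intro y C hC hy0 hy1
    have h1 := listSum_exists_le plan (likelihood M) (dataProd y) (one_le_pow₀ hC (n := c))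
      (Real.exp_pos β) (likelihood_nonneg hM) (dataProd_nonneg hy0) (sum_likelihood_concat hM)
      (fun D π => by
        rw [sum_dataProd_concat, mul_comm]
        refine mul_le_mul_of_nonneg_right ?_ (dataProd_nonneg hy0 D)
        refine (Finset.prod_le_prod (fun i _ => Finset.sum_nonneg fun τ _ => hy0 _ _)
          fun (i : Index A H m) _ => hy1 (π.explore i.1 i.2)).trans (le_of_eq ?_)
        simp [hc]) K []
    refine h1.trans (le_of_eq ?_)
    simp [dataProd, Real.exp_neg, div_eq_mul_inv]
  have hexp : ((1 + η) ^ c) ^ K ≤ 3 := by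
    rw [← pow_mul]
    calc (1 + η) ^ (c * K) ≤ (Real.exp η) ^ (c * K) :=
          pow_le_pow_left₀ (by linarith) (by linarith [Real.add_one_le_exp η]) _
      _ = Real.exp (K * c * η) := by rw [← Real.exp_nat_mul]; push_cast; ring_nf
      _ ≤ Real.exp 1 := Real.exp_le_exp.2 hηK
      _ ≤ 3 := by linarith [Real.exp_one_lt_d9]
  set B1 : Fin n → List (Batch O A H m) → ℝ := fun i bs =>
    if ∃ k ≤ K, Real.exp β * likelihood M (records plan [] (bs.take k)) <
      dataProd (g i) (records plan [] (bs.take k)) then likelihood M (records plan [] bs) else 0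
    with hB1
  set B2 : Fin n → List (Batch O A H m) → ℝ := fun i bs =>
    if ∃ k ≤ K, Real.exp β * likelihood M (records plan [] (bs.take k)) <
      dataProd (geomMean M (g i)) (records plan [] (bs.take k))
      then likelihood M (records plan [] bs) else 0 with hB2
  have hB1' : ∀ i, listSum K (B1 i) ≤ 3 * Real.exp (-β) := fun i =>
    (hbound (g i) (1 + η) (by linarith) (hg0 i) (hg1 i)).trans
      (mul_le_mul_of_nonneg_right hexp (Real.exp_pos _).le)
  have hB2' : ∀ i, listSum K (B2 i) ≤ Real.exp (-β) := fun i => by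
    simpa using hbound (geomMean M (g i)) 1 le_rfl (geomMean_nonneg M (g i))
      (sum_geomMean_le M (g i))
  have hB10 : ∀ i bs, 0 ≤ B1 i bs := fun i bs => by
    simp only [hB1]; split_ifs
    · exact likelihood_nonneg hM _
    · exact le_rfl
  have hB20 : ∀ i bs, 0 ≤ B2 i bs := fun i bs => by
    simp only [hB2]; split_ifs
    · exact likelihood_nonneg hM _
    · exact le_rfl
  have hpoint : ∀ ω : Fin K → Batch O A H m, likelihood M (runData plan ω) ≤
      E.indicator (fun ω => likelihood M (runData plan ω)) ω +
        ((∑ i, B1 i (List.ofFn ω)) + ∑ i, B2 i (List.ofFn ω)) := by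
    intro ω
    have hs1 : 0 ≤ ∑ i, B1 i (List.ofFn ω) := Finset.sum_nonneg fun i _ => hB10 i _
    have hs2 : 0 ≤ ∑ i, B2 i (List.ofFn ω) := Finset.sum_nonneg fun i _ => hB20 i _
    by_cases hω : ω ∈ E
    · rw [Set.indicator_of_mem hω]; linarith
    rw [Set.indicator_of_notMem hω, zero_add]
    rcases (likelihood_nonneg hM (runData plan ω)).eq_or_lt with h0 | h0
    · rw [← h0]; positivity
    have hnot : ¬ ∀ k ≤ K, IsTypical M β g (records plan [] ((List.ofFn ω).take k)) :=
      fun h => hω (hE ω h0 h)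
    push Not at hnot
    obtain ⟨k, hk, hnt⟩ := hnot
    unfold IsTypical at hnt
    push Not at hnt
    obtain ⟨i, hi⟩ := hnt
    by_cases h1 : dataProd (g i) (records plan [] ((List.ofFn ω).take k)) ≤
        Real.exp β * likelihood M (records plan [] ((List.ofFn ω).take k))
    · have hval : B2 i (List.ofFn ω) = likelihood M (runData plan ω) := by
        simp only [hB2]
        exact if_pos ⟨k, hk, hi h1⟩
      have := Finset.single_le_sum (f := fun i => B2 i (List.ofFn ω)) (fun i _ => hB20 i _)
        (Finset.mem_univ i)
      simp only [hval] at this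
      linarith
    · have hval : B1 i (List.ofFn ω) = likelihood M (runData plan ω) := by
        simp only [hB1]
        exact if_pos ⟨k, hk, not_le.1 h1⟩
      have := Finset.single_le_sum (f := fun i => B1 i (List.ofFn ω)) (fun i _ => hB10 i _)
        (Finset.mem_univ i)
      simp only [hval] at this
      linarith
  have htotal : ∑ ω : Fin K → Batch O A H m, likelihood M (runData plan ω) = 1 := by
    have := listSum_likelihood hM plan K []
    simpa [likelihood, listSum, runData] using this
  have hsum := Finset.sum_le_sum fun ω (_ : ω ∈ (Finset.univ : Finset (Fin K → Batch O A H m))) =>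
    hpoint ω
  rw [htotal, Finset.sum_add_distrib, Finset.sum_add_distrib] at hsum
  have h1 : ∑ ω : Fin K → Batch O A H m, ∑ i, B1 i (List.ofFn ω) ≤ n * (3 * Real.exp (-β)) := by
    rw [Finset.sum_comm]
    refine (Finset.sum_le_sum fun i _ => hB1' i).trans (le_of_eq ?_)
    simp
  have h2 : ∑ ω : Fin K → Batch O A H m, ∑ i, B2 i (List.ofFn ω) ≤ n * Real.exp (-β) := by
    rw [Finset.sum_comm]
    refine (Finset.sum_le_sum fun i _ => hB2' i).trans (le_of_eq ?_)
    simp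
  rw [runProb]
  linarith

lemma dataProd_mul (y z : Policy O A → Traj O A H → ℝ) (D : List (Record O A H m)) :
    dataProd (fun π τ => y π τ * z π τ) D = dataProd y D * dataProd z D := by
  induction D with
  | nil => simp [dataProd]
  | cons ρ D ih => rw [dataProd_cons, dataProd_cons, dataProd_cons, ih, Finset.prod_mul_distrib]; ring

lemma dataProd_exp (z : Policy O A → ℝ) (D : List (Record O A H m)) :
    dataProd (fun π _ => Real.exp (z π)) D = Real.exp (dataSum z D) := by
  induction D with
  | nil => simp [dataProd, dataSum]
  | cons ρ D ih => rw [dataProd_cons, dataSum_cons, ih, Real.exp_add, Real.exp_sum]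

lemma lawDist_eq (M N : POMDP S O A) (π : Policy O A) :
    lawDist M N H π = ∑ τ : Traj O A H, |trajProb M π τ - trajProb N π τ| := by
  refine Finset.sum_congr rfl fun τ _ => ?_
  rw [trajProb_eq, trajProb_eq, ← sub_mul, abs_mul, abs_of_nonneg (π.listWeight_nonneg _ _),
    mul_comm]

/-- The distance of two laws is controlled by the affinity of one of them and an upper bracket of
the other, as in the comparison of the `ℓ¹` distance with the Hellinger distance. -/
lemma lawDist_sq_le (hM : M.IsValid H) (g : Policy O A → Traj O A H → ℝ) {η : ℝ} (hη1 : η ≤ 1)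
    (π : Policy O A) (hNg : ∀ τ, trajProb N π τ ≤ g π τ) (hg0 : ∀ τ, 0 ≤ g π τ)
    (hgN : ∑ τ, (g π τ - trajProb N π τ) ≤ η) (hg1 : ∑ τ, g π τ ≤ 1 + η) :
    lawDist N M H π ^ 2 ≤ -24 * (affinity M g π - 1) + 14 * η := by
  have hη : 0 ≤ η := (Finset.sum_nonneg fun τ _ => sub_nonneg.2 (hNg τ)).trans hgN
  have hP := trajProb_nonneg (M := M) hM π
  set T := ∑ τ : Traj O A H, |g π τ - trajProb M π τ| with hT
  have h1 : lawDist N M H π ≤ η + T := by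
    rw [lawDist_eq]
    refine le_trans ?_ (add_le_add hgN le_rfl)
    rw [← Finset.sum_add_distrib]
    refine Finset.sum_le_sum fun τ _ => ?_
    rw [← abs_of_nonneg (sub_nonneg.2 (hNg τ)), abs_sub_comm (g π τ) (trajProb N π τ)]
    exact abs_sub_le _ _ _
  have hfac : T = ∑ τ : Traj O A H, |√(g π τ) - √(trajProb M π τ)| *
      (√(g π τ) + √(trajProb M π τ)) := by
    refine Finset.sum_congr rfl fun τ _ => ?_
    rw [← abs_of_nonneg (add_nonneg (Real.sqrt_nonneg (g π τ)) (Real.sqrt_nonneg (trajProb M π τ))),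
      ← abs_mul]
    congr 1
    nlinarith [Real.sq_sqrt (hg0 τ), Real.sq_sqrt (hP τ)]
  have hcs := Finset.sum_mul_sq_le_sq_mul_sq Finset.univ
    (fun τ : Traj O A H => |√(g π τ) - √(trajProb M π τ)|)
    fun τ => √(g π τ) + √(trajProb M π τ)
  rw [← hfac] at hcs
  have hminus : ∑ τ : Traj O A H, |√(g π τ) - √(trajProb M π τ)| ^ 2 =
      ∑ τ, g π τ + 1 - 2 * affinity M g π := by
    rw [← sum_trajProb hM π, affinity, Finset.mul_sum, ← Finset.sum_add_distrib,
      ← Finset.sum_sub_distrib]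
    refine Finset.sum_congr rfl fun τ _ => ?_
    rw [sq_abs, Real.sqrt_mul (hg0 τ)]
    nlinarith [Real.sq_sqrt (hg0 τ), Real.sq_sqrt (hP τ)]
  have hplus : ∑ τ : Traj O A H, (√(g π τ) + √(trajProb M π τ)) ^ 2 ≤
      2 * ∑ τ, g π τ + 2 := by
    have h2 : (2 : ℝ) = ∑ τ : Traj O A H, 2 * trajProb M π τ := by
      rw [← Finset.mul_sum, sum_trajProb hM π, mul_one]
    conv_rhs => rw [Finset.mul_sum, h2, ← Finset.sum_add_distrib, ← h2]
    refine Finset.sum_le_sum fun τ _ => ?_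
    nlinarith [Real.sq_sqrt (hg0 τ), Real.sq_sqrt (hP τ),
      sq_nonneg (√(g π τ) - √(trajProb M π τ))]
  have hm0 : 0 ≤ ∑ τ, g π τ + 1 - 2 * affinity M g π := by
    rw [← hminus]; exact Finset.sum_nonneg fun _ _ => sq_nonneg _
  have hT2 : T ^ 2 ≤ (2 * (1 - affinity M g π) + η) * 6 := by
    rw [hminus] at hcs
    refine hcs.trans (mul_le_mul (by linarith) (hplus.trans (by linarith)) ?_ (by linarith))
    exact Finset.sum_nonneg fun _ _ => sq_nonneg _
  have hsq := pow_le_pow_left₀ (lawDist_nonneg N M H π) h1 2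
  nlinarith [sq_nonneg (η - T)]

/-- On a typical data set, every model whose likelihood is not much smaller than the true one
is close to the true model on the data. The product `a` of the values `√(g · ℙ)` on the data is at
least `exp (-β / 2)` times the true likelihood, because `g` exceeds the likelihood of the model. On
the other hand `a` is the value of the normalized geometric mean times the product of the
affinities, and is thus at most `exp (β + ∑ (affinity - 1))` times the true likelihood. -/
lemma IsTypical.dataSum_lawDist_le {n : ℕ} {β η : ℝ} {g : Fin n → Policy O A → Traj O A H → ℝ}
    {D : List (Record O A H m)} (hD : IsTypical M β g D) (hM : M.IsValid H) (hN : N.IsValid H)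
    (i : Fin n) (hη1 : η ≤ 1) (hNg : ∀ π τ, trajProb N π τ ≤ g i π τ)
    (hgN : ∀ π, ∑ τ, (g i π τ - trajProb N π τ) ≤ η) (hg1 : ∀ π, ∑ τ, g i π τ ≤ 1 + η)
    (hηD : D.length * Fintype.card (Index A H m) * η ≤ 1) (hpos : 0 < likelihood M D)
    (hlik : Real.exp (-β) * likelihood M D ≤ likelihood N D) :
    dataSum (fun π => lawDist N M H π ^ 2) D ≤ 36 * β + 14 := by
  have hN0 := fun π τ => trajProb_nonneg (M := N) hN π τ
  have hM0 := fun π τ => trajProb_nonneg (M := M) hM π τ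
  have hg0 : ∀ π τ, 0 ≤ g i π τ := fun π τ => (hN0 π τ).trans (hNg π τ)
  set L := likelihood M D with hL
  set s := dataSum (fun π => affinity M (g i) π - 1) D with hs
  set a := dataProd (fun π τ => √(g i π τ * trajProb M π τ)) D with ha
  have hasq : a ^ 2 = dataProd (g i) D * L := by
    rw [pow_two, ha, ← dataProd_mul, hL, likelihood_eq, ← dataProd_mul]
    congr 1
    ext π τ
    exact Real.mul_self_sqrt (mul_nonneg (hg0 π τ) (hM0 π τ))
  have hlow : Real.exp (-β) * L ^ 2 ≤ a ^ 2 := by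
    rw [hasq, pow_two, ← mul_assoc]
    refine mul_le_mul_of_nonneg_right (hlik.trans ?_) hpos.le
    exact dataProd_mono hN0 hNg D
  have haff : dataProd (fun π _ => affinity M (g i) π) D ≤ Real.exp s := by
    rw [hs, ← dataProd_exp]
    refine dataProd_mono (fun π _ => affinity_nonneg _ _ _) (fun π _ => ?_) D
    linarith [Real.add_one_le_exp (affinity M (g i) π - 1)]
  have hup : a ≤ Real.exp β * L * Real.exp s := by
    have hfac : a = dataProd (geomMean M (g i)) D * dataProd (fun π _ => affinity M (g i) π) D := by
      rw [ha, ← dataProd_mul]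
      congr 1
      ext π τ
      rw [geomMean]
      by_cases h0 : affinity M (g i) π = 0
      · rw [h0, mul_zero]
        exact (Finset.sum_eq_zero_iff_of_nonneg fun _ _ => Real.sqrt_nonneg _).1 h0 τ
          (Finset.mem_univ τ)
      · rw [div_mul_cancel₀ _ h0]
    rw [hfac]
    exact mul_le_mul (hD i).2 haff (dataProd_nonneg (fun π _ => affinity_nonneg _ _ _) D)
      (by positivity)
  have ha0 : 0 ≤ a := dataProd_nonneg (fun _ _ => Real.sqrt_nonneg _) D
  have hup2 := pow_le_pow_left₀ ha0 hup 2
  have hexp : Real.exp (-β) ≤ Real.exp (2 * β + 2 * s) := by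
    have h1 := hlow.trans hup2
    have h2 : (Real.exp β * L * Real.exp s) ^ 2 = Real.exp (2 * β + 2 * s) * L ^ 2 := by
      rw [Real.exp_add, two_mul, two_mul, Real.exp_add, Real.exp_add]; ring
    rw [h2] at h1
    exact le_of_mul_le_mul_right h1 (by positivity)
  rw [Real.exp_le_exp] at hexp
  have hpt : ∀ π, lawDist N M H π ^ 2 ≤ -24 * (affinity M (g i) π - 1) + 14 * η := fun π =>
    lawDist_sq_le hM (g i) hη1 π (hNg π) (hg0 π) (hgN π) (hg1 π)
  refine (dataSum_mono hpt D).trans ?_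
  rw [dataSum_add_const]
  linarith

/-- On a typical data set, the true model belongs to the confidence set. -/
lemma IsTypical.mem_confSet {n : ℕ} {β : ℝ} {g : Fin n → Policy O A → Traj O A H → ℝ}
    {D : List (Record O A H m)} {Φ : Features S O A d₁ d₂ d₃ d₄ d₅}
    {F : Set (LinParam d₁ d₂ d₃ d₄ d₅)} {fstar : LinParam d₁ d₂ d₃ d₄ d₅}
    (hD : IsTypical (Φ.model fstar) β g D) (hF : ∀ f ∈ F, (Φ.model f).IsValid H)
    (hstar : fstar ∈ F) (hg : ∀ f ∈ F, ∃ i, ∀ π τ, trajProb (Φ.model f) π τ ≤ g i π τ) :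
    fstar ∈ confSet Φ F β D := by
  refine ⟨hstar, fun f hf => ?_⟩
  obtain ⟨i, hi⟩ := hg f hf
  have h1 : likelihood (Φ.model f) D ≤ Real.exp β * likelihood (Φ.model fstar) D :=
    (dataProd_mono (fun π τ => trajProb_nonneg (hF f hf) π τ) hi D).trans (hD i).1
  calc Real.exp (-β) * likelihood (Φ.model f) D
      ≤ Real.exp (-β) * (Real.exp β * likelihood (Φ.model fstar) D) :=
        mul_le_mul_of_nonneg_left h1 (Real.exp_pos _).le
    _ = likelihood (Φ.model fstar) D := by
        rw [← mul_assoc, ← Real.exp_add, neg_add_cancel, Real.exp_zero, one_mul]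

end

/-! ### Linear models: rank and bracketing number -/

section

variable {S O A : Type*} [Fintype S] [Fintype O] [Fintype A] {H m : ℕ}
  {d₁ d₂ d₃ d₄ d₅ : ℕ} {Φ : Features S O A d₁ d₂ d₃ d₄ d₅}

/-- The largest of the five feature dimensions. -/
def linDim (d₁ d₂ d₃ d₄ d₅ : ℕ) : ℕ := max d₁ (max d₂ (max d₃ (max d₄ d₅)))

lemma one_le_linDim {f : LinParam d₁ d₂ d₃ d₄ d₅} (hM : (Φ.model f).IsValid H) :
    1 ≤ linDim d₁ d₂ d₃ d₄ d₅ := by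
  by_contra h
  have h5 : d₅ = 0 := by unfold linDim at h; omega
  subst h5
  have := hM.1.2
  simp [Features.model] at this

lemma exists_forward_eq (f : LinParam d₁ d₂ d₃ d₄ d₅) {h : ℕ} (hh : 1 ≤ h)
    (l : List (O × A)) (hl : l.length = h) : ∃ c : Fin d₂ → ℝ,
      (Φ.model f).forward 1 (Φ.model f).init l = fun y => ∑ i, c i * Φ.ψ h y i := by
  obtain rfl | ⟨l', p, rfl⟩ := List.eq_nil_or_concat l
  · simp at hl; omega
  rw [List.concat_eq_append, List.length_append, List.length_singleton] at hl
  refine ⟨fun i => ∑ s, (Φ.model f).forward 1 (Φ.model f).init l' s *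
    (Φ.model f).emit h s p.1 * (f.B₁ h *ᵥ Φ.φ h s p.2) i, ?_⟩
  ext y
  rw [List.concat_eq_append, POMDP.forward_append]
  simp only [POMDP.forward]
  rw [show 1 + l'.length = h by omega]
  simp only [Finset.sum_mul]
  rw [Finset.sum_comm]
  refine Finset.sum_congr rfl fun s _ => ?_
  have : (Φ.model f).trans h s p.2 y = Φ.ψ h y ⬝ᵥ (f.B₁ h *ᵥ Φ.φ h s p.2) := rfl
  rw [this, dotProduct, Finset.mul_sum]
  exact Finset.sum_congr rfl fun i _ => by ring

/-- The rank of the system dynamics matrices of a linear model is at most the feature dimension: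
the belief after a step lies in the span of the features `ψ`. -/
lemma psrRank_le {f : LinParam d₁ d₂ d₃ d₄ d₅} (hM : (Φ.model f).IsValid H) (h : ℕ) :
    (Φ.model f).psrRank H h ≤ linDim d₁ d₂ d₃ d₄ d₅ := by
  rcases Nat.eq_zero_or_pos h with rfl | hh
  · refine le_trans ?_ (one_le_linDim hM)
    refine (Matrix.rank_le_card_width _).trans ?_
    simp
  · choose c hc using fun (l : List (O × A)) (hl : l.length = h) => exists_forward_eq (Φ := Φ) f hh l hl
    let P : Matrix (Σ n : Fin (H - h), Test O A n) (Fin d₂) ℝ := Matrix.of fun t i =>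
      ∑ s, (Φ.model f).forward (1 + h) (fun y => Φ.ψ h y i) (List.ofFn t.2.1) s *
        (Φ.model f).emit (h + t.1 + 1) s t.2.2
    let Q : Matrix (Fin d₂) (Traj O A h) ℝ := Matrix.of fun i τ =>
      c (List.ofFn τ) (by simp) i / (Φ.model f).histProb (List.ofFn τ)
    have hPQ : (Φ.model f).dynMatrix H h = P * Q := by
      ext t τ
      rw [Matrix.mul_apply]
      simp only [POMDP.dynMatrix, POMDP.testProb, POMDP.jointProb, Matrix.of_apply, P, Q,
        POMDP.forward_append, List.length_ofFn, ← mul_div_assoc]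
      rw [← Finset.sum_div, hc (List.ofFn τ) (by simp)]
      congr 1
      simp only [POMDP.forward_sum, Finset.sum_mul]
      rw [Finset.sum_comm]
      exact Finset.sum_congr rfl fun i _ => Finset.sum_congr rfl fun s _ => by ring
    rw [POMDP.psrRank, hPQ]
    refine (Matrix.rank_mul_le_left P Q).trans ((Matrix.rank_le_card_width P).trans ?_)
    rw [Fintype.card_fin, linDim]
    omega

/-- A weakly revealing model has at most as many states as there are core tests. -/
lemma card_state_le {M : POMDP S O A} (hW : M.IsWeaklyRevealing H m) :
    Fintype.card S ≤ (Fintype.card O * Fintype.card A) ^ (m - 1) * Fintype.card O := by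
  rw [← hW 1 (Finset.mem_Icc.2 ⟨le_rfl, by omega⟩)]
  refine (Matrix.rank_le_card_height _).trans (le_of_eq ?_)
  simp [Fintype.card_prod]

lemma abs_dotProduct_mulVec_le {p q : ℕ} (B : Matrix (Fin p) (Fin q) ℝ) (x : Fin p → ℝ)
    (y : Fin q → ℝ) {η : ℝ} (hη : 0 ≤ η) (hB : ∀ i j, |B i j| ≤ η) (hx : ∀ i, |x i| ≤ 1)
    (hy : ∀ j, |y j| ≤ 1) : |x ⬝ᵥ B *ᵥ y| ≤ p * q * η := by
  have h1 : ∀ i, |(B *ᵥ y) i| ≤ q * η := by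
    intro i
    calc |(B *ᵥ y) i| ≤ ∑ j, |B i j * y j| :=
          Finset.abs_sum_le_sum_abs (fun j => B i j * y j) Finset.univ
      _ ≤ ∑ _j : Fin q, η := Finset.sum_le_sum fun j _ => by
          rw [abs_mul]
          exact (mul_le_mul (hB i j) (hy j) (abs_nonneg _) hη).trans (by rw [mul_one])
      _ = q * η := by simp
  calc |x ⬝ᵥ B *ᵥ y| ≤ ∑ i, |x i * (B *ᵥ y) i| :=
        Finset.abs_sum_le_sum_abs (fun i => x i * (B *ᵥ y) i) Finset.univ
    _ ≤ ∑ _i : Fin p, (q * η : ℝ) := Finset.sum_le_sum fun i _ => by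
        rw [abs_mul]
        exact (mul_le_mul (hx i) (h1 i) (abs_nonneg _) zero_le_one).trans (by rw [one_mul])
    _ = p * q * η := by simp [mul_assoc]

/-- Two parameters agree up to `η` in all relevant entries. -/
def LinParam.IsClose (f g : LinParam d₁ d₂ d₃ d₄ d₅) (H : ℕ) (η : ℝ) : Prop :=
  (∀ h ∈ Finset.Icc 1 H, (∀ i j, |f.B₁ h i j - g.B₁ h i j| ≤ η) ∧
    ∀ i j, |f.B₂ h i j - g.B₂ h i j| ≤ η) ∧ ∀ i, |f.θ i - g.θ i| ≤ η

section Close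

variable {f g : LinParam d₁ d₂ d₃ d₄ d₅} {η : ℝ}

lemma mul_le_linDim_sq {p q d : ℕ} (hp : p ≤ d) (hq : q ≤ d) (hη : 0 ≤ η) :
    (p * q * η : ℝ) ≤ (d : ℝ) ^ 2 * η := by
  have hp' : (p : ℝ) ≤ d := by exact_mod_cast hp
  have hq' : (q : ℝ) ≤ d := by exact_mod_cast hq
  rw [pow_two]
  gcongr

lemma abs_trans_sub_le (hΦ : Φ.IsBounded H) (hη : 0 ≤ η) (hfg : f.IsClose g H η) {h : ℕ}
    (hh : h ∈ Finset.Icc 1 H) (s s' : S) (a : A) :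
    |(Φ.model f).trans h s a s' - (Φ.model g).trans h s a s'| ≤
      (linDim d₁ d₂ d₃ d₄ d₅ : ℝ) ^ 2 * η := by
  have hb := hΦ.1 h hh
  have h1 := abs_dotProduct_mulVec_le (f.B₁ h - g.B₁ h) (Φ.ψ h s') (Φ.φ h s a) hη
    (hfg.1 h hh).1 (hb.2.1 s') (hb.1 s a)
  rw [Matrix.sub_mulVec, dotProduct_sub] at h1
  exact h1.trans (mul_le_linDim_sq (by unfold linDim; omega) (by unfold linDim; omega) hη)

lemma abs_emit_sub_le (hΦ : Φ.IsBounded H) (hη : 0 ≤ η) (hfg : f.IsClose g H η) {h : ℕ}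
    (hh : h ∈ Finset.Icc 1 H) (s : S) (o : O) :
    |(Φ.model f).emit h s o - (Φ.model g).emit h s o| ≤
      (linDim d₁ d₂ d₃ d₄ d₅ : ℝ) ^ 2 * η := by
  have hb := hΦ.1 h hh
  have h1 := abs_dotProduct_mulVec_le (f.B₂ h - g.B₂ h) (Φ.ψbar h o) (Φ.φbar h s) hη
    (hfg.1 h hh).2 (hb.2.2.2 o) (hb.2.2.1 s)
  rw [Matrix.sub_mulVec, dotProduct_sub] at h1
  exact h1.trans (mul_le_linDim_sq (by unfold linDim; omega) (by unfold linDim; omega) hη)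

lemma abs_init_sub_le (hΦ : Φ.IsBounded H) (hη : 0 ≤ η) (hfg : f.IsClose g H η)
    (hd : 1 ≤ linDim d₁ d₂ d₃ d₄ d₅) (s : S) :
    |(Φ.model f).init s - (Φ.model g).init s| ≤ (linDim d₁ d₂ d₃ d₄ d₅ : ℝ) ^ 2 * η := by
  have h1 : (Φ.model f).init s - (Φ.model g).init s = ∑ i, (f.θ i - g.θ i) * Φ.φhat s i := by
    simp only [Features.model, dotProduct, ← Finset.sum_sub_distrib, sub_mul]
  rw [h1]
  calc |∑ i, (f.θ i - g.θ i) * Φ.φhat s i| ≤ ∑ i, |(f.θ i - g.θ i) * Φ.φhat s i| :=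
        Finset.abs_sum_le_sum_abs _ _
    _ ≤ ∑ _i : Fin d₅, η := Finset.sum_le_sum fun i _ => by
        rw [abs_mul]
        exact (mul_le_mul (hfg.2 i) (hΦ.2 s i) (abs_nonneg _) hη).trans (by rw [mul_one])
    _ = ((1 : ℕ) * d₅ * η : ℝ) := by simp
    _ ≤ _ := mul_le_linDim_sq hd (by unfold linDim; omega) hη

/-- Replacing a valid model by a close one changes the beliefs at most linearly in the number of
steps. -/
lemma l1_forward_sub_le {M N : POMDP S O A} (hM : M.IsValid H) (hN : N.IsValid H) {κ : ℝ}
    (htrans : ∀ h ∈ Finset.Icc 1 H, ∀ s a s', |M.trans h s a s' - N.trans h s a s'| ≤ κ)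
    (hemit : ∀ h ∈ Finset.Icc 1 H, ∀ s o, |M.emit h s o - N.emit h s o| ≤ κ)
    (l : List (O × A)) (h : ℕ) (hh : 1 ≤ h) (hl : h + l.length ≤ H + 1) (b b' : S → ℝ)
    (hb' : l1 b' ≤ 1) :
    l1 (M.forward h b l - N.forward h b' l) ≤
      l1 (b - b') + l.length * ((1 + Fintype.card S) * κ) := by
  induction l generalizing h b b' with
  | nil => simp [POMDP.forward]
  | cons p l ih =>
    simp only [List.length_cons] at hl
    have hmem : h ∈ Finset.Icc 1 H := Finset.mem_Icc.2 ⟨hh, by omega⟩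
    have hvM := hM.2 h hmem
    have hvN := hN.2 h hmem
    have hle : ∀ s, N.emit h s p.1 ≤ 1 := fun s => by
      rw [← (hvN.2 s).2]
      exact Finset.single_le_sum (fun o _ => (hvN.2 s).1 o) (Finset.mem_univ _)
    have hleM : ∀ s, M.emit h s p.1 ≤ 1 := fun s => by
      rw [← (hvM.2 s).2]
      exact Finset.single_le_sum (fun o _ => (hvM.2 s).1 o) (Finset.mem_univ _)
    simp only [POMDP.forward]
    set b₁ : S → ℝ := fun s' => ∑ s, b s * M.emit h s p.1 * M.trans h s p.2 s' with hb₁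
    set b₁' : S → ℝ := fun s' => ∑ s, b' s * N.emit h s p.1 * N.trans h s p.2 s' with hb₁'
    have h1 : l1 b₁' ≤ 1 := by
      refine le_trans ?_ hb'
      calc l1 b₁' ≤ ∑ s', ∑ s, |b' s| * N.emit h s p.1 * N.trans h s p.2 s' := by
            refine Finset.sum_le_sum fun s' _ => (Finset.abs_sum_le_sum_abs _ _).trans
              (le_of_eq (Finset.sum_congr rfl fun s _ => ?_))
            rw [abs_mul, abs_mul, abs_of_nonneg ((hvN.2 s).1 _), abs_of_nonneg ((hvN.1 s _).1 _)]
        _ = ∑ s, |b' s| * N.emit h s p.1 := by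
            rw [Finset.sum_comm]
            refine Finset.sum_congr rfl fun s _ => ?_
            rw [← Finset.mul_sum, (hvN.1 s p.2).2, mul_one]
        _ ≤ l1 b' := Finset.sum_le_sum fun s _ =>
            mul_le_of_le_one_right (abs_nonneg _) (hle s)
    have hstep : l1 (b₁ - b₁') ≤ l1 (b - b') + (1 + Fintype.card S) * κ := by
      have hpt : ∀ s s', |b s * M.emit h s p.1 * M.trans h s p.2 s' -
          b' s * N.emit h s p.1 * N.trans h s p.2 s'| ≤
          |b s - b' s| * M.trans h s p.2 s' + |b' s| * (κ * M.trans h s p.2 s') +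
            |b' s| * κ := by
        intro s s'
        have e1 : b s * M.emit h s p.1 * M.trans h s p.2 s' -
            b' s * N.emit h s p.1 * N.trans h s p.2 s' =
            (b s - b' s) * (M.emit h s p.1 * M.trans h s p.2 s') +
            b' s * ((M.emit h s p.1 - N.emit h s p.1) * M.trans h s p.2 s') +
            b' s * (N.emit h s p.1 * (M.trans h s p.2 s' - N.trans h s p.2 s')) := by ring
        have hT0 := (hvM.1 s p.2).1 s'
        rw [e1]
        refine (abs_add_three _ _ _).trans (add_le_add (add_le_add ?_ ?_) ?_)
        · rw [abs_mul, abs_mul, abs_of_nonneg ((hvM.2 s).1 _), abs_of_nonneg hT0]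
          exact mul_le_mul_of_nonneg_left (mul_le_of_le_one_left hT0 (hleM s)) (abs_nonneg _)
        · rw [abs_mul, abs_mul, abs_of_nonneg hT0]
          exact mul_le_mul_of_nonneg_left (mul_le_mul_of_nonneg_right (hemit h hmem s p.1) hT0)
            (abs_nonneg _)
        · rw [abs_mul, abs_mul, abs_of_nonneg ((hvN.2 s).1 _)]
          refine mul_le_mul_of_nonneg_left ?_ (abs_nonneg _)
          exact (mul_le_of_le_one_left (abs_nonneg _) (hle s)).trans (htrans h hmem s p.2 s')
      calc l1 (b₁ - b₁') ≤ ∑ s', ∑ s, (|b s - b' s| * M.trans h s p.2 s' +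
              |b' s| * (κ * M.trans h s p.2 s') + |b' s| * κ) := by
            refine Finset.sum_le_sum fun s' _ => ?_
            rw [Pi.sub_apply, hb₁, hb₁', ← Finset.sum_sub_distrib]
            exact (Finset.abs_sum_le_sum_abs _ _).trans
              (Finset.sum_le_sum fun s _ => hpt s s')
        _ = l1 (b - b') + (l1 b' * κ + Fintype.card S * (l1 b' * κ)) := by
            rw [Finset.sum_comm]
            simp only [Finset.sum_add_distrib, ← Finset.mul_sum, (hvM.1 _ p.2).2, mul_one,
              Finset.sum_const, Finset.card_univ, nsmul_eq_mul]
            simp only [l1, Finset.sum_mul, Finset.mul_sum, Pi.sub_apply, add_assoc]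
            congr 2
            exact Finset.sum_congr rfl fun s _ => by ring
        _ ≤ _ := by
            -- A valid model has a state, so `κ` bounds some absolute value.
            have hκ : 0 ≤ κ ∨ IsEmpty S := by
              rcases isEmpty_or_nonempty S with hS | ⟨⟨s⟩⟩
              · exact Or.inr hS
              · exact Or.inl ((abs_nonneg _).trans (hemit h hmem s p.1))
            have hκ' : 0 ≤ κ := by
              rcases hκ with hκ | hS
              · exact hκ
              · exact absurd hM.1.2 (by simp)
            have h2 : l1 b' * κ ≤ κ := mul_le_of_le_one_left hκ' hb'
            have h3 : (Fintype.card S : ℝ) * (l1 b' * κ) ≤ Fintype.card S * κ :=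
              mul_le_mul_of_nonneg_left h2 (Nat.cast_nonneg _)
            linarith
    refine (ih (h + 1) (by omega) (by omega) b₁ b₁' h1).trans ?_
    rw [List.length_cons]
    push_cast
    linarith

lemma abs_histProb_sub_le (hΦ : Φ.IsBounded H) (hη : 0 ≤ η) (hf : (Φ.model f).IsValid H)
    (hg : (Φ.model g).IsValid H) (hfg : f.IsClose g H η) (l : List (O × A)) (hl : l.length = H) :
    |(Φ.model f).histProb l - (Φ.model g).histProb l| ≤
      (1 + H) * ((1 + Fintype.card S) * ((linDim d₁ d₂ d₃ d₄ d₅ : ℝ) ^ 2 * η)) := by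
  set κ := (linDim d₁ d₂ d₃ d₄ d₅ : ℝ) ^ 2 * η with hκ
  have hκ0 : 0 ≤ κ := by positivity
  have h1 := l1_forward_sub_le hf hg (κ := κ)
    (fun h hh s a s' => abs_trans_sub_le hΦ hη hfg hh s s' a)
    (fun h hh s o => abs_emit_sub_le hΦ hη hfg hh s o) l 1 le_rfl (by omega)
    (Φ.model f).init (Φ.model g).init (by
      rw [← hg.1.2]
      exact (Finset.sum_congr rfl fun s _ => abs_of_nonneg (hg.1.1 s)).le)
  have h2 : l1 ((Φ.model f).init - (Φ.model g).init) ≤ Fintype.card S * κ := by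
    refine (Finset.sum_le_sum fun s _ =>
      abs_init_sub_le hΦ hη hfg (one_le_linDim hf) s).trans (le_of_eq ?_)
    simp [hκ]
  have h3 : |(Φ.model f).histProb l - (Φ.model g).histProb l| ≤
      l1 ((Φ.model f).forward 1 (Φ.model f).init l - (Φ.model g).forward 1 (Φ.model g).init l) := by
    rw [POMDP.histProb, POMDP.histProb, ← Finset.sum_sub_distrib]
    exact Finset.abs_sum_le_sum_abs _ _
  rw [hl] at h1
  linarith

end Close

/-- The cell of a number in a grid of width `1 / T` on `[-1, 1]`. -/
def gridCell (T : ℕ) (x : ℝ) : Fin (2 * T + 1) :=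
  ⟨min ⌊(x + 1) * T⌋₊ (2 * T), by omega⟩

lemma abs_sub_le_of_gridCell_eq {T : ℕ} (hT : 0 < T) {x y : ℝ} (hx : |x| ≤ 1) (hy : |y| ≤ 1)
    (h : gridCell T x = gridCell T y) : |x - y| ≤ 1 / T := by
  have hT' : (0 : ℝ) < T := by exact_mod_cast hT
  have hval : ∀ x : ℝ, |x| ≤ 1 → 0 ≤ (x + 1) * T ∧ ⌊(x + 1) * T⌋₊ ≤ 2 * T := by
    intro x hx
    have := abs_le.1 hx
    refine ⟨mul_nonneg (by linarith) hT'.le, ?_⟩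
    refine Nat.floor_le_of_le ?_
    push_cast
    exact mul_le_mul_of_nonneg_right (by linarith) hT'.le
  obtain ⟨hx0, hx1⟩ := hval x hx
  obtain ⟨hy0, hy1⟩ := hval y hy
  have h1 : ⌊(x + 1) * T⌋₊ = ⌊(y + 1) * T⌋₊ := by
    have := congrArg Fin.val h
    simp only [gridCell] at this
    omega
  have a1 := Nat.floor_le hx0
  have a2 := Nat.lt_floor_add_one ((x + 1) * T)
  have a3 := Nat.floor_le hy0
  have a4 := Nat.lt_floor_add_one ((y + 1) * T)
  rw [h1] at a1 a2
  rw [abs_le, ← neg_div, div_le_iff₀ hT', le_div_iff₀ hT']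
  constructor <;> linarith

/-- The cells of a grid for the relevant entries of the parameters. -/
abbrev ParamGrid (d₁ d₂ d₃ d₄ d₅ H T : ℕ) :=
  (Fin H → Fin d₂ → Fin d₁ → Fin (2 * T + 1)) × (Fin H → Fin d₄ → Fin d₃ → Fin (2 * T + 1)) ×
    (Fin d₅ → Fin (2 * T + 1))

/-- The cell of a parameter. -/
def LinParam.cell (f : LinParam d₁ d₂ d₃ d₄ d₅) (H T : ℕ) : ParamGrid d₁ d₂ d₃ d₄ d₅ H T :=
  (fun h i j => gridCell T (f.B₁ (h + 1) i j), fun h i j => gridCell T (f.B₂ (h + 1) i j),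
    fun i => gridCell T (f.θ i))

lemma isClose_of_cell_eq {f g : LinParam d₁ d₂ d₃ d₄ d₅} {T : ℕ} (hT : 0 < T)
    (hf : f.IsBounded H) (hg : g.IsBounded H) (h : f.cell H T = g.cell H T) :
    f.IsClose g H (1 / T) := by
  simp only [LinParam.cell, Prod.mk.injEq] at h
  obtain ⟨h1, h2, h3⟩ := h
  refine ⟨fun k hk => ?_, fun i =>
    abs_sub_le_of_gridCell_eq hT (hf.2 i) (hg.2 i) (congrFun h3 i)⟩
  obtain ⟨hk1, hkH⟩ := Finset.mem_Icc.1 hk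
  obtain ⟨j, rfl⟩ : ∃ j, k = j + 1 := ⟨k - 1, by omega⟩
  exact ⟨fun a b => abs_sub_le_of_gridCell_eq hT ((hf.1 _ hk).1 a b) ((hg.1 _ hk).1 a b)
      (congrFun (congrFun (congrFun h1 ⟨j, by omega⟩) a) b),
    fun a b => abs_sub_le_of_gridCell_eq hT ((hf.1 _ hk).2 a b) ((hg.1 _ hk).2 a b)
      (congrFun (congrFun (congrFun h2 ⟨j, by omega⟩) a) b)⟩

lemma card_paramGrid_le {d : ℕ} (hd : linDim d₁ d₂ d₃ d₄ d₅ ≤ d) (hd1 : 1 ≤ d) (hH : 1 ≤ H)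
    (T : ℕ) : Fintype.card (ParamGrid d₁ d₂ d₃ d₄ d₅ H T) ≤ (2 * T + 1) ^ (3 * (H * d ^ 2)) := by
  unfold linDim at hd
  have h1 : d₁ * d₂ * H ≤ H * d ^ 2 := by
    rw [mul_comm, pow_two]
    exact Nat.mul_le_mul le_rfl (Nat.mul_le_mul (by omega) (by omega))
  have h2 : d₃ * d₄ * H ≤ H * d ^ 2 := by
    rw [mul_comm, pow_two]
    exact Nat.mul_le_mul le_rfl (Nat.mul_le_mul (by omega) (by omega))
  have h3 : d₅ ≤ H * d ^ 2 := by
    calc d₅ ≤ 1 * (d * 1) := by omega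
      _ ≤ H * (d * d) := Nat.mul_le_mul hH (Nat.mul_le_mul le_rfl hd1)
      _ = H * d ^ 2 := by rw [pow_two]
  simp only [Fintype.card_prod, Fintype.card_fun, Fintype.card_fin, ← pow_mul, ← pow_add]
  exact Nat.pow_le_pow_right (by omega) (by omega)

/-- A bracket of a class of linear models, from a grid of parameters of width `1 / T`: the
probabilities of the histories in one cell differ by at most `e`. -/
lemma exists_isBracket {F : Set (LinParam d₁ d₂ d₃ d₄ d₅)} (hΦ : Φ.IsBounded H)
    (hF : ∀ f ∈ F, f.IsBounded H ∧ (Φ.model f).IsValid H) {T : ℕ} (hT : 0 < T) {ε : ℝ}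
    (hTε : ((Fintype.card O * Fintype.card A : ℕ) : ℝ) ^ H * (2 * ((1 + H) *
      ((1 + Fintype.card S) * ((linDim d₁ d₂ d₃ d₄ d₅ : ℝ) ^ 2 * (1 / T))))) ≤ ε) :
    ∃ g₁ g₂ : Fin (Fintype.card (ParamGrid d₁ d₂ d₃ d₄ d₅ H T)) → Policy O A → Traj O A H → ℝ,
      IsBracket Φ H F ε g₁ g₂ := by
  classical
  set e := (1 + H) * ((1 + Fintype.card S) * ((linDim d₁ d₂ d₃ d₄ d₅ : ℝ) ^ 2 * (1 / T))) with he
  have he0 : 0 ≤ e := by positivity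
  let eq := Fintype.equivFin (ParamGrid d₁ d₂ d₃ d₄ d₅ H T)
  -- The center of a cell is some member of the class in this cell.
  let cen : ParamGrid d₁ d₂ d₃ d₄ d₅ H T → LinParam d₁ d₂ d₃ d₄ d₅ := fun c =>
    if hc : ∃ f ∈ F, f.cell H T = c then hc.choose else ⟨0, 0, 0⟩
  have hcen : ∀ f ∈ F, cen (f.cell H T) ∈ F ∧ (cen (f.cell H T)).cell H T = f.cell H T := by
    intro f hf
    have hc : ∃ f' ∈ F, f'.cell H T = f.cell H T := ⟨f, hf, rfl⟩
    simp only [cen, dif_pos hc]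
    exact hc.choose_spec
  refine ⟨fun i π τ => ((Φ.model (cen (eq.symm i))).histProb (List.ofFn τ) - e) *
      π.listWeight [] (List.ofFn τ),
    fun i π τ => ((Φ.model (cen (eq.symm i))).histProb (List.ofFn τ) + e) *
      π.listWeight [] (List.ofFn τ), fun i π => ?_, fun f hf => ⟨eq (f.cell H T), fun π τ => ?_⟩⟩
  · refine le_trans ?_ hTε
    calc _ ≤ ∑ _τ : Traj O A H, 2 * e := by
          refine Finset.sum_le_sum fun τ _ => ?_
          rw [← sub_mul, show ∀ x : ℝ, x - e - (x + e) = -(2 * e) by intro x; ring, abs_mul,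
            abs_neg, abs_of_nonneg (by positivity), abs_of_nonneg (π.listWeight_nonneg _ _)]
          exact mul_le_of_le_one_right (by positivity) (π.listWeight_le_one _ _)
      _ = _ := by simp
  · obtain ⟨hcF, hcell⟩ := hcen f hf
    have hclose := isClose_of_cell_eq hT (hF f hf).1 (hF _ hcF).1 hcell.symm
    have hdiff := abs_le.1 (abs_histProb_sub_le hΦ (by positivity) (hF f hf).2 (hF _ hcF).2 hclose
      (List.ofFn τ) (by simp))
    simp only [Equiv.symm_apply_apply]
    rw [trajProb_eq]
    have hw := π.listWeight_nonneg [] (List.ofFn τ)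
    exact ⟨mul_le_mul_of_nonneg_right (by linarith [hdiff.1]) hw,
      mul_le_mul_of_nonneg_right (by linarith [hdiff.2]) hw⟩

end

/-! ### The sum of the model errors along a run -/

section

variable {S O A : Type*} [Fintype S] [Fintype O] [Fintype A] [Nonempty A] {N : POMDP S O A}
  {H m K : ℕ} {α y Γ : ℝ}

lemma one_le_card_pow (A : Type*) [Fintype A] [Nonempty A] (k : ℕ) :
    (1 : ℝ) ≤ (Fintype.card A : ℝ) ^ k :=
  one_le_pow₀ (by exact_mod_cast Fintype.card_pos)

lemma card_pow_succ_le (hm : 1 ≤ m) (hA : (Fintype.card A : ℝ) ^ m ≤ y) :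
    (Fintype.card A : ℝ) ^ (m + 1) ≤ y ^ 2 := by
  have h1 : (1 : ℝ) ≤ Fintype.card A := by exact_mod_cast Fintype.card_pos
  calc (Fintype.card A : ℝ) ^ (m + 1) ≤ (Fintype.card A : ℝ) ^ (m * 2) :=
        pow_le_pow_right₀ h1 (by omega)
    _ = ((Fintype.card A : ℝ) ^ m) ^ 2 := pow_mul _ _ _
    _ ≤ y ^ 2 := pow_le_pow_left₀ (by positivity) hA 2

lemma card_sq_le (hm : 1 ≤ m) (hA : (Fintype.card A : ℝ) ^ m ≤ y) :
    (Fintype.card A : ℝ) ^ 2 ≤ y ^ 2 := by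
  have h1 : (1 : ℝ) ≤ Fintype.card A := by exact_mod_cast Fintype.card_pos
  refine pow_le_pow_left₀ (by positivity) (le_trans ?_ hA) 2
  simpa using pow_le_pow_right₀ h1 hm

section Step

variable {h : ℕ} {M : POMDP S O A}

/-- The coordinates, in the core histories of `Rs`, of the prediction error of `R` for the
future `r`. -/
def CoreRep.errCoord (R : CoreRep M H m h α) (Rs : CoreRep N H m h α) (r : List (O × A))
    (j : Fin Rs.n) : ℝ :=
  R.fut r ((N.histProb (Rs.core j))⁻¹ • N.pred m (Rs.core j)) -
    N.histProb (Rs.core j ++ r) / N.histProb (Rs.core j)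

/-- For a fixed future, the prediction error after the history `l` is a linear functional of the
coordinates of `l` in the core histories of the true model. These are as many as the rank,
which does not grow with the number of observations. -/
lemma CoreRep.errCoord_dotProduct (hN : N.IsValid H) (hm : 1 ≤ m) (hmH : h + m ≤ H)
    (R : CoreRep M H m h α) (Rs : CoreRep N H m h α) {l r : List (O × A)} (hl : l.length = h)
    (hr : r ≠ []) (hrH : h + r.length ≤ H) :
    R.errCoord Rs r ⬝ᵥ (Rs.coef *ᵥ N.pred m l) =
      R.fut r (N.pred m l) - N.histProb (l ++ r) := by
  obtain ⟨a⟩ := ‹Nonempty A›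
  have hpred : N.pred m l = fun u => ∑ j, (Rs.coef *ᵥ N.pred m l) j *
      ((N.histProb (Rs.core j))⁻¹ • N.pred m (Rs.core j)) u := by
    ext u
    rw [POMDP.pred_eq hN hm l a u (by omega),
      Rs.repr l (testList a u) hl (by simp [testList]) (by simp; omega)]
    refine Finset.sum_congr rfl fun j _ => ?_
    rw [Pi.smul_apply, POMDP.pred_eq hN hm _ a u (by rw [Rs.length_core]; omega), smul_eq_mul]
    ring
  conv_rhs => rw [hpred, R.fut_sum, Rs.repr l r hl hr hrH, ← Finset.sum_sub_distrib]
  refine Finset.sum_congr rfl fun j _ => ?_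
  rw [errCoord]
  ring

/-- The functionals `errCoord` are bounded in total over the futures, with no factor for the number
of observations. -/
lemma CoreRep.listSum_abs_errCoord_le (hM : M.IsValid H) (hN : N.IsValid H) (hm : 1 ≤ m)
    (hα : 0 < α) (hmH : h + m ≤ H) (R : CoreRep M H m h α) (Rs : CoreRep N H m h α) {k : ℕ}
    (hk : h + k ≤ H) (j : Fin Rs.n) :
    listSum k (fun r => |R.errCoord Rs r j|) ≤
      (Fintype.card A : ℝ) ^ k * (1 / α * (Fintype.card A : ℝ) ^ m + 1) := by
  have hlen := Rs.length_core j
  have h0 : 0 ≤ N.histProb (Rs.core j) := POMDP.histProb_nonneg hN _ (by omega)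
  have h1 := R.listSum_abs_fut_le hM k hk ((N.histProb (Rs.core j))⁻¹ • N.pred m (Rs.core j))
  have h2 : l1 ((N.histProb (Rs.core j))⁻¹ • N.pred m (Rs.core j)) ≤
      (Fintype.card A : ℝ) ^ m := by
    rw [l1_smul, abs_of_nonneg (inv_nonneg.2 h0)]
    refine (mul_le_mul_of_nonneg_left (POMDP.l1_pred_le hN hm (Rs.core j) (by omega))
      (inv_nonneg.2 h0)).trans ?_
    rw [mul_left_comm]
    exact mul_le_of_le_one_right (by positivity) (inv_mul_le_one)
  have h3 : listSum k (fun r => N.histProb (Rs.core j ++ r) / N.histProb (Rs.core j)) ≤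
      (Fintype.card A : ℝ) ^ k := by
    rw [listSum_eq_uniform k []]
    exact mul_le_of_le_one_right (by positivity)
      (POMDP.listSum_weight_div_le_one hN _ k [] _ (by omega))
  have h4 : (Fintype.card A : ℝ) ^ k * (1 / α *
      l1 ((N.histProb (Rs.core j))⁻¹ • N.pred m (Rs.core j))) ≤
      (Fintype.card A : ℝ) ^ k * (1 / α * (Fintype.card A : ℝ) ^ m) := by
    gcongr
  rw [mul_add, mul_one]
  refine le_trans ?_ (add_le_add (h1.trans h4) h3)
  rw [← listSum_add_fun]
  refine listSum_mono fun r hr => ?_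
  refine (abs_sub _ _).trans (le_of_eq ?_)
  congr 1
  exact abs_of_nonneg (div_nonneg (POMDP.histProb_nonneg hN _ (by simp; omega)) h0)

end Step

variable {M : Fin K → POMDP S O A}

/-- The sum over the run of the prediction errors at a fixed step. -/
lemma sum_listSum_weight_err_le (hK : 1 ≤ K) (hM : ∀ k, (M k).IsValid H) (hN : N.IsValid H)
    (hm : 1 ≤ m) (hmH : m ≤ H) (hα : 0 < α) {h : Fin (H - m + 1)} (Rs : CoreRep N H m h α)
    (R : ∀ k, CoreRep (M k) H m h α) (π : Fin K → Policy O A) (hn : (Rs.n : ℝ) ≤ y) (hy : 1 ≤ y)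
    (hA : (Fintype.card A : ℝ) ^ m ≤ y) (hα' : 1 / α ≤ y) (hΓ0 : 0 ≤ Γ)
    (hΓ : ∀ k, ∑ k' with k' < k, dataDist (M k) N H m (π k') ≤ Γ) :
    ∑ k, listSum (h : ℕ) (fun l => (π k).listWeight [] l * (R k).err N (futLen H m h) l) ≤
      64 * y ^ 8 * (1 + Γ) * Real.log (y + K) := by
  have hk1 : 1 ≤ futLen H m h := by rw [futLen]; split_ifs <;> omega
  have hkm : futLen H m h ≤ m + 1 := by rw [futLen]; split_ifs <;> omega
  have hkH : h + futLen H m h ≤ H := by rw [futLen]; split_ifs <;> omega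
  have hA1 : (1 : ℝ) ≤ Fintype.card A := by exact_mod_cast Fintype.card_pos
  have hy0 : 0 ≤ y := by linarith
  have hα0 : 0 ≤ 1 / α := by positivity
  -- The histories, weighted by their probabilities, are the vectors; the futures the functionals.
  let x : Fin K → Traj O A h → Fin Rs.n → ℝ := fun k τ =>
    (π k).listWeight [] (List.ofFn τ) • (Rs.coef *ᵥ N.pred m (List.ofFn τ))
  let w : Fin K → (Fin (futLen H m h) → O × A) → Fin Rs.n → ℝ := fun k r =>
    (R k).errCoord Rs (List.ofFn r)
  have hval : ∀ k k', ∑ τ, ∑ r, |w k r ⬝ᵥ x k' τ| = listSum (h : ℕ) (fun l =>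
      (π k').listWeight [] l * (R k).err N (futLen H m h) l) := by
    intro k k'
    refine Finset.sum_congr rfl fun τ _ => ?_
    simp only [CoreRep.err, mul_listSum]
    refine Finset.sum_congr rfl fun r _ => ?_
    have hr : List.ofFn r ≠ [] := by
      intro h0
      have := congrArg List.length h0
      simp at this
      omega
    rw [dotProduct_smul, CoreRep.errCoord_dotProduct hN hm (by omega) (R k) Rs (by simp) hr
      (by simpa using hkH), smul_eq_mul, abs_mul, abs_of_nonneg (Policy.listWeight_nonneg _ _ _)]
  have hx : ∀ k, ∑ τ, l1 (x k τ) ≤ y ^ 2 := by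
    intro k
    calc ∑ τ, l1 (x k τ) ≤ listSum (h : ℕ) (fun l => (1 / α * (Fintype.card A : ℝ) ^ m) *
            ((π k).listWeight [] l * N.histProb ([] ++ l))) := by
          refine Finset.sum_le_sum fun τ _ => ?_
          have h1 := (Rs.norm_coef (N.pred m (List.ofFn τ))).trans (mul_le_mul_of_nonneg_left
            (POMDP.l1_pred_le hN hm (List.ofFn τ) (by simp; omega)) hα0)
          rw [l1_smul, abs_of_nonneg (Policy.listWeight_nonneg _ _ _)]
          simp only [List.nil_append]
          refine (mul_le_mul_of_nonneg_left h1 (Policy.listWeight_nonneg _ _ _)).trans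
            (le_of_eq (by ring))
      _ = 1 / α * (Fintype.card A : ℝ) ^ m := by
          rw [← mul_listSum, listSum_weight_histProb hN _ _ _ _ (by simp; omega),
            POMDP.histProb_nil hN, mul_one]
      _ ≤ y ^ 2 := by rw [pow_two]; gcongr
  have hw : ∀ k j, ∑ r, |w k r j| ≤ 2 * y ^ 4 := by
    intro k j
    refine (CoreRep.listSum_abs_errCoord_le (hM k) hN hm hα (by omega) (R k) Rs hkH j).trans ?_
    have h1 : (Fintype.card A : ℝ) ^ futLen H m h ≤ y ^ 2 :=
      (pow_le_pow_right₀ hA1 hkm).trans (card_pow_succ_le hm hA)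
    have h2 : 1 / α * (Fintype.card A : ℝ) ^ m + 1 ≤ 2 * y ^ 2 := by
      have : 1 / α * (Fintype.card A : ℝ) ^ m ≤ y * y := by gcongr
      nlinarith
    calc _ ≤ y ^ 2 * (2 * y ^ 2) := mul_le_mul h1 h2 (by positivity) (by positivity)
      _ = 2 * y ^ 4 := by ring
  have hprev : ∀ k, ∑ k' with k' < k, ∑ τ, ∑ r, |w k r ⬝ᵥ x k' τ| ≤ 2 * y ^ 5 * Γ := by
    intro k
    have hC : ((Fintype.card A : ℝ) ^ (m + 1) * (1 / α) + 1) * (Fintype.card A : ℝ) ^ 2 ≤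
        2 * y ^ 5 := by
      have h1 : (Fintype.card A : ℝ) ^ (m + 1) * (1 / α) + 1 ≤ 2 * y ^ 3 := by
        have h3 : (Fintype.card A : ℝ) ^ (m + 1) * (1 / α) ≤ y ^ 2 * y :=
          mul_le_mul (card_pow_succ_le hm hA) hα' hα0 (by positivity)
        have h4 : 1 ≤ y ^ 3 := one_le_pow₀ hy
        nlinarith
      calc _ ≤ 2 * y ^ 3 * y ^ 2 := mul_le_mul h1 (card_sq_le hm hA) (by positivity) (by positivity)
        _ = _ := by ring
    calc ∑ k' with k' < k, ∑ τ, ∑ r, |w k r ⬝ᵥ x k' τ|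
        ≤ ∑ k' with k' < k, 2 * y ^ 5 * dataDist (M k) N H m (π k') := by
          refine Finset.sum_le_sum fun k' _ => ?_
          rw [hval]
          refine (CoreRep.listSum_weight_err_le (hM k) hN hm hmH hα (R k) (π k')).trans ?_
          rw [← mul_assoc]
          exact mul_le_mul_of_nonneg_right hC
            (Finset.sum_nonneg fun i _ => lawDist_nonneg _ _ _ _)
      _ = 2 * y ^ 5 * ∑ k' with k' < k, dataDist (M k) N H m (π k') :=
          (Finset.mul_sum _ _ _).symm
      _ ≤ _ := mul_le_mul_of_nonneg_left (hΓ k) (by positivity)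
  have hmain := sum_sum_abs_dotProduct_le hK x w (ρ := y ^ 2) (R := 2 * y ^ 4)
    (γ := 2 * y ^ 5 * Γ) (by positivity) (by positivity) (by positivity) hx hw hprev
  simp only [hval] at hmain
  refine hmain.trans ?_
  have hsq : √(Rs.n : ℝ) ≤ y := by
    rw [Real.sqrt_le_left hy0]; nlinarith
  have hK' : (1 : ℝ) ≤ K := by exact_mod_cast hK
  have hlog : Real.log (√(Rs.n : ℝ) + K) ≤ Real.log (y + K) :=
    Real.log_le_log (by positivity) (by linarith)
  have hlog0 : 0 ≤ Real.log (√(Rs.n : ℝ) + K) := by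
    refine Real.log_nonneg ?_
    have := Real.sqrt_nonneg (Rs.n : ℝ)
    linarith
  have h1 : y ^ 2 * (√(Rs.n : ℝ) * (2 * y ^ 4)) + (2 * y ^ 5 * Γ + y ^ 2 * (2 * y ^ 4)) ≤
      16 * y ^ 7 * (1 + Γ) := by
    have e1 : y ^ 2 * (√(Rs.n : ℝ) * (2 * y ^ 4)) ≤ y ^ 2 * (y * (2 * y ^ 4)) := by gcongr
    have e2 : y ^ 5 ≤ y ^ 7 := pow_le_pow_right₀ hy (by norm_num)
    have e3 : y ^ 6 ≤ y ^ 7 := pow_le_pow_right₀ hy (by norm_num)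
    have e4 : y ^ 5 * Γ ≤ y ^ 7 * Γ := mul_le_mul_of_nonneg_right e2 hΓ0
    have e5 : 0 ≤ y ^ 7 * Γ := by positivity
    have e6 : 0 ≤ y ^ 7 := by positivity
    nlinarith
  have h2 : 4 * (Rs.n : ℝ) * Real.log (√(Rs.n : ℝ) + K) ≤ 4 * y * Real.log (y + K) := by
    gcongr
  calc _ ≤ (16 * y ^ 7 * (1 + Γ)) * (4 * y * Real.log (y + K)) :=
        mul_le_mul h1 h2 (by positivity) (by positivity)
    _ = _ := by ring

/-- The sum over the run of the errors of the initial predictive state. -/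
lemma sum_l1_pred_nil_sub_le (hK : 1 ≤ K) (hM : ∀ k, (M k).IsValid H) (hN : N.IsValid H)
    (hm : 1 ≤ m) (hmH : m ≤ H) (π : Fin K → Policy O A) (hy : 1 ≤ y)
    (hA : (Fintype.card A : ℝ) ^ m ≤ y) (hΓ0 : 0 ≤ Γ)
    (hΓ : ∀ k, ∑ k' with k' < k, dataDist (M k) N H m (π k') ≤ Γ) :
    ∑ k, l1 ((M k).pred m [] - N.pred m []) ≤ 64 * y ^ 8 * (1 + Γ) * Real.log (y + K) := by
  let e : Fin K → ℝ := fun k => l1 ((M k).pred m [] - N.pred m [])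
  have he0 : ∀ k, 0 ≤ e k := fun k => l1_nonneg _
  have hval : ∀ k : Fin K, |(fun _ : Fin 1 => e k) ⬝ᵥ (fun _ : Fin 1 => (1 : ℝ))| = e k :=
    fun k => by simp [dotProduct, abs_of_nonneg (he0 k)]
  have hpredle : ∀ M' : POMDP S O A, M'.IsValid H → l1 (M'.pred m []) ≤ y := by
    intro M' hM'
    refine (POMDP.l1_pred_le hM' hm [] (by simpa using hmH)).trans ?_
    rw [POMDP.histProb_nil hM', mul_one]
    exact hA
  have hw : ∀ k, e k ≤ 2 * y := by
    intro k
    have h1 : e k ≤ l1 ((M k).pred m []) + l1 (N.pred m []) := by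
      simp only [e, l1]
      rw [← Finset.sum_add_distrib]
      exact Finset.sum_le_sum fun u _ => abs_sub _ _
    linarith [hpredle (M k) (hM k), hpredle N hN]
  have hprev : ∀ k, ∑ k' with k' < k, e k ≤ y ^ 2 * Γ := by
    intro k
    calc ∑ k' with k' < k, e k ≤ ∑ k' with k' < k, y ^ 2 * dataDist (M k) N H m (π k') := by
          refine Finset.sum_le_sum fun k' _ =>
            (l1_pred_nil_sub_le (hM k) hN hm hmH (π k')).trans ?_
          exact mul_le_mul_of_nonneg_right (card_sq_le hm hA)
            (Finset.sum_nonneg fun i _ => lawDist_nonneg _ _ _ _)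
      _ = y ^ 2 * ∑ k' with k' < k, dataDist (M k) N H m (π k') := (Finset.mul_sum _ _ _).symm
      _ ≤ _ := mul_le_mul_of_nonneg_left (hΓ k) (by positivity)
  -- The errors are the values at `1` of linear functionals in dimension one.
  have hmain := sum_sum_abs_dotProduct_le hK (I := Unit) (L := Unit) (n := 1)
    (fun _ _ _ => 1) (fun k _ _ => e k) (ρ := 1) (R := 2 * y) (γ := y ^ 2 * Γ) one_pos
    (by positivity) (by positivity) (fun k => by simp [l1])
    (fun k j => by simpa [abs_of_nonneg (he0 k)] using hw k)
    (fun k => by simpa [hval] using hprev k)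
  simp only [hval, Finset.univ_unique, Finset.sum_singleton] at hmain
  refine hmain.trans ?_
  have hK' : (1 : ℝ) ≤ K := by exact_mod_cast hK
  have hlog : Real.log (1 + K) ≤ Real.log (y + K) := Real.log_le_log (by positivity) (by linarith)
  have hlog0 : 0 ≤ Real.log (1 + K) := Real.log_nonneg (by linarith)
  have e1 : y ≤ y ^ 8 := by simpa using pow_le_pow_right₀ hy (show 1 ≤ 8 by norm_num)
  have e2 : y ^ 2 ≤ y ^ 8 := pow_le_pow_right₀ hy (by norm_num)
  have h1 : 2 * y + (y ^ 2 * Γ + 2 * y) ≤ 16 * y ^ 8 * (1 + Γ) := by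
    have e4 : y ^ 2 * Γ ≤ y ^ 8 * Γ := mul_le_mul_of_nonneg_right e2 hΓ0
    have e5 : 0 ≤ y ^ 8 * Γ := by positivity
    nlinarith
  simp only [Nat.cast_one, Real.sqrt_one, one_mul, mul_one]
  calc _ ≤ (16 * y ^ 8 * (1 + Γ)) * (4 * Real.log (y + K)) :=
        mul_le_mul h1 (by linarith) (by positivity) (by positivity)
    _ = _ := by ring

/-- If every model is close to the true one on the data collected before it was chosen, then the
sum of the distances of the trajectory laws under the chosen policies is small. -/
theorem sum_lawDist_le (hK : 1 ≤ K) (hM : ∀ k, (M k).IsValid H) (hN : N.IsValid H)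
    (hm : 1 ≤ m) (hmH : m ≤ H) (hα : 0 < α) (Rs : ∀ h : Fin (H - m + 1), CoreRep N H m h α)
    (R : ∀ k, ∀ h : Fin (H - m + 1), CoreRep (M k) H m h α) (π : Fin K → Policy O A)
    (hn : ∀ h, ((Rs h).n : ℝ) ≤ y) (hy : 1 ≤ y) (hA : (Fintype.card A : ℝ) ^ m ≤ y)
    (hα' : 1 / α ≤ y) (hH : (H : ℝ) ≤ y) (hΓ0 : 0 ≤ Γ)
    (hΓ : ∀ k, ∑ k' with k' < k, dataDist (M k) N H m (π k') ≤ Γ) :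
    ∑ k, lawDist (M k) N H (π k) ≤ 256 * y ^ 10 * (1 + Γ) * Real.log (y + K) := by
  set B := 64 * y ^ 8 * (1 + Γ) * Real.log (y + K) with hB
  have h0 := sum_l1_pred_nil_sub_le hK hM hN hm hmH π hy hA hΓ0 hΓ
  have hB0 : 0 ≤ B := (Finset.sum_nonneg fun k _ => l1_nonneg _).trans h0
  have h1 : ∀ h : Fin (H - m + 1), ∑ k, listSum (h : ℕ) (fun l => (π k).listWeight [] l *
      (R k h).err N (futLen H m h) l) ≤ B := fun h =>
    sum_listSum_weight_err_le hK hM hN hm hmH hα (Rs h) (fun k => R k h) π (hn h) hy hA hα' hΓ0 hΓ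
  have hα0 : 0 ≤ 1 / α := by positivity
  calc ∑ k, lawDist (M k) N H (π k)
      ≤ ∑ k, (1 + 1 / α) * (l1 ((M k).pred m [] - N.pred m []) +
          ∑ h : Fin (H - m + 1), listSum (h : ℕ) fun l =>
            (π k).listWeight [] l * (R k h).err N (futLen H m h) l) :=
        Finset.sum_le_sum fun k _ => lawDist_le (hM k) hN hm hmH hα (R k) (π k)
    _ = (1 + 1 / α) * (∑ k, l1 ((M k).pred m [] - N.pred m []) +
          ∑ h : Fin (H - m + 1), ∑ k, listSum (h : ℕ) fun l =>
            (π k).listWeight [] l * (R k h).err N (futLen H m h) l) := by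
        rw [← Finset.mul_sum, Finset.sum_add_distrib, Finset.sum_comm (γ := Fin (H - m + 1))]
    _ ≤ (1 + 1 / α) * (B + (H : ℝ) * B) := by
        refine mul_le_mul_of_nonneg_left (add_le_add h0 ?_) (by positivity)
        refine (Finset.sum_le_sum fun h _ => h1 h).trans ?_
        rw [Finset.sum_const, Finset.card_univ, Fintype.card_fin, nsmul_eq_mul]
        refine mul_le_mul_of_nonneg_right ?_ hB0
        exact_mod_cast (by omega : H - m + 1 ≤ H)
    _ ≤ (2 * y) * (2 * y * B) := by
        refine mul_le_mul (by linarith) ?_ (by positivity) (by positivity)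
        rw [← one_add_mul]
        exact mul_le_mul_of_nonneg_right (by linarith) hB0
    _ = _ := by rw [hB]; ring

end

/-! ### Values -/

section

variable {S O A : Type*} [Fintype S] [Fintype O] [Fintype A] {M N : POMDP S O A} {H m K : ℕ}
  {d₁ d₂ d₃ d₄ d₅ : ℕ} {Φ : Features S O A d₁ d₂ d₃ d₄ d₅} {r : ℕ → O → A → ℝ}

lemma sum_reward_mem (hr : ∀ h ∈ Finset.Icc 1 H, ∀ o a, 0 ≤ r h o a ∧ r h o a ≤ 1)
    (τ : Traj O A H) : 0 ≤ ∑ i : Fin H, r ((i : ℕ) + 1) (τ i).1 (τ i).2 ∧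
      ∑ i : Fin H, r ((i : ℕ) + 1) (τ i).1 (τ i).2 ≤ H := by
  have h : ∀ i : Fin H, 0 ≤ r ((i : ℕ) + 1) (τ i).1 (τ i).2 ∧
      r ((i : ℕ) + 1) (τ i).1 (τ i).2 ≤ 1 := fun i =>
    hr _ (Finset.mem_Icc.2 ⟨by omega, by omega⟩) _ _
  refine ⟨Finset.sum_nonneg fun i _ => (h i).1, (Finset.sum_le_sum fun i _ => (h i).2).trans ?_⟩
  simp

lemma value_nonneg (hM : M.IsValid H)
    (hr : ∀ h ∈ Finset.Icc 1 H, ∀ o a, 0 ≤ r h o a ∧ r h o a ≤ 1) (π : Policy O A) :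
    0 ≤ value M H r π :=
  Finset.sum_nonneg fun τ _ => mul_nonneg (trajProb_nonneg hM π τ) (sum_reward_mem hr τ).1

lemma value_le (hM : M.IsValid H)
    (hr : ∀ h ∈ Finset.Icc 1 H, ∀ o a, 0 ≤ r h o a ∧ r h o a ≤ 1) (π : Policy O A) :
    value M H r π ≤ H := by
  calc value M H r π ≤ ∑ τ : Traj O A H, trajProb M π τ * H :=
        Finset.sum_le_sum fun τ _ =>
          mul_le_mul_of_nonneg_left (sum_reward_mem hr τ).2 (trajProb_nonneg hM π τ)
    _ = H := by rw [← Finset.sum_mul, sum_trajProb hM, one_mul]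

lemma value_sub_le [Nonempty A] (hr : ∀ h ∈ Finset.Icc 1 H, ∀ o a, 0 ≤ r h o a ∧ r h o a ≤ 1)
    (π : Policy O A) : value M H r π - value N H r π ≤ H * lawDist M N H π := by
  rw [value, value, expReturn, expReturn, ← Finset.sum_sub_distrib, lawDist_eq, Finset.mul_sum]
  refine Finset.sum_le_sum fun τ _ => ?_
  obtain ⟨h0, h1⟩ := sum_reward_mem hr τ
  rw [← sub_mul, mul_comm]
  exact (mul_le_mul_of_nonneg_left (le_abs_self _) h0).trans
    (mul_le_mul_of_nonneg_right h1 (abs_nonneg _))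

lemma mixtureValue_eq (M : POMDP S O A) (H : ℕ) (r : ℕ → O → A → ℝ) (L : List (Policy O A)) :
    mixtureValue M H r L = (L.map (value M H r)).sum / L.length := by
  have h : ∀ L : List (Policy O A), ∑ τ : Traj O A H, (L.map fun π => trajProb M π τ).sum *
      ∑ i : Fin H, r ((i : ℕ) + 1) (τ i).1 (τ i).2 = (L.map (value M H r)).sum := by
    intro L
    induction L with
    | nil => simp
    | cons π L ih =>
      simp only [List.map_cons, List.sum_cons, add_mul, Finset.sum_add_distrib, ih]
      rfl
  rw [mixtureValue, expReturn, ← h, Finset.sum_div]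
  exact Finset.sum_congr rfl fun τ _ => by rw [div_mul_eq_mul_div]

lemma sum_map_range (n : ℕ) (f : ℕ → ℝ) :
    ((List.range n).map f).sum = ∑ i ∈ Finset.range n, f i := by
  induction n with
  | zero => simp
  | succ n ih => rw [List.range_succ, Finset.sum_range_succ, ← ih]; simp

lemma sum_fin_lt (f : ℕ → ℝ) (k : Fin K) :
    ∑ k' : Fin K with k' < k, f k' = ∑ i ∈ Finset.range k, f i := by
  have h := Finset.sum_range (n := K) fun i => if i < (k : ℕ) then f i else 0
  rw [Finset.sum_filter]
  simp only [← Fin.val_fin_lt] at *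
  rw [← h, ← Finset.sum_filter]
  congr 1
  ext i
  simp only [Finset.mem_filter, Finset.mem_range]
  omega

lemma mixtureValue_records_eq (plan : Planner O A d₁ d₂ d₃ d₄ d₅ H m)
    (bs : List (Batch O A H m)) (hbs : bs.length = K) :
    mixtureValue M H r ((records plan [] bs).map Prod.fst) =
      (∑ k : Fin K, value M H r (plan (records plan [] (bs.take k))).2) / K := by
  rw [mixtureValue_eq, map_fst_records, List.map_map, sum_map_range, hbs, Finset.sum_range]
  simp

lemma length_records (plan : Planner O A d₁ d₂ d₃ d₄ d₅ H m) (bs : List (Batch O A H m)) :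
    (records plan [] bs).length = bs.length := by
  have := congrArg List.length (map_fst_records plan bs)
  simpa using this

lemma dataSum_records_eq [Nonempty A] (plan : Planner O A d₁ d₂ d₃ d₄ d₅ H m)
    (z : Policy O A → ℝ) (bs : List (Batch O A H m)) (k : Fin K) (hbs : bs.length = K) :
    dataSum z (records plan [] (bs.take k)) = ∑ k' : Fin K with k' < k,
      ∑ i : Index A H m,
        z ((plan (records plan [] (bs.take k'))).2.explore i.1 i.2) := by
  rw [sum_fin_lt fun k' => ∑ i : Index A H m,
        z ((plan (records plan [] (bs.take k'))).2.explore i.1 i.2), ← sum_map_range]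
  have h := map_fst_records plan (bs.take k)
  have hd : dataSum z (records plan [] (bs.take k)) =
      (((records plan [] (bs.take k)).map Prod.fst).map fun π =>
        ∑ i : Index A H m, z (π.explore i.1 i.2)).sum := by
    rw [List.map_map]; rfl
  rw [hd, h, List.map_map, List.length_take, min_eq_left (by omega)]
  congr 1
  refine List.map_congr_left fun j hj => ?_
  have hj' := List.mem_range.1 hj
  simp only [Function.comp_apply]
  rw [List.take_take, min_eq_left hj'.le]

/-! ### Upper brackets -/

/-- The upper ends of a bracket, where those which lie above no model of the class are replaced by
`0`. Then all of them are nonnegative with total mass at most `1 + ε`. -/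
lemma exists_upper_bracket {F : Set (LinParam d₁ d₂ d₃ d₄ d₅)} {ε : ℝ}
    (hF : ∀ f ∈ F, (Φ.model f).IsValid H) (hε : 0 ≤ ε) {n : ℕ}
    {g₁ g₂ : Fin n → Policy O A → Traj O A H → ℝ} (hg : IsBracket Φ H F ε g₁ g₂) :
    ∃ g : Fin n → Policy O A → Traj O A H → ℝ, (∀ i π τ, 0 ≤ g i π τ) ∧
      (∀ i π, ∑ τ, g i π τ ≤ 1 + ε) ∧ ∀ f ∈ F, ∃ i,
        (∀ π τ, trajProb (Φ.model f) π τ ≤ g i π τ) ∧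
          ∀ π, ∑ τ, (g i π τ - trajProb (Φ.model f) π τ) ≤ ε := by
  classical
  let good : Fin n → Prop := fun i => ∃ f ∈ F, ∀ π τ, g₁ i π τ ≤ trajProb (Φ.model f) π τ ∧
    trajProb (Φ.model f) π τ ≤ g₂ i π τ
  have hdiff : ∀ f ∈ F, ∀ i, (∀ π τ, g₁ i π τ ≤ trajProb (Φ.model f) π τ ∧
      trajProb (Φ.model f) π τ ≤ g₂ i π τ) → ∀ π,
      ∑ τ, (g₂ i π τ - trajProb (Φ.model f) π τ) ≤ ε := by
    intro f _ i hi π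
    refine (Finset.sum_le_sum fun τ _ => ?_).trans (hg.1 i π)
    rw [abs_sub_comm]
    exact (by linarith [(hi π τ).1] : _ ≤ g₂ i π τ - g₁ i π τ).trans (le_abs_self _)
  refine ⟨fun i π τ => if good i then g₂ i π τ else 0, fun i π τ => ?_, fun i π => ?_,
    fun f hf => ?_⟩
  · dsimp only
    split_ifs with h
    · obtain ⟨f, hf, hi⟩ := h
      exact (trajProb_nonneg (hF f hf) π τ).trans (hi π τ).2
    · exact le_rfl
  · dsimp only
    split_ifs with h
    · obtain ⟨f, hf, hi⟩ := h
      have h1 := hdiff f hf i hi π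
      rw [Finset.sum_sub_distrib, sum_trajProb (hF f hf)] at h1
      linarith
    · simp only [Finset.sum_const_zero]; linarith
  · obtain ⟨i, hi⟩ := hg.2 f hf
    have hgood : good i := ⟨f, hf, hi⟩
    exact ⟨i, fun π τ => by simpa [hgood] using (hi π τ).2, fun π => by
      simpa [hgood] using hdiff f hf i hi π⟩

/-! ### Numerical bounds -/

section Numerics

variable [Nonempty A] {y δ ε : ℝ} {F : Set (LinParam d₁ d₂ d₃ d₄ d₅)}
  {fstar : LinParam d₁ d₂ d₃ d₄ d₅}

lemma le_exp_self (x : ℝ) : x ≤ Real.exp x := by linarith [Real.add_one_le_exp x]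

lemma card_obs_pos (hM : M.IsValid H) (hH : 1 ≤ H) : 0 < Fintype.card O := by
  by_contra h0
  have hO : IsEmpty O := Fintype.card_eq_zero_iff.1 (by omega)
  obtain ⟨s⟩ : Nonempty S := by
    by_contra hS
    rw [not_nonempty_iff] at hS
    exact absurd hM.1.2 (by simp)
  have := ((hM.2 1 (Finset.mem_Icc.2 ⟨le_rfl, hH⟩)).2 s).2
  simp at this

/-- The number `K H |A|^(m-1)`, which bounds the number of collected trajectories. -/
def dataSize (A : Type*) [Fintype A] (H m K : ℕ) : ℝ :=
  K * H * (Fintype.card A : ℝ) ^ (m - 1)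

lemma one_le_dataSize (hK : 1 ≤ K) (hH : 1 ≤ H) : 1 ≤ dataSize A H m K := by
  have h1 : (1 : ℝ) ≤ K := by exact_mod_cast hK
  have h2 : (1 : ℝ) ≤ H := by exact_mod_cast hH
  exact one_le_mul_of_one_le_of_one_le (one_le_mul_of_one_le_of_one_le h1 h2)
    (one_le_card_pow A _)

lemma card_pow_pred_le (hA : (Fintype.card A : ℝ) ^ m ≤ y) :
    (Fintype.card A : ℝ) ^ (m - 1) ≤ y :=
  le_trans (pow_le_pow_right₀ (by exact_mod_cast Fintype.card_pos) (by omega)) hA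

lemma dataSize_le (hK : 1 ≤ K) (hA : (Fintype.card A : ℝ) ^ m ≤ y) (hH : (H : ℝ) ≤ y) :
    dataSize A H m K ≤ Real.exp (Real.log K + 2 * y) := by
  have hK' : (0 : ℝ) < K := by exact_mod_cast hK
  rw [dataSize, Real.exp_add, Real.exp_log hK', two_mul, Real.exp_add, mul_assoc]
  have h1 := le_exp_self y
  refine mul_le_mul_of_nonneg_left (mul_le_mul (hH.trans h1) ((card_pow_pred_le hA).trans h1)
    (by positivity) (by positivity)) hK'.le

lemma card_obs_mul_card_act_pow_le (hO : 0 < Fintype.card O) (hm : 1 ≤ m)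
    (hA : (Fintype.card A : ℝ) ^ m ≤ y)
    (hH : (H : ℝ) ≤ y) (hlogO : Real.log (Fintype.card O) ≤ y) :
    ((Fintype.card O * Fintype.card A : ℕ) : ℝ) ^ H ≤ Real.exp (2 * y ^ 2) := by
  have hO' : (0 : ℝ) < Fintype.card O := by exact_mod_cast hO
  have h1 : (Fintype.card O : ℝ) ≤ Real.exp y := by
    rw [← Real.log_le_iff_le_exp hO']; exact hlogO
  have h2 : (Fintype.card A : ℝ) ≤ Real.exp y := by
    refine le_trans ?_ (hA.trans (le_exp_self y))
    simpa using pow_le_pow_right₀ (show (1 : ℝ) ≤ Fintype.card A by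
      exact_mod_cast Fintype.card_pos) hm
  have h3 : ((Fintype.card O * Fintype.card A : ℕ) : ℝ) ≤ Real.exp (2 * y) := by
    push_cast
    rw [two_mul, Real.exp_add]
    exact mul_le_mul h1 h2 (Nat.cast_nonneg _) (Real.exp_pos _).le
  calc _ ≤ Real.exp (2 * y) ^ H := pow_le_pow_left₀ (Nat.cast_nonneg _) h3 H
    _ = Real.exp (H * (2 * y)) := (Real.exp_nat_mul _ _).symm
    _ ≤ _ := Real.exp_le_exp.2 (by nlinarith)

/-- The class has a bracket of size polynomial, on the logarithmic scale, in the parameters of the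
problem. The number of states enters through its logarithm only, and weak revealing bounds this by
the logarithms of the numbers of observations and actions. -/
lemma exists_isBracket_le (hΦ : Φ.IsBounded H)
    (hF : ∀ f ∈ F, f.IsBounded H ∧ (Φ.model f).IsValid H) (hstar : fstar ∈ F)
    (hW : (Φ.model fstar).IsWeaklyRevealing H m) (hm : 1 ≤ m) (hmH : m ≤ H) (hK : 1 ≤ K)
    (hy : 1 ≤ y) (hd : (linDim d₁ d₂ d₃ d₄ d₅ : ℝ) ≤ y) (hA : (Fintype.card A : ℝ) ^ m ≤ y)
    (hH : (H : ℝ) ≤ y) (hlogO : Real.log (Fintype.card O) ≤ y) :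
    ∃ n : ℕ, (n : ℝ) ≤ Real.exp (39 * y ^ 5 * (1 + Real.log K)) ∧
      ∃ g₁ g₂ : Fin n → Policy O A → Traj O A H → ℝ,
        IsBracket Φ H F (1 / dataSize A H m K) g₁ g₂ := by
  have hvalid := (hF fstar hstar).2
  have hH1 : 1 ≤ H := hm.trans hmH
  have hO := card_obs_pos hvalid hH1
  have hd1 := one_le_linDim hvalid
  set d := linDim d₁ d₂ d₃ d₄ d₅ with hdef
  set D := dataSize A H m K with hD
  have hD1 : 1 ≤ D := one_le_dataSize hK hH1
  have hK' : (1 : ℝ) ≤ K := by exact_mod_cast hK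
  have hL0 : 0 ≤ Real.log K := Real.log_nonneg hK'
  have hOA1 : 1 ≤ Fintype.card O * Fintype.card A := Nat.mul_pos hO Fintype.card_pos
  have hOA1' : (1 : ℝ) ≤ ((Fintype.card O * Fintype.card A : ℕ) : ℝ) := by exact_mod_cast hOA1
  have hOA := card_obs_mul_card_act_pow_le hO hm hA hH hlogO
  have hS : (1 + Fintype.card S : ℝ) ≤ Real.exp (1 + 2 * y ^ 2) := by
    have h1 : Fintype.card S ≤ (Fintype.card O * Fintype.card A) ^ H := by
      refine (card_state_le hW).trans ?_
      calc _ ≤ (Fintype.card O * Fintype.card A) ^ (m - 1) * (Fintype.card O * Fintype.card A) :=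
            Nat.mul_le_mul le_rfl (Nat.le_mul_of_pos_right _ Fintype.card_pos)
        _ = (Fintype.card O * Fintype.card A) ^ (m - 1 + 1) := (pow_succ _ _).symm
        _ ≤ _ := Nat.pow_le_pow_right hOA1 (by omega)
    have h2 : (Fintype.card S : ℝ) ≤ ((Fintype.card O * Fintype.card A : ℕ) : ℝ) ^ H := by
      exact_mod_cast h1
    have h3 : (1 : ℝ) ≤ Real.exp (2 * y ^ 2) := Real.one_le_exp (by positivity)
    have h4 : (2 : ℝ) ≤ Real.exp 1 := by linarith [Real.exp_one_gt_d9]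
    rw [Real.exp_add]
    nlinarith
  set X : ℝ := ((Fintype.card O * Fintype.card A : ℕ) : ℝ) ^ H *
    (2 * ((1 + H) * ((1 + Fintype.card S) * (d : ℝ) ^ 2))) * D with hX
  have hd1' : (1 : ℝ) ≤ d := by exact_mod_cast hd1
  have hX1 : 1 ≤ X := by
    have h1 : (1 : ℝ) ≤ ((Fintype.card O * Fintype.card A : ℕ) : ℝ) ^ H := one_le_pow₀ hOA1'
    have h2 : (1 : ℝ) ≤ 1 + H := by simp
    have h3 : (1 : ℝ) ≤ 1 + Fintype.card S := by simp
    have h4 : (1 : ℝ) ≤ (d : ℝ) ^ 2 := one_le_pow₀ hd1'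
    exact one_le_mul_of_one_le_of_one_le (one_le_mul_of_one_le_of_one_le h1
      (one_le_mul_of_one_le_of_one_le one_le_two (one_le_mul_of_one_le_of_one_le h2
        (one_le_mul_of_one_le_of_one_le h3 h4)))) hD1
  have hXle : X ≤ Real.exp (2 * y ^ 2) *
      (Real.exp 1 * (Real.exp y * (Real.exp (1 + 2 * y ^ 2) * Real.exp (2 * y)))) *
        Real.exp (Real.log K + 2 * y) := by
    have h1 : (2 : ℝ) ≤ Real.exp 1 := by linarith [Real.exp_one_gt_d9]
    have h2 : (1 + H : ℝ) ≤ Real.exp y := by linarith [Real.add_one_le_exp y]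
    have h3 : (d : ℝ) ^ 2 ≤ Real.exp (2 * y) := by
      rw [two_mul, Real.exp_add, ← pow_two]
      exact pow_le_pow_left₀ (Nat.cast_nonneg _) (hd.trans (le_exp_self y)) 2
    have h4 := dataSize_le (A := A) (m := m) hK hA hH
    rw [hX]
    gcongr
  have h5X : 5 * X ≤ Real.exp (13 * y ^ 2 * (1 + Real.log K)) := by
    have h5 : (5 : ℝ) ≤ Real.exp 2 := by
      rw [show (2 : ℝ) = 1 + 1 by norm_num, Real.exp_add]
      nlinarith [Real.exp_one_gt_d9]
    calc 5 * X ≤ Real.exp 2 * (Real.exp (2 * y ^ 2) *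
          (Real.exp 1 * (Real.exp y * (Real.exp (1 + 2 * y ^ 2) * Real.exp (2 * y)))) *
            Real.exp (Real.log K + 2 * y)) := mul_le_mul h5 hXle (by linarith) (by positivity)
      _ = Real.exp (4 * y ^ 2 + 5 * y + 4 + Real.log K) := by
          simp only [← Real.exp_add]; congr 1; ring
      _ ≤ _ := by
          refine Real.exp_le_exp.2 ?_
          have hy2 : 1 ≤ y ^ 2 := one_le_pow₀ hy
          nlinarith [mul_le_mul_of_nonneg_right hy2 hL0]
  set T := ⌈X⌉₊ with hT
  have hT0 : 0 < T := Nat.ceil_pos.2 (by linarith)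
  have hT0' : (0 : ℝ) < T := by exact_mod_cast hT0
  have hXT : X ≤ T := Nat.le_ceil X
  have hTX : ((2 * T + 1 : ℕ) : ℝ) ≤ 5 * X := by
    have := Nat.ceil_lt_add_one (show 0 ≤ X by linarith)
    push_cast
    linarith
  refine ⟨_, ?_, exists_isBracket hΦ hF hT0 ?_⟩
  · have hcard := card_paramGrid_le (d₁ := d₁) (d₂ := d₂) (d₃ := d₃) (d₄ := d₄) (d₅ := d₅)
      hdef.ge hd1 hH1 T
    calc ((Fintype.card (ParamGrid d₁ d₂ d₃ d₄ d₅ H T) : ℕ) : ℝ)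
        ≤ ((2 * T + 1 : ℕ) : ℝ) ^ (3 * (H * d ^ 2)) := by exact_mod_cast hcard
      _ ≤ Real.exp (13 * y ^ 2 * (1 + Real.log K)) ^ (3 * (H * d ^ 2)) :=
          pow_le_pow_left₀ (Nat.cast_nonneg _) (hTX.trans h5X) _
      _ = Real.exp (((3 * (H * d ^ 2) : ℕ) : ℝ) * (13 * y ^ 2 * (1 + Real.log K))) :=
          (Real.exp_nat_mul _ _).symm
      _ ≤ _ := by
          refine Real.exp_le_exp.2 ?_
          push_cast
          have h1 : (H : ℝ) * (d : ℝ) ^ 2 ≤ y * y ^ 2 := by gcongr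
          have h2 : 0 ≤ 13 * y ^ 2 * (1 + Real.log K) := by positivity
          calc 3 * ((H : ℝ) * (d : ℝ) ^ 2) * (13 * y ^ 2 * (1 + Real.log K))
              ≤ 3 * (y * y ^ 2) * (13 * y ^ 2 * (1 + Real.log K)) := by gcongr
            _ = _ := by ring
  · rw [le_div_iff₀ (by linarith)]
    calc _ = X / T := by rw [hX]; ring
      _ ≤ 1 := (div_le_one hT0').2 hXT

/-- The slackness `β` of the algorithm is nonnegative and grows polynomially in `y` and `log K`. The
equation for its exponential makes the probability of an atypical run small. -/
lemma slackness_bounds (hΦ : Φ.IsBounded H)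
    (hF : ∀ f ∈ F, f.IsBounded H ∧ (Φ.model f).IsValid H) (hstar : fstar ∈ F)
    (hW : (Φ.model fstar).IsWeaklyRevealing H m) (hm : 1 ≤ m) (hmH : m ≤ H) (hK : 1 ≤ K)
    (hδ : 0 < δ) (hδ1 : δ ≤ 1)
    (hy : 1 ≤ y) (hd : (linDim d₁ d₂ d₃ d₄ d₅ : ℝ) ≤ y) (hA : (Fintype.card A : ℝ) ^ m ≤ y)
    (hH : (H : ℝ) ≤ y) (hlogO : Real.log (Fintype.card O) ≤ y) (hlogδ : Real.log (1 / δ) ≤ y) :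
    ∃ (n : ℕ) (g₁ g₂ : Fin n → Policy O A → Traj O A H → ℝ),
      IsBracket Φ H F (1 / dataSize A H m K) g₁ g₂ ∧
      Real.exp (slackness 1 Φ H m K F δ) = n * dataSize A H m K / δ ∧
      0 ≤ slackness 1 Φ H m K F δ ∧
      slackness 1 Φ H m K F δ ≤ 43 * y ^ 5 * (1 + Real.log K) := by
  obtain ⟨n₀, hn₀, hbr₀⟩ := exists_isBracket_le hΦ hF hstar hW hm hmH hK hy hd hA hH hlogO
  set n := bracketNumber Φ H F (1 / dataSize A H m K) with hn
  obtain ⟨g₁, g₂, hg⟩ : ∃ g₁ g₂ : Fin n → Policy O A → Traj O A H → ℝ,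
      IsBracket Φ H F (1 / dataSize A H m K) g₁ g₂ :=
    Nat.sInf_mem (s := {N | ∃ g₁ g₂ : Fin N → Policy O A → Traj O A H → ℝ,
      IsBracket Φ H F (1 / dataSize A H m K) g₁ g₂}) ⟨n₀, hbr₀⟩
  have hnle : n ≤ n₀ := Nat.sInf_le hbr₀
  have hn1 : 1 ≤ n := by
    obtain ⟨i, _⟩ := hg.2 fstar hstar
    exact Nat.one_le_iff_ne_zero.2 fun h => (h ▸ i).elim0
  have hD1 : 1 ≤ dataSize A H m K := one_le_dataSize hK (hm.trans hmH)
  have hn1' : (1 : ℝ) ≤ n := by exact_mod_cast hn1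
  have hK' : (1 : ℝ) ≤ K := by exact_mod_cast hK
  have hL0 : 0 ≤ Real.log K := Real.log_nonneg hK'
  have hval : slackness 1 Φ H m K F δ = Real.log (n * dataSize A H m K / δ) := one_mul _
  have hge : 1 ≤ n * dataSize A H m K / δ := by
    rw [le_div_iff₀ hδ]
    nlinarith
  refine ⟨n, g₁, g₂, hg, ?_, ?_, ?_⟩
  · rw [hval, Real.exp_log (by linarith)]
  · rw [hval]; exact Real.log_nonneg hge
  · rw [hval, Real.log_le_iff_le_exp (by linarith)]
    have h1 : (n : ℝ) ≤ Real.exp (39 * y ^ 5 * (1 + Real.log K)) :=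
      le_trans (by exact_mod_cast hnle) hn₀
    have h2 := dataSize_le (A := A) (m := m) hK hA hH
    have h3 : 1 / δ ≤ Real.exp y := by
      rw [← Real.log_le_iff_le_exp (by positivity)]; exact hlogδ
    calc n * dataSize A H m K / δ = n * dataSize A H m K * (1 / δ) := by ring
      _ ≤ Real.exp (39 * y ^ 5 * (1 + Real.log K)) * Real.exp (Real.log K + 2 * y) *
          Real.exp y := by gcongr
      _ = Real.exp (39 * y ^ 5 * (1 + Real.log K) + (Real.log K + 2 * y) + y) := by
          simp only [← Real.exp_add]
      _ ≤ _ := by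
          refine Real.exp_le_exp.2 ?_
          have e1 : y ≤ y ^ 5 := by simpa using pow_le_pow_right₀ hy (show 1 ≤ 5 by norm_num)
          have e2 : 1 ≤ y ^ 5 := one_le_pow₀ hy
          nlinarith [mul_le_mul_of_nonneg_right e2 hL0]

/-- The number of iterations beats its own logarithm. -/
lemma log_sq_div_sqrt_le {k : ℝ} (hk : 1 ≤ k) (hy : 1 ≤ y) (hε : 0 < ε)
    (hlogε : Real.log (1 + 1 / ε) ≤ y) (hP : 1 / ε ^ 2 * (10 ^ 9 * y ^ 20) ^ 4 ≤ k) :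
    10 ^ 6 * y ^ 18 * (1 + Real.log k) ^ 2 ≤ ε * √k := by
  set z := ε ^ 2 * k with hz
  have hzP : (10 ^ 9 * y ^ 20) ^ 4 ≤ z := by
    rw [one_div, inv_mul_le_iff₀ (by positivity)] at hP
    exact hP
  have hQ1 : (1 : ℝ) ≤ 10 ^ 9 * y ^ 20 := by
    have : 1 ≤ y ^ 20 := one_le_pow₀ hy
    linarith
  have hz1 : 1 ≤ z := (one_le_pow₀ hQ1).trans hzP
  -- With the eighth root `s` of `z = ε² k`, the logarithm of `k` is at most linear in `s`, so that
  -- its square is absorbed by half of the four factors in `ε √k = s ^ 4`.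
  set s := √(√(√z)) with hs
  have hs0 : 0 ≤ s := Real.sqrt_nonneg _
  have hs4 : s ^ 4 = √z := by
    rw [show s ^ 4 = (s ^ 2) ^ 2 by ring, hs, Real.sq_sqrt (Real.sqrt_nonneg _),
      Real.sq_sqrt (Real.sqrt_nonneg _)]
  have hs8 : s ^ 8 = z := by
    rw [show s ^ 8 = (s ^ 4) ^ 2 by ring, hs4, Real.sq_sqrt (by linarith)]
  have hs1 : 1 ≤ s := by
    by_contra hlt
    push Not at hlt
    have : s ^ 8 < 1 := pow_lt_one₀ hs0 hlt (by norm_num)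
    linarith
  have hs2 : 10 ^ 9 * y ^ 20 ≤ s ^ 2 := by
    rw [← hs8, show s ^ 8 = (s ^ 2) ^ 4 by ring] at hzP
    exact le_of_pow_le_pow_left₀ (by norm_num) (by positivity) hzP
  have hlogk : Real.log k ≤ 8 * (s - 1) + 2 * y := by
    have hkz : k = z * (1 / ε) ^ 2 := by rw [hz]; field_simp
    have h1 : Real.log z ≤ 8 * (s - 1) := by
      rw [← hs8, Real.log_pow]
      have := Real.log_le_sub_one_of_pos (show 0 < s by linarith)
      push_cast
      linarith
    have h2 : Real.log (1 / ε) ≤ y := by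
      refine le_trans (Real.log_le_log (by positivity) ?_) hlogε
      linarith
    rw [hkz, Real.log_mul (by linarith) (by positivity), Real.log_pow]
    push_cast
    linarith
  have hL0 : 0 ≤ Real.log k := Real.log_nonneg hk
  have hL : 1 + Real.log k ≤ 10 * y * s := by nlinarith
  have hsk : ε * √k = s ^ 4 := by
    rw [hs4, hz, Real.sqrt_mul (sq_nonneg ε), Real.sqrt_sq hε.le]
  rw [hsk]
  calc 10 ^ 6 * y ^ 18 * (1 + Real.log k) ^ 2 ≤ 10 ^ 6 * y ^ 18 * (10 * y * s) ^ 2 := by gcongr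
    _ = (10 ^ 8 * y ^ 20) * s ^ 2 := by ring
    _ ≤ s ^ 2 * s ^ 2 := by
        refine mul_le_mul_of_nonneg_right ?_ (by positivity)
        refine le_trans ?_ hs2
        have : 0 ≤ y ^ 20 := by positivity
        linarith
    _ = s ^ 4 := by ring

lemma card_index_le (hm : 1 ≤ m) (hmH : m ≤ H) :
    (Fintype.card (Index A H m) : ℝ) ≤ H * (Fintype.card A : ℝ) ^ (m - 1) := by
  have h1 : Fintype.card (Index A H m) = (H - m + 1) * Fintype.card A ^ (m - 1) := by
    simp [Fintype.card_prod]
  rw [h1]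
  push_cast
  refine mul_le_mul_of_nonneg_right ?_ (by positivity)
  exact_mod_cast (by omega : H - m + 1 ≤ H)

end Numerics

/-! ### The guarantee of the algorithm -/

section Run

variable [Nonempty A] {α y ε : ℝ} {F : Set (LinParam d₁ d₂ d₃ d₄ d₅)}
  {fstar : LinParam d₁ d₂ d₃ d₄ d₅}

/-- By the Cauchy–Schwarz inequality, a bound on the sum of the squared distances on the data bounds
the sum of the distances. -/
lemma sum_dataDist_le {n : ℕ} (s : Finset (Fin n)) (hn : n ≤ K) (π : Fin n → Policy O A) {B : ℝ}
    (hB : ∑ k ∈ s, ∑ i : Index A H m, lawDist M N H ((π k).explore i.1 i.2) ^ 2 ≤ B) :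
    (∑ k ∈ s, dataDist M N H m (π k)) ^ 2 ≤ K * Fintype.card (Index A H m) * B := by
  have h1 : ∑ k ∈ s, dataDist M N H m (π k) =
      ∑ p ∈ s ×ˢ (Finset.univ : Finset (Index A H m)),
        lawDist M N H ((π p.1).explore p.2.1 p.2.2) := by
    rw [Finset.sum_product]; rfl
  have h2 : ∑ k ∈ s, ∑ i : Index A H m, lawDist M N H ((π k).explore i.1 i.2) ^ 2 =
      ∑ p ∈ s ×ˢ (Finset.univ : Finset (Index A H m)),
        lawDist M N H ((π p.1).explore p.2.1 p.2.2) ^ 2 := by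
    rw [Finset.sum_product]
  rw [h1]
  refine sq_sum_le_card_mul_sum_sq.trans ?_
  rw [← h2, Finset.card_product, Finset.card_univ]
  have hs : s.card ≤ K := (Finset.card_le_univ s).trans (by simpa using hn)
  have hs' : (s.card : ℝ) ≤ K := by exact_mod_cast hs
  push_cast
  have h0 : 0 ≤ ∑ k ∈ s, ∑ i : Index A H m, lawDist M N H ((π k).explore i.1 i.2) ^ 2 :=
    Finset.sum_nonneg fun _ _ => Finset.sum_nonneg fun _ _ => sq_nonneg _
  gcongr

/-- The bound on the sum of the errors in terms of the number of iterations. -/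
lemma regret_numerics {k Γ β : ℝ} (hk : 1 ≤ k) (hy : 1 ≤ y)
    (hβ1 : β ≤ 43 * y ^ 5 * (1 + Real.log k)) (hΓ : Γ = 1562 * √k * y ^ 6 * (1 + Real.log k))
    (hε : 10 ^ 6 * y ^ 18 * (1 + Real.log k) ^ 2 ≤ ε * √k) :
    k * y ^ 2 * (36 * β + 14) ≤ Γ ^ 2 ∧
      y * (256 * y ^ 10 * (1 + Γ) * Real.log (y + k)) ≤ ε * k := by
  have hk0 : 0 ≤ k := by linarith
  have hy0 : 0 ≤ y := by linarith
  set Λ := 1 + Real.log k with hΛ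
  have hL0 : 0 ≤ Real.log k := Real.log_nonneg hk
  have hΛ1 : 1 ≤ Λ := by linarith
  have hsk : √k ^ 2 = k := Real.sq_sqrt hk0
  have hsk1 : 1 ≤ √k := by rw [Real.one_le_sqrt]; exact hk
  constructor
  · -- Here `1562 = 36 * 43 + 14`.
    have h5 : 1 ≤ y ^ 5 * Λ := one_le_mul_of_one_le_of_one_le (one_le_pow₀ hy) hΛ1
    have h1 : 36 * β + 14 ≤ 1562 * (y ^ 5 * Λ) := by nlinarith
    have h2 : Γ ^ 2 = k * (1562 ^ 2 * (y ^ 12 * Λ ^ 2)) := by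
      rw [hΓ, ← hsk, Real.sqrt_sq (by positivity)]; ring
    rw [h2, mul_assoc]
    refine mul_le_mul_of_nonneg_left ?_ hk0
    have h3 : y ^ 2 * (1562 * (y ^ 5 * Λ)) ≤ 1562 ^ 2 * (y ^ 12 * Λ ^ 2) := by
      have e1 : y ^ 7 ≤ y ^ 12 := pow_le_pow_right₀ hy (by norm_num)
      have e2 : Λ ≤ Λ ^ 2 := by nlinarith
      have e3 : y ^ 7 * Λ ≤ y ^ 12 * Λ ^ 2 := mul_le_mul e1 e2 (by linarith) (by positivity)
      have e4 : 0 ≤ y ^ 7 * Λ := by positivity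
      calc y ^ 2 * (1562 * (y ^ 5 * Λ)) = 1562 * (y ^ 7 * Λ) := by ring
        _ ≤ 1562 ^ 2 * (y ^ 12 * Λ ^ 2) := by linarith
    exact (mul_le_mul_of_nonneg_left h1 (by positivity)).trans h3
  · have hlog : Real.log (y + k) ≤ 2 * y * Λ := by
      have h1 : Real.log (y + k) ≤ Real.log (2 * (y * k)) := by
        refine Real.log_le_log (by positivity) ?_
        nlinarith
      rw [Real.log_mul (by norm_num) (by positivity), Real.log_mul (by positivity)
        (by positivity)] at h1
      have h2 := Real.log_le_sub_one_of_pos (show (0 : ℝ) < 2 by norm_num)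
      have h3 := Real.log_le_sub_one_of_pos (show (0 : ℝ) < y by linarith)
      nlinarith
    have hΓ1 : 1 + Γ ≤ 1563 * √k * y ^ 6 * Λ := by
      have : 1 ≤ √k * (y ^ 6 * Λ) := one_le_mul_of_one_le_of_one_le hsk1
        (one_le_mul_of_one_le_of_one_le (one_le_pow₀ hy) hΛ1)
      rw [hΓ]
      linarith
    have hlog0 : 0 ≤ Real.log (y + k) := Real.log_nonneg (by linarith)
    calc y * (256 * y ^ 10 * (1 + Γ) * Real.log (y + k))
        ≤ y * (256 * y ^ 10 * (1563 * √k * y ^ 6 * Λ) * (2 * y * Λ)) := by gcongr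
      _ = 800256 * y ^ 18 * Λ ^ 2 * √k := by ring
      _ ≤ 10 ^ 6 * y ^ 18 * Λ ^ 2 * √k := by gcongr; norm_num
      _ ≤ ε * √k * √k := mul_le_mul_of_nonneg_right hε (by linarith)
      _ = ε * k := by rw [mul_assoc, Real.mul_self_sqrt hk0]

/-- On a run on which all data sets are typical, the output is nearly optimal. -/
theorem optValue_sub_le_mixtureValue {plan : Planner O A d₁ d₂ d₃ d₄ d₅ H m} {n : ℕ} {β η : ℝ}
    {g : Fin n → Policy O A → Traj O A H → ℝ} (hm : 1 ≤ m) (hmH : m ≤ H) (hα : 0 < α)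
    (hF : ∀ f ∈ F, Φ.IsAdmissible H m α f) (hstar : fstar ∈ F) (hK : 1 ≤ K)
    (hr : ∀ h ∈ Finset.Icc 1 H, ∀ o a, 0 ≤ r h o a ∧ r h o a ≤ 1)
    (hplan : IsCrane Φ F r β (Φ.model fstar) K plan)
    (hη : 0 ≤ η) (hη1 : η ≤ 1) (hηK : K * Fintype.card (Index A H m) * η ≤ 1)
    (hg1 : ∀ i π, ∑ τ, g i π τ ≤ 1 + η)
    (hgF : ∀ f ∈ F, ∃ i, (∀ π τ, trajProb (Φ.model f) π τ ≤ g i π τ) ∧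
      ∀ π, ∑ τ, (g i π τ - trajProb (Φ.model f) π τ) ≤ η)
    (hy : 1 ≤ y) (hd : (linDim d₁ d₂ d₃ d₄ d₅ : ℝ) ≤ y) (hA : (Fintype.card A : ℝ) ^ m ≤ y)
    (hα' : 1 / α ≤ y) (hH : (H : ℝ) ≤ y) (hβ0 : 0 ≤ β)
    (hβ1 : β ≤ 43 * y ^ 5 * (1 + Real.log K))
    (hε : 10 ^ 6 * y ^ 18 * (1 + Real.log K) ^ 2 ≤ ε * √K)
    (ω : Fin K → Batch O A H m) (hpos : 0 < likelihood (Φ.model fstar) (runData plan ω))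
    (htyp : ∀ k ≤ K, IsTypical (Φ.model fstar) β g (records plan [] ((List.ofFn ω).take k))) :
    optValue (Φ.model fstar) H r - ε ≤
      mixtureValue (Φ.model fstar) H r ((runData plan ω).map Prod.fst) := by
  have hvalid : ∀ f ∈ F, (Φ.model f).IsValid H := fun f hf => (hF f hf).2.1
  have hN := hvalid fstar hstar
  have hK' : (1 : ℝ) ≤ K := by exact_mod_cast hK
  set D : ℕ → List (Record O A H m) := fun k => records plan [] ((List.ofFn ω).take k) with hD
  have hDpos : ∀ k, 0 < likelihood (Φ.model fstar) (D k) := fun k =>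
    likelihood_take_pos hN plan _ k hpos
  let f : Fin K → LinParam d₁ d₂ d₃ d₄ d₅ := fun k => (plan (D k)).1
  let π : Fin K → Policy O A := fun k => (plan (D k)).2
  have hopt : ∀ k : Fin K, IsOptimistic Φ F r β (D k) (f k) (π k) := fun k =>
    hplan ((List.ofFn ω).take k) (by simp) (hDpos k)
  have hfF : ∀ k, f k ∈ F := fun k => (hopt k).1.1
  have hstarconf : ∀ k : Fin K, fstar ∈ confSet Φ F β (D k) := fun k =>
    (htyp k k.2.le).mem_confSet hvalid hstar fun f' hf' =>
      let ⟨i, hi⟩ := hgF f' hf'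
      ⟨i, hi.1⟩
  have hvalue : ∀ k, optValue (Φ.model fstar) H r ≤ value (Φ.model (f k)) H r (π k) := fun k =>
    ciSup_le fun π' => (hopt k).2 fstar (hstarconf k) π'
  have hsq : ∀ k : Fin K, ∑ k' with k' < k, ∑ i : Index A H m,
      lawDist (Φ.model (f k)) (Φ.model fstar) H ((π k').explore i.1 i.2) ^ 2 ≤ 36 * β + 14 := by
    intro k
    obtain ⟨i, hi1, hi2⟩ := hgF (f k) (hfF k)
    have h1 := (htyp k k.2.le).dataSum_lawDist_le hN (hvalid _ (hfF k)) i hη1 hi1 hi2 (hg1 i)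
      (by
        refine le_trans ?_ hηK
        have hlen : (records plan [] ((List.ofFn ω).take k)).length ≤ K := by
          rw [length_records]; simp
        gcongr) (hDpos k) ((hopt k).1.2 fstar hstar)
    rwa [dataSum_records_eq (K := K) plan _ (List.ofFn ω) k (by simp)] at h1
  set Γ : ℝ := 1562 * √K * y ^ 6 * (1 + Real.log K) with hΓ
  have hΓ0 : 0 ≤ Γ := by
    have := Real.log_nonneg hK'
    positivity
  obtain ⟨hnum1, hnum2⟩ := regret_numerics hK' hy hβ1 hΓ hε
  have hΓle : ∀ k : Fin K, ∑ k' with k' < k,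
      dataDist (Φ.model (f k)) (Φ.model fstar) H m (π k') ≤ Γ := by
    intro k
    have h1 := sum_dataDist_le (K := K) _ le_rfl π (hsq k)
    refine le_of_sq_le_sq ?_ hΓ0
    refine h1.trans (le_trans ?_ hnum1)
    have h2 : (Fintype.card (Index A H m) : ℝ) ≤ y ^ 2 := by
      refine (card_index_le hm hmH).trans ?_
      rw [pow_two]
      exact mul_le_mul hH (card_pow_pred_le hA) (by positivity) (by linarith)
    gcongr
  have hrep : ∀ f' ∈ F, ∀ h : Fin (H - m + 1), Nonempty (CoreRep (Φ.model f') H m h α) :=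
    fun f' hf' h => (hF f' hf').2.2.2.nonempty_coreRep (hvalid f' hf') hm hmH (by omega)
  have hsum := sum_lawDist_le hK (M := fun k => Φ.model (f k)) (fun k => hvalid _ (hfF k)) hN hm
    hmH hα (fun h => (hrep fstar hstar h).some) (fun k h => (hrep (f k) (hfF k) h).some) π
    (fun h => by
      rw [CoreRep.n_eq]
      exact le_trans (by exact_mod_cast psrRank_le hN h) hd) hy hA hα' hH hΓ0 hΓle
  rw [runData, mixtureValue_records_eq (K := K) plan (List.ofFn ω) (by simp), le_div_iff₀ (by linarith)]
  have hterm : ∀ k, optValue (Φ.model fstar) H r -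
      H * lawDist (Φ.model (f k)) (Φ.model fstar) H (π k) ≤ value (Φ.model fstar) H r (π k) := by
    intro k
    linarith [hvalue k, value_sub_le (M := Φ.model (f k)) (N := Φ.model fstar) hr (π k)]
  have htotal := Finset.sum_le_sum fun k (_ : k ∈ (Finset.univ : Finset (Fin K))) => hterm k
  rw [Finset.sum_sub_distrib, ← Finset.mul_sum, Finset.sum_const, Finset.card_univ,
    Fintype.card_fin, nsmul_eq_mul] at htotal
  have hfinal : (H : ℝ) * ∑ k, lawDist (Φ.model (f k)) (Φ.model fstar) H (π k) ≤ ε * K := by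
    refine le_trans ?_ hnum2
    exact mul_le_mul hH hsum (Finset.sum_nonneg fun k _ => lawDist_nonneg _ _ _ _) (by linarith)
  refine le_trans ?_ htotal
  linarith

end Run

end

/-- The polynomial `(10⁹ (1 + x₁ + ⋯ + x₇)²⁰)⁴`. The fourth power leaves room for the square
of the logarithm of the number of iterations. -/
def samplePoly : MvPolynomial (Fin 7) ℕ :=
  (10 ^ 9 * (1 + ∑ i, MvPolynomial.X i) ^ 20) ^ 4

lemma aeval_samplePoly (v : Fin 7 → ℝ) :
    MvPolynomial.aeval v samplePoly = (10 ^ 9 * (1 + ∑ i, v i) ^ 20) ^ 4 := by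
  simp only [samplePoly, map_pow, map_mul, map_add, map_one, map_sum, map_ofNat,
    MvPolynomial.aeval_X]

end Crane

end

theorem corollary5 :
    ∃ (c : ℝ) (P : MvPolynomial (Fin 7) ℕ), 0 < c ∧
      ∀ (S O A : Type*) [Fintype S] [Fintype O] [Fintype A] [Nonempty A]
        (d₁ d₂ d₃ d₄ d₅ H m : ℕ) (Φ : Features S O A d₁ d₂ d₃ d₄ d₅)
        (r : ℕ → O → A → ℝ) (α δ ε : ℝ)
        (F : Set (LinParam d₁ d₂ d₃ d₄ d₅)) (fstar : LinParam d₁ d₂ d₃ d₄ d₅)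
        (K : ℕ) (plan : Planner O A d₁ d₂ d₃ d₄ d₅ H m),
        1 ≤ m → m ≤ H →
        Φ.IsBounded H →
        (∀ h ∈ Finset.Icc 1 H, ∀ o a, 0 ≤ r h o a ∧ r h o a ≤ 1) →
        0 < α → 0 < δ → δ ≤ 1 → 0 < ε →
        (∀ f ∈ F, Φ.IsAdmissible H m α f) →
        fstar ∈ F →
        (Φ.model fstar).IsWeaklyRevealing H m →
        1 ≤ K →
        1 / ε ^ 2 *
            MvPolynomial.aeval
              ![((max d₁ (max d₂ (max d₃ (max d₄ d₅))) : ℕ) : ℝ),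
                (Fintype.card A : ℝ) ^ m,
                1 / α,
                (H : ℝ),
                Real.log (Fintype.card O),
                Real.log (1 / δ),
                Real.log (1 + 1 / ε)] P ≤ (K : ℝ) →
        IsCrane Φ F r (slackness c Φ H m K F δ) (Φ.model fstar) K plan →
        1 - δ ≤ runProb (Φ.model fstar) plan
          {ω : Fin K → Batch O A H m |
            optValue (Φ.model fstar) H r - ε ≤
              mixtureValue (Φ.model fstar) H r ((runData plan ω).map Prod.fst)} := by
  refine ⟨1, samplePoly, one_pos, ?_⟩
  intro S O A _ _ _ _ d₁ d₂ d₃ d₄ d₅ H m Φ r α δ ε F fstar K plan hm hmH hΦ hr hα hδ hδ1 hε hF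
    hstar hW hK hP hplan
  have hvalid : ∀ f ∈ F, (Φ.model f).IsValid H := fun f hf => (hF f hf).2.1
  have hN := hvalid fstar hstar
  have hH1 : 1 ≤ H := hm.trans hmH
  rw [aeval_samplePoly, Fin.sum_univ_seven] at hP
  simp only [Matrix.cons_val] at hP
  obtain ⟨y, hy⟩ : ∃ y : ℝ, y = 1 + (((max d₁ (max d₂ (max d₃ (max d₄ d₅))) : ℕ) : ℝ) +
    (Fintype.card A : ℝ) ^ m + 1 / α + (H : ℝ) + Real.log (Fintype.card O) +
    Real.log (1 / δ) + Real.log (1 + 1 / ε)) := ⟨_, rfl⟩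
  rw [← hy] at hP
  have h0 : (0 : ℝ) ≤ ((max d₁ (max d₂ (max d₃ (max d₄ d₅))) : ℕ) : ℝ) := Nat.cast_nonneg _
  have h1 : (0 : ℝ) ≤ (Fintype.card A : ℝ) ^ m := by positivity
  have h2 : 0 ≤ 1 / α := by positivity
  have h3 : (0 : ℝ) ≤ H := Nat.cast_nonneg _
  have h4 : 0 ≤ Real.log (Fintype.card O) :=
    Real.log_nonneg (by exact_mod_cast card_obs_pos hN hH1)
  have h5 : 0 ≤ Real.log (1 / δ) := Real.log_nonneg (by rw [le_div_iff₀ hδ]; linarith)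
  have h6 : 0 ≤ Real.log (1 + 1 / ε) := Real.log_nonneg (by
    have : 0 < 1 / ε := by positivity
    linarith)
  have hy1 : 1 ≤ y := by linarith only [hy, h0, h1, h2, h3, h4, h5, h6]
  have hdy : ((max d₁ (max d₂ (max d₃ (max d₄ d₅))) : ℕ) : ℝ) ≤ y := by
    linarith only [hy, h0, h1, h2, h3, h4, h5, h6]
  have hAy : (Fintype.card A : ℝ) ^ m ≤ y := by linarith only [hy, h0, h1, h2, h3, h4, h5, h6]
  have hαy : 1 / α ≤ y := by linarith only [hy, h0, h1, h2, h3, h4, h5, h6]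
  have hHy : (H : ℝ) ≤ y := by linarith only [hy, h0, h1, h2, h3, h4, h5, h6]
  have hOy : Real.log (Fintype.card O) ≤ y := by linarith only [hy, h0, h1, h2, h3, h4, h5, h6]
  have hδy : Real.log (1 / δ) ≤ y := by linarith only [hy, h0, h1, h2, h3, h4, h5, h6]
  have hεy : Real.log (1 + 1 / ε) ≤ y := by linarith only [hy, h0, h1, h2, h3, h4, h5, h6]
  clear hy h0 h1 h2 h3 h4 h5 h6
  have hK' : (1 : ℝ) ≤ K := by exact_mod_cast hK
  rcases le_or_gt (H : ℝ) ε with hHε | hHε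
  · -- Values lie between `0` and `H`, so every policy is `ε`-optimal.
    have h := one_sub_le_runProb hN plan (K := K) (n := 0) (β := 0) (η := 0) Fin.elim0
      (fun i => i.elim0) le_rfl (fun i => i.elim0) (by simp)
      {ω : Fin K → Batch O A H m | optValue (Φ.model fstar) H r - ε ≤
        mixtureValue (Φ.model fstar) H r ((runData plan ω).map Prod.fst)} (fun ω _ _ => by
          rw [Set.mem_ofPred_eq, runData, mixtureValue_records_eq (K := K) plan (List.ofFn ω) (by simp)]
          have hle : optValue (Φ.model fstar) H r ≤ H := ciSup_le fun π => value_le hN hr π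
          refine le_trans (by linarith only [hle, hHε]) (div_nonneg (Finset.sum_nonneg fun k _ => ?_)
            (Nat.cast_nonneg K))
          exact value_nonneg hN hr _)
    refine le_trans ?_ h
    simp only [Nat.cast_zero, mul_zero, zero_mul, sub_zero]
    linarith only [hδ]
  -- This makes up for the factor `4` in the probability of an atypical run.
  have hK4 : (4 : ℝ) ≤ K := by
    refine le_trans ?_ hP
    have e1 : ε ^ 2 ≤ y ^ 2 := pow_le_pow_left₀ hε.le (hHε.le.trans hHy) 2
    have e2 : y ^ 2 ≤ y ^ 80 := pow_le_pow_right₀ hy1 (by norm_num)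
    rw [one_div, ← div_eq_inv_mul, le_div_iff₀ (by positivity)]
    have e3 : (10 ^ 9 * y ^ 20) ^ 4 = 10 ^ 36 * y ^ 80 := by ring
    rw [e3]
    have e4 : 0 ≤ y ^ 80 := by positivity
    linarith only [e1, e2, e4]
  obtain ⟨n, g₁, g₂, hg, hexp, hβ0, hβ1⟩ := slackness_bounds hΦ
    (fun f hf => ⟨(hF f hf).1, (hF f hf).2.1⟩) hstar hW hm hmH hK hδ hδ1 hy1
    hdy hAy hHy hOy hδy
  set β := slackness 1 Φ H m K F δ with hβ
  have hD1 : 1 ≤ dataSize A H m K := one_le_dataSize hK hH1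
  set η := 1 / dataSize A H m K with hη
  have hη0 : 0 ≤ η := by positivity
  have hη1 : η ≤ 1 := by rw [hη, div_le_one (one_pos.trans_le hD1)]; exact hD1
  have hηK : K * Fintype.card (Index A H m) * η ≤ 1 := by
    rw [hη, mul_one_div, div_le_one (one_pos.trans_le hD1), dataSize, mul_assoc (K : ℝ) H]
    exact mul_le_mul_of_nonneg_left (card_index_le hm hmH) (Nat.cast_nonneg _)
  obtain ⟨g, hg0, hg1, hgF⟩ := exists_upper_bracket hvalid hη0 hg
  have hmain := one_sub_le_runProb hN plan (K := K) (β := β) g hg0 hη0 hg1 hηK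
    {ω : Fin K → Batch O A H m | optValue (Φ.model fstar) H r - ε ≤
        mixtureValue (Φ.model fstar) H r ((runData plan ω).map Prod.fst)}
    (fun ω hpos htyp => optValue_sub_le_mixtureValue hm hmH hα hF hstar hK hr hplan hη0 hη1 hηK
      hg1 hgF hy1 hdy hAy hαy hHy hβ0 hβ1
      (log_sq_div_sqrt_le hK' hy1 hε hεy hP) ω hpos htyp)
  refine le_trans ?_ hmain
  have hfail : 4 * n * Real.exp (-β) ≤ δ := by
    rw [Real.exp_neg, hexp, inv_div, ← mul_div_assoc]
    refine div_le_of_le_mul₀ (by positivity) hδ.le ?_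
    have hD4 : 4 ≤ dataSize A H m K := by
      have e1 : (1 : ℝ) ≤ H := by exact_mod_cast hH1
      have e2 := one_le_card_pow A (m - 1)
      have e3 : (1 : ℝ) ≤ H * (Fintype.card A : ℝ) ^ (m - 1) :=
        one_le_mul_of_one_le_of_one_le e1 e2
      rw [dataSize, mul_assoc]
      exact hK4.trans (le_mul_of_one_le_right (Nat.cast_nonneg K) e3)
    have hn0 : (0 : ℝ) ≤ n := Nat.cast_nonneg _
    linarith only [mul_le_mul_of_nonneg_left hD4 (mul_nonneg hn0 hδ.le)]
  linarith only [hfail]
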